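/- Let $K$ be a field of characteristic different from $2$ with algebraic closure $\bar K$, let $n\ge 3$, and let $R=K[x_1,\dots,x_{n-1}]$ be the coordinate ring of $\mathbb P^{n-2}$. Let $X\subset\mathbb P^{n-2}$ be a set of $n$ points in general position defined over $K$: $X(\bar K)$ consists of $n$ points, no $n-1$ of which lie in a hyperplane, and the ideal of $X$ over $\bar K$ is generated by its homogeneous ideal $I\subset R$ over $K$. Let $F_\bullet$ be a minimal graded free resolution of $R/I$, with maps $F_r\to F_{r-1}$ represented by matrices $\phi_r$ with respect to homogeneous bases. Then $F_0$ and $F_{n-2}$ have rank $1$. For $1\le a_1,\dots,a_{n-2}\le n-1$ put \[ [a_1,\dots,a_{n-2}]=\frac{\partial\phi_1}{\partial x_{a_1}}\cdots\frac{\partial\phi_{n-2}}{\partial x_{a_{n-2}}},\qquad [[a_1,\dots,a_{n-2}]]=\sum_{k=1}^{n-2}[a_{\sigma^{2k}(1)},\dots,a_{\sigma^{2k}(n-2)}], \] where $\sigma$ is the cycle $(1\,2\,\dots\,n-2)$, and for $1\le j\le n-1$ put \[ \Omega_j=(-1)^j[[1,\dots,\widehat{j},\dots,n-1]]. \] These $1\times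 1$ matrices are forms of degree $2$ (or zero). Let $V=\langle x_1,\dots,x_{n-1}\rangle$ be the space of linear forms, with dual basis $x_1^*,\dots,x_{n-1}^*$ of $V^*$, identify $S^2V$ with the space of quadratic forms in $R$, and let \[ \Omega=\sum_{j=1}^{n-1}x_j^*\otimes\Omega_j\in V^*\otimes S^2V. \] Let $g=(g_{ij})\in\mathrm{GL}_{n-1}(K)$, put $x_j'=\sum_{i=1}^{n-1}g_{ij}x_i$, and let $F'_\bullet$ be the resolution with matrices $\phi_r'(x_1,\dots,x_{n-1})=\phi_r(x_1',\dots,x_{n-1}')$. Let $\Omega'$ be the element of $V^*\otimes S^2V$ defined from $F'_\bullet$ by the same formulas (its forms $\Omega_j'$ are again of degree $2$ or zero). Then \[ \Omega'=(\det g)\,(g\cdot\Omega), \] where $g$ acts on $V^*\otimes S^2V$ in the standard way: $(g\cdot f)(x_1,\dots,x_{n-1})=f(x_1',\dots,x_{n-1}')$ on $V$ and on $S^2V$, and $(g\cdot\ell)(v)=\ell(g^{-1}\cdot v)$ on $V^*$. -/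

import Mathlib

open scoped TensorProduct LinearAlgebra.Projectivization

noncomputable section

namespace PointsResolution

open MvPolynomial

/-! ### Sets of points in projective space

Throughout, `m = n - 2`.  The coordinates on projective space of dimension `n - 2 = m` are
`x_0, …, x_m`, indexed by `Fin (m + 1)` (so that the usual index `j ∈ {1, …, n - 1}` is
`(j : Fin (m + 1)) + 1`). -/

/-- The affine cone (without its vertex) over a finite set of geometric points. -/
def cone {L : Type*} [Field L] {m : ℕ} (X : Finset (ℙ L (Fin (m + 1) → L))) :
    Set (Fin (m + 1) → L) :=
  {v | ∃ hv : v ≠ 0, Projectivization.mk L v hv ∈ X}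

/-- The homogeneous ideal in `K[x_0, …, x_m]` of a set of points over the algebraic closure of `K`:
the polynomials that vanish at all homogeneous coordinate vectors of all the points.  (As the
algebraic closure is infinite, this ideal is generated by the forms vanishing on the points.) -/
def homogeneousIdeal (K : Type*) [Field K] {m : ℕ}
    (X : Finset (ℙ (AlgebraicClosure K) (Fin (m + 1) → AlgebraicClosure K))) :
    Ideal (MvPolynomial (Fin (m + 1)) K) :=
  vanishingIdeal K (cone X)

/-- `X` is the set of geometric points of a set of `n = m + 2` points in general position in
projective space of dimension `n - 2 = m`, defined over `K`. -/
structure IsPointsInGeneralPosition (K : Type*) [Field K] {m : ℕ}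
    (X : Finset (ℙ (AlgebraicClosure K) (Fin (m + 1) → AlgebraicClosure K))) : Prop where
  /-- there are `n` geometric points -/
  card_eq : X.card = m + 2
  /-- no subset of size `n - 1` is contained in a hyperplane -/
  not_in_hyperplane : ∀ S ⊆ X, S.card = m + 1 →
    ∀ f : Module.Dual (AlgebraicClosure K) (Fin (m + 1) → AlgebraicClosure K), f ≠ 0 →
      ∃ P ∈ S, f P.rep ≠ 0
  /-- `X` is defined over `K`: its ideal over the algebraic closure is generated by polynomials
  with coefficients in `K` -/
  defined_over : vanishingIdeal (AlgebraicClosure K) (cone X) =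
    (homogeneousIdeal K X).map (MvPolynomial.map (algebraMap K (AlgebraicClosure K)))

/-! ### Minimal graded free resolutions, given by matrices -/

/-- A polynomial that is homogeneous of the (possibly negative) integer degree `e`: it is zero, or
`e` is a natural number and it is homogeneous of degree `e`. -/
def IsHomogeneousOfDegree {σ K : Type*} [CommRing K] (p : MvPolynomial σ K) (e : ℤ) : Prop :=
  p = 0 ∨ ∃ d : ℕ, (d : ℤ) = e ∧ p.IsHomogeneous d

/-- A sequence of finitely generated free `R`-modules `F_k`, for `k ≥ 0`, over `R = K[x_s : s ∈ σ]`,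
with chosen bases and with the maps `F_{k+1} → F_k` given by matrices acting on column vectors.
The basis vector `i` of `F_k` sits in degree `deg k i`, that is `F_k = ⨁_i R(-deg k i)`. -/
structure FreeSequence (σ K : Type*) [CommRing K] where
  /-- the rank of `F_k` -/
  rank : ℕ → ℕ
  /-- the degrees of the basis vectors of `F_k` -/
  deg : ∀ k, Fin (rank k) → ℤ
  /-- `diff k` is the matrix `φ_{k+1}` of the map `F_{k+1} → F_k` -/
  diff : ∀ k, Matrix (Fin (rank k)) (Fin (rank (k + 1))) (MvPolynomial σ K)

/-- `F` is a minimal graded free resolution of the graded `R`-module `R ⧸ I`. -/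
structure FreeSequence.IsMinimalFreeResolution {σ K : Type*} [CommRing K]
    (F : FreeSequence σ K) (I : Ideal (MvPolynomial σ K)) : Prop where
  finite_length : ∃ r, ∀ k, r < k → F.rank k = 0
  /-- the maps respect the gradings -/
  graded : ∀ k i j, IsHomogeneousOfDegree (F.diff k i j) (F.deg (k + 1) j - F.deg k i)
  /-- `F` is a complex, exact in positive degrees -/
  exact : ∀ k, Function.Exact (F.diff (k + 1)).mulVecLin (F.diff k).mulVecLin
  /-- `H_0(F)` is isomorphic to `R ⧸ I` as a graded module -/
  augmentation : ∃ ε : (Fin (F.rank 0) → MvPolynomial σ K) →ₗ[MvPolynomial σ K]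
      (MvPolynomial σ K ⧸ I),
    Function.Surjective ε ∧ Function.Exact (F.diff 0).mulVecLin ε ∧
      ∀ i, ∃ p : MvPolynomial σ K, IsHomogeneousOfDegree p (F.deg 0 i) ∧
        ε (Pi.single i 1) = Ideal.Quotient.mk I p
  /-- minimality: `φ_{k+1}(F_{k+1}) ⊆ 𝔪 F_k`, where `𝔪` is generated by the variables -/
  minimal : ∀ k i j, F.diff k i j ∈ Ideal.span (Set.range (X : σ → MvPolynomial σ K))

/-! ### The bracket symbols and the forms `Ω_j` -/

/-- The matrix product `∂φ_1/∂x_{a 0} * ∂φ_2/∂x_{a 1} * ⋯ * ∂φ_k/∂x_{a (k-1)}`, of size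
`rank 0 × rank k`.  For `k = m = n - 2` this is the symbol `[a_1, …, a_{n-2}]`. -/
def FreeSequence.bracket {σ K : Type*} [CommRing K] (F : FreeSequence σ K) :
    (k : ℕ) → (Fin k → σ) → Matrix (Fin (F.rank 0)) (Fin (F.rank k)) (MvPolynomial σ K)
  | 0, _ => 1
  | k + 1, a => F.bracket k (fun i => a i.castSucc) *
      (F.diff k).map (fun p => pderiv (a (Fin.last k)) p)

/-- The symbol `[[a_1, …, a_m]] = ∑_{k=1}^m [a_{σ^{2k}(1)}, …, a_{σ^{2k}(m)}]`, where `σ` is the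
`m`-cycle `(1 2 … m)`. -/
def FreeSequence.doubleBracket {σ K : Type*} [CommRing K] (F : FreeSequence σ K)
    (m : ℕ) (a : Fin m → σ) :
    Matrix (Fin (F.rank 0)) (Fin (F.rank m)) (MvPolynomial σ K) :=
  ∑ k ∈ Finset.Icc 1 m, F.bracket m (fun i => a (((finRotate m) ^ (2 * k)) i))

/-- `Ω_j = (-1)^j [[1, 2, …, ĵ, …, n - 1]]` (here `j` is counted from `0`, whence `j + 1`).  For a
resolution of `n` points in general position this is a `1 × 1` matrix. -/
def FreeSequence.omega {K : Type*} [CommRing K] {m : ℕ} (F : FreeSequence (Fin (m + 1)) K)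
    (j : Fin (m + 1)) : Matrix (Fin (F.rank 0)) (Fin (F.rank m)) (MvPolynomial (Fin (m + 1)) K) :=
  (-1 : MvPolynomial (Fin (m + 1)) K) ^ ((j : ℕ) + 1) • F.doubleBracket m j.succAbove

/-! ### Changes of coordinates -/

/-- The substitution `x_j ↦ x'_j = ∑_i g_{ij} x_i`, that is `f ↦ f(x'_0, …, x'_m)`. -/
def subst {K : Type*} [Field K] {m : ℕ} (g : GL (Fin (m + 1)) K) :
    MvPolynomial (Fin (m + 1)) K →ₐ[K] MvPolynomial (Fin (m + 1)) K :=
  aeval (fun j => ∑ i, C (g.1 i j) * X i)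

/-- The sequence `F'` with matrices `φ'_r(x_0, …, x_m) = φ_r(x'_0, …, x'_m)`. -/
def FreeSequence.changeCoordinates {K : Type*} [Field K] {m : ℕ}
    (F : FreeSequence (Fin (m + 1)) K) (g : GL (Fin (m + 1)) K) :
    FreeSequence (Fin (m + 1)) K where
  rank := F.rank
  deg := F.deg
  diff k := (F.diff k).map (subst g)

/-- `S^d V`, identified with the space of forms of degree `d` in `K[x_0, …, x_m]`. -/
abbrev Forms (K : Type*) [Field K] (m d : ℕ) : Submodule K (MvPolynomial (Fin (m + 1)) K) :=
  homogeneousSubmodule (Fin (m + 1)) K d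

theorem subst_mem_forms {K : Type*} [Field K] {m : ℕ} (g : GL (Fin (m + 1)) K) (d : ℕ) :
    ∀ p ∈ Forms K m d, (subst g).toLinearMap p ∈ Forms K m d := by
  intro p hp
  rw [mem_homogeneousSubmodule] at hp ⊢
  have h := hp.aeval (fun j => ∑ i, C (g.1 i j) * (X i : MvPolynomial (Fin (m + 1)) K)) (n := 1)
    (fun j => IsHomogeneous.sum _ _ _ fun i _ => by
      simpa using (isHomogeneous_C (Fin (m + 1)) (g.1 i j)).mul (isHomogeneous_X K i))
  simpa [subst] using h

/-- The action of `g` on `S^d V`: `(g • f)(x) = f(x')`.  For `d = 1` it is the action on `V`. -/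
def actForms {K : Type*} [Field K] {m : ℕ} (g : GL (Fin (m + 1)) K) (d : ℕ) :
    Forms K m d →ₗ[K] Forms K m d :=
  (subst g).toLinearMap.restrict (subst_mem_forms g d)

/-- The contragredient action of `g` on `V^*`: `(g • ℓ)(v) = ℓ(g⁻¹ • v)`, where `V` is the space
of linear forms. -/
def actDual {K : Type*} [Field K] {m : ℕ} (g : GL (Fin (m + 1)) K) :
    Module.Dual K (Forms K m 1) →ₗ[K] Module.Dual K (Forms K m 1) :=
  Module.Dual.transpose (actForms g⁻¹ 1)

/-- The action of `g` on `V^* ⊗ S² V`. -/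
def actTensor {K : Type*} [Field K] {m : ℕ} (g : GL (Fin (m + 1)) K) :
    Module.Dual K (Forms K m 1) ⊗[K] Forms K m 2 →ₗ[K]
      Module.Dual K (Forms K m 1) ⊗[K] Forms K m 2 :=
  TensorProduct.map (actDual g) (actForms g 2)

/-- The element `x_j^*` of the basis of `V^*` dual to the basis `x_0, …, x_m` of `V`: it sends a
linear form to its coefficient at `x_j`. -/
def dualVar (K : Type*) [Field K] {m : ℕ} (j : Fin (m + 1)) : Module.Dual K (Forms K m 1) :=
  (lcoeff K (Finsupp.single j 1)).comp (Forms K m 1).subtype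

/-- The tensor `∑_j x_j^* ⊗ q_j ∈ V^* ⊗ S² V`. -/
def tensorOf {K : Type*} [Field K] {m : ℕ} (q : Fin (m + 1) → Forms K m 2) :
    Module.Dual K (Forms K m 1) ⊗[K] Forms K m 2 :=
  ∑ j, dualVar K j ⊗ₜ[K] q j

end PointsResolution

end

/-!
The double bracket `[[v_1, …, v_m]]`, where the partial derivatives are replaced by directional
derivatives along vectors `v_i`, is an alternating multilinear form in the `v_i` with values in the
quadratic forms. Hence `(v_0, …, v_m) ↦ ∑_j (-1)^j v_j ⊗ [[v_0, …, v̂_j, …, v_m]]` is an alternating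
form of top degree on `K^{m+1}` with values in `V^* ⊗ S² V`. By the chain rule a change of
coordinates turns its value `-Ω` at the standard basis into its value at the rows of `g`, up to the
action of `g` on `V^* ⊗ S² V`. An alternating form of top degree is multiplied by the determinant,
and this is the factor `det g` (`tensorOf_omega_changeCoordinates`).

*The shape of the resolution.* Over the algebraic closure there is a linear form `l` that vanishes
at none of the points. The values of linear forms at the points satisfy exactly one linear relation
`λ`, all of whose coefficients are nonzero. Therefore `R ⧸ (I + (l))` is an Artinian Gorenstein
algebra with Hilbert function `(1, m, 1)` and with the pairing `(a, b) ↦ λ(a b)` of linear forms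
(`exists_isGorensteinSystem`). The homology of `F ⊗ R ⧸ (y_0, …, y_i)`, for a basis
`y_0 = l, y_1, …, y_m` of the linear forms, is computed by induction on `i` with the long exact
sequences for the multiplication by `y_i`. For `i = m` this gives the ranks and degrees: all
matrices but the first and the last are linear, `F_m` has rank one and is generated in degree
`m + 2`, and `F_{m+1} = 0` (`deg_eq`, `rank_and_deg_top`, `rank_eq_zero`).

*Alternation.* Let `E(c_2, …, c_m) = φ_1 ∂φ_2/∂c_2 ⋯ ∂φ_m/∂c_m`. Differentiating `φ_r φ_{r+1} = 0`
once and twice shows that `E` and the middle arguments of the bracket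
`T(a_1, …, a_m) = ∂φ_1/∂a_1 ⋯ ∂φ_m/∂a_m` are alternating, and that the antisymmetrization of `T` in
its first and its last argument is a difference of partial derivatives of `E`
(`chain_derivs_sub`). The resolution carries a multiplication that satisfies the Leibniz rule
(`leibniz`). Its pairings `F_k ⊗ F_{m-k} → F_m` make the matrices `φ_k` and `φ_{m+1-k}` transposes
of each other up to sign, so that `T` is equal to the bracket with reversed arguments up to the sign
of the reversal (`chain_derivs_reverse`). Thus `T` is antisymmetric in its first and last argument,
and `2 T` is a sum of two partial derivatives of `E`. Summing over the rotations
`σ^{2k}` shows that the double bracket is the exterior derivative of `E`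
(`sum_chain_derivs_rotate`).
-/

namespace PointsResolution
open MvPolynomial

/-! ### Homogeneous components in integer degrees -/

theorem isHomogeneousOfDegree_iff {σ K : Type*} [CommRing K] {p : MvPolynomial σ K} {e : ℤ} :
    IsHomogeneousOfDegree p e ↔ ∀ d, coeff d p ≠ 0 → ((d.degree : ℕ) : ℤ) = e := by
  constructor
  · rintro (rfl | ⟨n, rfl, hp⟩) d hd
    · simp at hd
    · by_contra h
      exact hd (hp.coeff_eq_zero fun h' => h (by rw [h']))
  · intro h
    by_cases hp : p = 0
    · exact Or.inl hp
    obtain ⟨d, hd⟩ := MvPolynomial.ne_zero_iff.1 hp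
    refine Or.inr ⟨d.degree, h d hd, fun d' hd' => ?_⟩
    have h1 := h d hd
    have h2 := h d' hd'
    have h3 : Finsupp.weight 1 d' = d'.degree := by
      rw [Finsupp.degree_eq_weight_one]
      rfl
    rw [h3]
    omega

theorem isHomogeneousOfDegree_natCast {σ K : Type*} [CommRing K] {p : MvPolynomial σ K} {d : ℕ} :
    IsHomogeneousOfDegree p d ↔ p.IsHomogeneous d := by
  constructor
  · rintro (rfl | ⟨n, hn, hp⟩)
    · exact isHomogeneous_zero _ _ _
    · obtain rfl : n = d := by exact_mod_cast hn
      exact hp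
  · exact fun hp => Or.inr ⟨d, rfl, hp⟩

theorem IsHomogeneousOfDegree.add {σ K : Type*} [CommRing K] {p q : MvPolynomial σ K} {e : ℤ}
    (hp : IsHomogeneousOfDegree p e) (hq : IsHomogeneousOfDegree q e) :
    IsHomogeneousOfDegree (p + q) e := by
  rw [isHomogeneousOfDegree_iff] at *
  intro d hd
  by_cases h : coeff d p = 0
  · refine hq d fun h' => hd ?_
    rw [coeff_add, h, h', add_zero]
  · exact hp d h

theorem IsHomogeneousOfDegree.sum {σ K ι : Type*} [CommRing K] {s : Finset ι}
    {p : ι → MvPolynomial σ K} {e : ℤ} (hp : ∀ i ∈ s, IsHomogeneousOfDegree (p i) e) :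
    IsHomogeneousOfDegree (∑ i ∈ s, p i) e :=
  Finset.sum_induction p (IsHomogeneousOfDegree · e) (fun _ _ => .add) (Or.inl rfl) hp

theorem IsHomogeneousOfDegree.mul {σ K : Type*} [CommRing K] {p q : MvPolynomial σ K} {e e' : ℤ}
    (hp : IsHomogeneousOfDegree p e) (hq : IsHomogeneousOfDegree q e') :
    IsHomogeneousOfDegree (p * q) (e + e') := by
  rcases hp with rfl | ⟨n, rfl, hp⟩
  · exact Or.inl (zero_mul q)
  rcases hq with rfl | ⟨n', rfl, hq⟩
  · exact Or.inl (mul_zero p)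
  exact Or.inr ⟨n + n', by push_cast; rfl, hp.mul hq⟩

theorem IsHomogeneousOfDegree.sub {σ K : Type*} [CommRing K] {p q : MvPolynomial σ K} {e : ℤ}
    (hp : IsHomogeneousOfDegree p e) (hq : IsHomogeneousOfDegree q e) :
    IsHomogeneousOfDegree (p - q) e := by
  have h : IsHomogeneousOfDegree (-q) e := by
    rw [isHomogeneousOfDegree_iff] at *
    intro d hd
    exact hq d (by simpa using hd)
  simpa [sub_eq_add_neg] using hp.add h

/-- The homogeneous component of integer degree `e`; it is zero if `e` is negative. -/
noncomputable def comp {σ K : Type*} [CommRing K] (e : ℤ) :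
    MvPolynomial σ K →ₗ[K] MvPolynomial σ K :=
  if 0 ≤ e then homogeneousComponent e.toNat else 0

theorem coeff_comp {σ K : Type*} [CommRing K] (e : ℤ) (p : MvPolynomial σ K) (d : σ →₀ ℕ) :
    coeff d (comp e p) = if ((d.degree : ℕ) : ℤ) = e then coeff d p else 0 := by
  unfold comp
  split_ifs with h1 h2 h2
  · rw [coeff_homogeneousComponent, if_pos (by omega)]
  · rw [coeff_homogeneousComponent, if_neg (by omega)]
  · omega
  · simp

theorem isHomogeneousOfDegree_comp {σ K : Type*} [CommRing K] (e : ℤ) (p : MvPolynomial σ K) :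
    IsHomogeneousOfDegree (comp e p) e := by
  rw [isHomogeneousOfDegree_iff]
  intro d hd
  rw [coeff_comp] at hd
  by_contra h
  exact hd (if_neg h)

theorem comp_eq_self {σ K : Type*} [CommRing K] {e : ℤ} {p : MvPolynomial σ K}
    (hp : IsHomogeneousOfDegree p e) : comp e p = p := by
  rw [isHomogeneousOfDegree_iff] at hp
  ext d
  rw [coeff_comp]
  split_ifs with h
  · rfl
  · by_contra h'
    exact h (hp d (Ne.symm h'))

theorem comp_zero {σ K : Type*} [CommRing K] (p : MvPolynomial σ K) :
    comp 0 p = C (constantCoeff p) := by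
  simp [comp, constantCoeff_eq]

theorem comp_mul {σ K : Type*} [CommRing K] {e : ℤ} {q : MvPolynomial σ K}
    (hq : IsHomogeneousOfDegree q e) (e' : ℤ) (p : MvPolynomial σ K) :
    comp e' (q * p) = q * comp (e' - e) p := by
  classical
  rw [isHomogeneousOfDegree_iff] at hq
  ext d
  rw [coeff_comp, coeff_mul, coeff_mul, eq_comm,
    Finset.sum_congr rfl (g := fun x : (σ →₀ ℕ) × (σ →₀ ℕ) =>
      if ((d.degree : ℕ) : ℤ) = e' then coeff x.1 q * coeff x.2 p else 0)]
  · split_ifs <;> simp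
  intro x hx
  rw [coeff_comp]
  by_cases h0 : coeff x.1 q = 0
  · simp [h0]
  have h1 := hq _ h0
  have h2 : d.degree = x.1.degree + x.2.degree := by
    rw [← Finset.HasAntidiagonal.mem_antidiagonal.1 hx, map_add]
  have h3 : ((x.2.degree : ℕ) : ℤ) = e' - e ↔ ((d.degree : ℕ) : ℤ) = e' := by
    constructor <;> intro <;> omega
  simp only [h3]
  split_ifs <;> simp

/-! ### Koszul homology of a resolution along a sequence of linear forms -/

/-- The properties of a minimal graded free resolution of `R ⧸ I` that are used to determine its
ranks and degrees: `F_0 = R` and the image of `F_1` in `F_0` is `I`. -/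
structure FreeSequence.IsMinimalCyclicResolution {σ K : Type*} [CommRing K]
    (F : FreeSequence σ K) (I : Ideal (MvPolynomial σ K)) : Prop where
  rank_zero : F.rank 0 = 1
  deg_zero : ∀ i, F.deg 0 i = 0
  graded : ∀ k i j, IsHomogeneousOfDegree (F.diff k i j) (F.deg (k + 1) j - F.deg k i)
  exact : ∀ k, Function.Exact (F.diff (k + 1)).mulVecLin (F.diff k).mulVecLin
  minimal : ∀ k i j, F.diff k i j ∈ Ideal.span (Set.range (X : σ → MvPolynomial σ K))
  range : ∀ z : Fin (F.rank 0) → MvPolynomial σ K,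
    (∃ u, (F.diff 0).mulVec u = z) ↔ ∀ s, z s ∈ I

/-- The ideal generated by `y_0, …, y_{i-1}`. -/
def initialIdeal {R : Type*} [CommRing R] (y : ℕ → R) (i : ℕ) : Ideal R :=
  Ideal.span (y '' Set.Iio i)

theorem initialIdeal_zero {R : Type*} [CommRing R] (y : ℕ → R) : initialIdeal y 0 = ⊥ := by
  simp [initialIdeal]

theorem mem_initialIdeal_succ {R : Type*} [CommRing R] {y : ℕ → R} {i : ℕ} {f : R} :
    f ∈ initialIdeal y (i + 1) ↔ ∃ a, f - y i * a ∈ initialIdeal y i := by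
  have : Set.Iio (i + 1) = insert i (Set.Iio i) := by
    ext t
    simp only [Set.mem_Iio, Set.mem_insert_iff]
    omega
  rw [initialIdeal, this, Set.image_insert_eq, Ideal.mem_span_insert]
  constructor
  · rintro ⟨a, z, hz, rfl⟩
    exact ⟨a, by rwa [mul_comm, add_sub_cancel_left]⟩
  · rintro ⟨a, ha⟩
    exact ⟨a, f - y i * a, ha, by ring⟩

theorem initialIdeal_mono {R : Type*} [CommRing R] (y : ℕ → R) {i j : ℕ} (h : i ≤ j) :
    initialIdeal y i ≤ initialIdeal y j :=
  Ideal.span_mono (Set.image_mono (Set.Iio_subset_Iio h))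

theorem mem_initialIdeal {R : Type*} [CommRing R] (y : ℕ → R) {t i : ℕ} (h : t < i) :
    y t ∈ initialIdeal y i :=
  Ideal.subset_span ⟨t, h, rfl⟩

theorem comp_mem_initialIdeal {σ K : Type*} [CommRing K] {y : ℕ → MvPolynomial σ K}
    (hy : ∀ i, (y i).IsHomogeneous 1) (i : ℕ) {f : MvPolynomial σ K} (hf : f ∈ initialIdeal y i)
    (e : ℤ) : comp e f ∈ initialIdeal y i := by
  induction i generalizing f with
  | zero =>
    rw [initialIdeal_zero, Ideal.mem_bot] at *
    rw [hf, map_zero]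
  | succ i ih =>
    rw [mem_initialIdeal_succ] at *
    obtain ⟨a, ha⟩ := hf
    refine ⟨comp (e - 1) a, ?_⟩
    rw [← comp_mul (e := 1) (Or.inr ⟨1, rfl, hy i⟩), ← map_sub]
    exact ih ha

/-- The properties of a homogeneous ideal `I` and of a basis `y_0, …, y_m` of the linear forms used
below. They say that `y_0` is a nonzerodivisor modulo `I` and that the quotient of `R` by `I` and
`y_0` is an Artinian Gorenstein algebra with Hilbert function `(1, m, 1)`. -/
structure IsGorensteinSystem {σ K : Type*} [CommRing K] (I : Ideal (MvPolynomial σ K)) (m : ℕ)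
    (y : ℕ → MvPolynomial σ K) : Prop where
  homogeneous : ∀ i, (y i).IsHomogeneous 1
  regular : ∀ i ≤ m, ∀ f, y i * f ∈ initialIdeal y i → f ∈ initialIdeal y i
  initialIdeal_eq : initialIdeal y (m + 1) = Ideal.span (Set.range X)
  nonzerodivisor : ∀ f, y 0 * f ∈ I → f ∈ I
  mem_of_three_le : ∀ d, 3 ≤ d → ∀ f : MvPolynomial σ K, f.IsHomogeneous d →
    f ∈ I ⊔ Ideal.span {y 0}
  quadrics : ∀ f g : MvPolynomial σ K, f.IsHomogeneous 2 → g.IsHomogeneous 2 →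
    ∃ a b : K, (a ≠ 0 ∨ b ≠ 0) ∧ C a * f + C b * g ∈ I ⊔ Ideal.span {y 0}
  dual : ∀ i, 1 ≤ i → i ≤ m → ∃ b : MvPolynomial σ K, b.IsHomogeneous 1 ∧
    (∀ t, 1 ≤ t → t < i → y t * b ∈ I ⊔ Ideal.span {y 0}) ∧ y i * b ∉ I ⊔ Ideal.span {y 0}
  socle : ∀ d ≤ 1, ∀ f : MvPolynomial σ K, f.IsHomogeneous d →
    (∀ t, 1 ≤ t → t ≤ m → y t * f ∈ I ⊔ Ideal.span {y 0}) → f ∈ I ⊔ Ideal.span {y 0}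
  eq_zero_of_mem : ∀ d ≤ 1, ∀ f : MvPolynomial σ K, f.IsHomogeneous d → f ∈ I → f = 0

theorem mem_sup_span_singleton {R : Type*} [CommRing R] {I : Ideal R} {y f : R} :
    f ∈ I ⊔ Ideal.span {y} ↔ ∃ a, f - y * a ∈ I := by
  rw [Submodule.mem_sup]
  constructor
  · rintro ⟨p, hp, q, hq, rfl⟩
    obtain ⟨a, rfl⟩ := Ideal.mem_span_singleton.1 hq
    exact ⟨a, by simpa using hp⟩
  · rintro ⟨a, ha⟩
    exact ⟨_, ha, _, Ideal.mem_span_singleton.2 ⟨a, rfl⟩, by ring⟩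


namespace FreeSequence

variable {σ K : Type*} [Field K] (F : FreeSequence σ K) (y : ℕ → MvPolynomial σ K)

/-- The vector `z ∈ F_k` is homogeneous of degree `j`. -/
def IsHomVec (k : ℕ) (j : ℤ) (z : Fin (F.rank k) → MvPolynomial σ K) : Prop :=
  ∀ s, IsHomogeneousOfDegree (z s) (j - F.deg k s)

/-- The component of degree `j` of a vector in `F_k`. -/
noncomputable def vcomp (k : ℕ) (j : ℤ) (z : Fin (F.rank k) → MvPolynomial σ K) :
    Fin (F.rank k) → MvPolynomial σ K :=
  fun s => comp (j - F.deg k s) (z s)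

/-- The vector `z ∈ F_k` is a cycle of the complex `F ⊗ R ⧸ (y_0, …, y_{i-1})`. -/
def IsCycle (i : ℕ) : (k : ℕ) → (Fin (F.rank k) → MvPolynomial σ K) → Prop
  | 0, _ => True
  | k + 1, z => ∀ s, (F.diff k).mulVec z s ∈ initialIdeal y i

/-- The vector `z ∈ F_k` is a boundary of the complex `F ⊗ R ⧸ (y_0, …, y_{i-1})`. -/
def IsBoundary (i k : ℕ) (z : Fin (F.rank k) → MvPolynomial σ K) : Prop :=
  ∃ u, ∀ s, (z - (F.diff k).mulVec u) s ∈ initialIdeal y i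

/-- The vector `z ∈ F_i` is a cycle of `F ⊗ R ⧸ (y_0, …, y_i)` that the iterated connecting maps of
the long exact sequences for multiplication by `y_i, …, y_1` send to the class of `b` in
`H_0(F ⊗ R ⧸ (y_0)) = R ⧸ (I + (y_0))`. -/
def IsLift : (i : ℕ) → (Fin (F.rank i) → MvPolynomial σ K) → MvPolynomial σ K → Prop
  | 0, z, b => ∀ s, z s = b
  | i + 1, z, b => ∃ w, IsLift i w b ∧
      ∀ s, ((F.diff i).mulVec z - y (i + 1) • w) s ∈ initialIdeal y (i + 1)

variable {F y} {I : Ideal (MvPolynomial σ K)} {m : ℕ}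

theorem isHomVec_vcomp (k : ℕ) (j : ℤ) (z : Fin (F.rank k) → MvPolynomial σ K) :
    F.IsHomVec k j (F.vcomp k j z) := fun _ => isHomogeneousOfDegree_comp _ _

theorem IsHomVec.vcomp_eq {k : ℕ} {j : ℤ} {z : Fin (F.rank k) → MvPolynomial σ K}
    (hz : F.IsHomVec k j z) : F.vcomp k j z = z := funext fun s => comp_eq_self (hz s)

theorem vcomp_sub (k : ℕ) (j : ℤ) (z w : Fin (F.rank k) → MvPolynomial σ K) :
    F.vcomp k j (z - w) = F.vcomp k j z - F.vcomp k j w := by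
  ext1 s
  simp [vcomp]

theorem vcomp_smul {q : MvPolynomial σ K} (hq : q.IsHomogeneous 1) (k : ℕ) (j : ℤ)
    (z : Fin (F.rank k) → MvPolynomial σ K) :
    F.vcomp k j (q • z) = q • F.vcomp k (j - 1) z := by
  ext1 s
  simp only [vcomp, Pi.smul_apply, smul_eq_mul]
  rw [comp_mul (e := 1) (Or.inr ⟨1, rfl, hq⟩), sub_right_comm]

theorem IsHomVec.sub {k : ℕ} {j : ℤ} {z w : Fin (F.rank k) → MvPolynomial σ K}
    (hz : F.IsHomVec k j z) (hw : F.IsHomVec k j w) : F.IsHomVec k j (z - w) :=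
  fun s => (hz s).sub (hw s)

theorem IsHomVec.smul {q : MvPolynomial σ K} (hq : q.IsHomogeneous 1) {k : ℕ} {j : ℤ}
    {z : Fin (F.rank k) → MvPolynomial σ K} (hz : F.IsHomVec k (j - 1) z) :
    F.IsHomVec k j (q • z) := by
  have h := F.isHomVec_vcomp k j (q • z)
  rwa [vcomp_smul hq, hz.vcomp_eq] at h

theorem vcomp_mulVec (hF : ∀ k i j, IsHomogeneousOfDegree (F.diff k i j)
    (F.deg (k + 1) j - F.deg k i)) (k : ℕ) (j : ℤ) (z : Fin (F.rank (k + 1)) → MvPolynomial σ K) :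
    F.vcomp k j ((F.diff k).mulVec z) = (F.diff k).mulVec (F.vcomp (k + 1) j z) := by
  ext1 s
  simp only [vcomp, Matrix.mulVec, dotProduct, map_sum]
  refine Finset.sum_congr rfl fun t _ => ?_
  rw [comp_mul (hF k s t), sub_sub_sub_cancel_right]

theorem vcomp_mem (hy : ∀ i, (y i).IsHomogeneous 1) {i k : ℕ}
    {z : Fin (F.rank k) → MvPolynomial σ K} (hz : ∀ s, z s ∈ initialIdeal y i) (j : ℤ) :
    ∀ s, F.vcomp k j z s ∈ initialIdeal y i :=
  fun s => comp_mem_initialIdeal hy i (hz s) _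

theorem mulVec_mem {i k : ℕ} {z : Fin (F.rank (k + 1)) → MvPolynomial σ K}
    (hz : ∀ s, z s ∈ initialIdeal y i) : ∀ s, (F.diff k).mulVec z s ∈ initialIdeal y i :=
  fun s => by
    rw [Matrix.mulVec, dotProduct]
    exact Ideal.sum_mem _ fun t _ => Ideal.mul_mem_left _ _ (hz t)

theorem mulVec_mulVec_eq_zero (hF : F.IsMinimalCyclicResolution I) (k : ℕ)
    (u : Fin (F.rank (k + 1 + 1)) → MvPolynomial σ K) :
    (F.diff k).mulVec ((F.diff (k + 1)).mulVec u) = 0 :=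
  (hF.exact k).apply_apply_eq_zero u

theorem IsBoundary.mono {i j k : ℕ} (h : i ≤ j) {z : Fin (F.rank k) → MvPolynomial σ K}
    (hz : F.IsBoundary y i k z) : F.IsBoundary y j k z := by
  obtain ⟨u, hu⟩ := hz
  exact ⟨u, fun s => initialIdeal_mono y h (hu s)⟩

/-- Vectors with entries in `(y_0, …, y_i)` are multiples of `y_i`, up to `(y_0, …, y_{i-1})`. -/
theorem exists_sub_smul_mem {i k : ℕ} {z : Fin (F.rank k) → MvPolynomial σ K}
    (hz : ∀ s, z s ∈ initialIdeal y (i + 1)) :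
    ∃ w : Fin (F.rank k) → MvPolynomial σ K, ∀ s, (z - y i • w) s ∈ initialIdeal y i := by
  choose w hw using fun s => mem_initialIdeal_succ.1 (hz s)
  exact ⟨w, hw⟩

theorem isCycle_of_sub_smul_mem (hF : F.IsMinimalCyclicResolution I)
    (hy : IsGorensteinSystem I m y) {i k : ℕ} (hi : i ≤ m)
    {z : Fin (F.rank (k + 1)) → MvPolynomial σ K} {w : Fin (F.rank k) → MvPolynomial σ K}
    (h : ∀ s, ((F.diff k).mulVec z - y i • w) s ∈ initialIdeal y i) : F.IsCycle y i k w := by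
  cases k with
  | zero => trivial
  | succ k =>
    intro s
    refine hy.regular i hi _ ?_
    have h1 := mulVec_mem h s
    rw [Matrix.mulVec_sub, mulVec_mulVec_eq_zero hF, Matrix.mulVec_smul, zero_sub] at h1
    simpa using neg_mem h1

/-- If `φ(z) ≡ y_i w` and `w ≡ φ(u)` modulo `(y_0, …, y_{i-1})`, then `z - y_i u` is a cycle. -/
theorem isCycle_sub_smul {i k : ℕ} {z u : Fin (F.rank (k + 1)) → MvPolynomial σ K}
    {w : Fin (F.rank k) → MvPolynomial σ K}
    (h : ∀ s, ((F.diff k).mulVec z - y i • w) s ∈ initialIdeal y i)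
    (hu : ∀ s, (w - (F.diff k).mulVec u) s ∈ initialIdeal y i) :
    F.IsCycle y i (k + 1) (z - y i • u) := by
  intro s
  have h1 := add_mem (h s) (Ideal.mul_mem_left _ (y i) (hu s))
  rw [Matrix.mulVec_sub, Matrix.mulVec_smul]
  convert h1 using 1
  simp only [Pi.sub_apply, Pi.smul_apply, smul_eq_mul]
  ring

theorem isBoundary_of_sub_smul {i k : ℕ} {z u : Fin (F.rank k) → MvPolynomial σ K}
    (h : F.IsBoundary y i k (z - y i • u)) : F.IsBoundary y (i + 1) k z := by
  obtain ⟨v, hv⟩ := h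
  refine ⟨v, fun s => ?_⟩
  have h1 := add_mem (initialIdeal_mono y (Nat.le_succ i) (hv s))
    (Ideal.mul_mem_right (u s) _ (mem_initialIdeal y (Nat.lt_succ_self i)))
  convert h1 using 1
  simp only [Pi.sub_apply, Pi.smul_apply, smul_eq_mul]
  ring

/-- The homology of `F ⊗ R ⧸ (y_0, …, y_{i-1})` vanishes in homological degrees `k ≥ i`, if
`i ≥ 1`. -/
theorem isBoundary_of_le (hF : F.IsMinimalCyclicResolution I) (hy : IsGorensteinSystem I m y)
    {i : ℕ} (hi : i ≤ m) {k : ℕ} (hk : i ≤ k) {z : Fin (F.rank (k + 1)) → MvPolynomial σ K}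
    (hz : F.IsCycle y (i + 1) (k + 1) z) : F.IsBoundary y (i + 1) (k + 1) z := by
  induction i generalizing k with
  | zero =>
    obtain ⟨w, hw⟩ := exists_sub_smul_mem hz
    obtain ⟨u, hu⟩ : ∃ u, (F.diff k).mulVec u = w := by
      have h : (F.diff k).mulVec z = y 0 • w := by
        ext1 s
        have := hw s
        rw [initialIdeal_zero, Ideal.mem_bot] at this
        simpa [sub_eq_zero] using this
      cases k with
      | zero =>
        rw [hF.range]
        intro s
        refine hy.nonzerodivisor _ ?_
        have := (hF.range _).1 ⟨z, rfl⟩ s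
        rwa [h] at this
      | succ k =>
        refine (hF.exact k w).1 (funext fun s => ?_)
        have h1 := mulVec_mulVec_eq_zero hF k z
        rw [h, Matrix.mulVec_smul] at h1
        have h2 := hy.regular 0 (Nat.zero_le m) ((F.diff k).mulVec w s)
        rw [initialIdeal_zero, Ideal.mem_bot, Ideal.mem_bot] at h2
        exact h2 (congrFun h1 s)
    refine isBoundary_of_sub_smul (u := u) ?_
    have h2 := isCycle_sub_smul hw (u := u) (by simp [hu])
    obtain ⟨v, hv⟩ := (hF.exact k _).1 (funext fun s => by
      have := h2 s
      rwa [initialIdeal_zero, Ideal.mem_bot] at this)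
    exact ⟨v, fun s => by rw [← hv]; simp⟩
  | succ i ih =>
    obtain ⟨w, hw⟩ := exists_sub_smul_mem hz
    obtain ⟨k, rfl⟩ : ∃ k', k = k' + 1 := ⟨k - 1, by omega⟩
    obtain ⟨u, hu⟩ := ih (by omega) (by omega) (isCycle_of_sub_smul_mem hF hy hi hw)
    exact isBoundary_of_sub_smul (ih (by omega) (by omega) (isCycle_sub_smul hw hu))

/-- `H_0(F ⊗ R ⧸ (y_0)) = R ⧸ (I + (y_0))`. -/
theorem isBoundary_one_zero_iff (hF : F.IsMinimalCyclicResolution I)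
    {z : Fin (F.rank 0) → MvPolynomial σ K} :
    F.IsBoundary y 1 0 z ↔ ∀ s, z s ∈ I ⊔ Ideal.span {y 0} := by
  simp only [mem_sup_span_singleton]
  constructor
  · rintro ⟨u, hu⟩ s
    obtain ⟨w, hw⟩ := exists_sub_smul_mem hu
    refine ⟨w s, ?_⟩
    have h1 := hw s
    rw [initialIdeal_zero, Ideal.mem_bot] at h1
    have h2 : z s - y 0 * w s = (F.diff 0).mulVec u s := by
      rw [← sub_eq_zero, ← h1]
      simp only [Pi.sub_apply, Pi.smul_apply, smul_eq_mul]
      ring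
    rw [h2]
    exact (hF.range _).1 ⟨u, rfl⟩ s
  · intro h
    choose a ha using h
    obtain ⟨u, hu⟩ := (hF.range (z - y 0 • a)).2 ha
    refine ⟨u, fun s => ?_⟩
    rw [hu, sub_sub_cancel]
    exact Ideal.mul_mem_right _ _ (mem_initialIdeal y Nat.zero_lt_one)

/-- The homogeneous cycles of degree `j` of `F ⊗ R ⧸ (y_0, …, y_{i-1})` in homological degree `k`
are boundaries. -/
def HomologyVanishes (F : FreeSequence σ K) (y : ℕ → MvPolynomial σ K) (i k : ℕ) (j : ℤ) : Prop :=
  ∀ z, F.IsHomVec k j z → F.IsCycle y i k z → F.IsBoundary y i k z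

theorem homologyVanishes_succ_zero {i : ℕ} {j : ℤ} (h : F.HomologyVanishes y i 0 j) :
    F.HomologyVanishes y (i + 1) 0 j :=
  fun z hz _ => (h z hz trivial).mono (Nat.le_succ i)

/-- The long exact sequence for multiplication by `y_i`, in a fixed degree. -/
theorem homologyVanishes_succ_succ (hF : F.IsMinimalCyclicResolution I)
    (hy : IsGorensteinSystem I m y) {i k : ℕ} {j : ℤ} (hi : i ≤ m)
    (h : ∀ z, F.IsHomVec (k + 1) j z → F.IsCycle y i (k + 1) z → F.IsBoundary y (i + 1) (k + 1) z)
    (h' : F.HomologyVanishes y i k (j - 1)) : F.HomologyVanishes y (i + 1) (k + 1) j := by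
  intro z hz hc
  obtain ⟨w, hw⟩ := exists_sub_smul_mem hc
  have hw1 := vcomp_mem hy.homogeneous hw j
  rw [vcomp_sub, vcomp_mulVec hF.graded, hz.vcomp_eq, vcomp_smul (hy.homogeneous i)] at hw1
  obtain ⟨u, hu⟩ := h' _ (isHomVec_vcomp _ _ _) (isCycle_of_sub_smul_mem hF hy hi hw1)
  have hu1 := vcomp_mem hy.homogeneous hu (j - 1)
  rw [vcomp_sub, vcomp_mulVec hF.graded, (isHomVec_vcomp _ _ _).vcomp_eq] at hu1
  obtain ⟨v, hv⟩ := h _ (hz.sub ((isHomVec_vcomp _ _ u).smul (hy.homogeneous i)))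
    (isCycle_sub_smul hw1 hu1)
  refine ⟨v, fun s => ?_⟩
  have h1 := add_mem (hv s) (Ideal.mul_mem_right (F.vcomp (k + 1) (j - 1) u s) _
    (mem_initialIdeal y (Nat.lt_succ_self i)))
  convert h1 using 1
  simp only [Pi.sub_apply, Pi.smul_apply, smul_eq_mul]
  ring

/-- Regularity: `F ⊗ R ⧸ (y_0, …, y_i)` has no homology in degrees above `k + 2`. -/
theorem homologyVanishes_of_three_le (hF : F.IsMinimalCyclicResolution I)
    (hy : IsGorensteinSystem I m y) {i k : ℕ} {j : ℤ} (hi : i ≤ m) (hj : k + 3 ≤ j) :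
    F.HomologyVanishes y (i + 1) k j := by
  induction i generalizing k j with
  | zero =>
    cases k with
    | succ k => exact fun z _ hz => isBoundary_of_le hF hy hi (Nat.zero_le k) hz
    | zero =>
      intro z hz _
      rw [zero_add, isBoundary_one_zero_iff hF]
      intro s
      have h := hz s
      rw [hF.deg_zero, sub_zero] at h
      lift j to ℕ using by omega
      exact hy.mem_of_three_le j (by omega) _ (isHomogeneousOfDegree_natCast.1 h)
  | succ i ih =>
    cases k with
    | zero => exact homologyVanishes_succ_zero (ih (by omega) hj)
    | succ k =>
      refine homologyVanishes_succ_succ hF hy hi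
        (fun z hz hc => (ih (by omega) hj z hz hc).mono (Nat.le_succ _))
        (ih (by omega) (by push_cast at hj; omega))

theorem IsLift.add {i : ℕ} {z z' : Fin (F.rank i) → MvPolynomial σ K} {b b' : MvPolynomial σ K}
    (h : F.IsLift y i z b) (h' : F.IsLift y i z' b') : F.IsLift y i (z + z') (b + b') := by
  induction i generalizing b b' with
  | zero => exact fun s => by rw [Pi.add_apply, h s, h' s]
  | succ i ih =>
    obtain ⟨w, h1, h2⟩ := h
    obtain ⟨w', h1', h2'⟩ := h'
    refine ⟨w + w', ih h1 h1', fun s => ?_⟩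
    convert add_mem (h2 s) (h2' s) using 1
    rw [Matrix.mulVec_add]
    simp only [Pi.sub_apply, Pi.add_apply, Pi.smul_apply, smul_eq_mul]
    ring

theorem IsLift.smul {i : ℕ} {z : Fin (F.rank i) → MvPolynomial σ K} {b : MvPolynomial σ K}
    (h : F.IsLift y i z b) (r : MvPolynomial σ K) : F.IsLift y i (r • z) (r * b) := by
  induction i generalizing b with
  | zero => exact fun s => by rw [Pi.smul_apply, h s, smul_eq_mul]
  | succ i ih =>
    obtain ⟨w, h1, h2⟩ := h
    refine ⟨r • w, ih h1, fun s => ?_⟩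
    convert Ideal.mul_mem_left _ r (h2 s) using 1
    rw [Matrix.mulVec_smul]
    simp only [Pi.sub_apply, Pi.smul_apply, smul_eq_mul]
    ring

/-- Together with `IsLift.mem`: the iterated connecting map is injective. -/
theorem IsLift.isBoundary (hF : F.IsMinimalCyclicResolution I) (hy : IsGorensteinSystem I m y)
    {i : ℕ} (hi : i ≤ m) {z : Fin (F.rank i) → MvPolynomial σ K} {b : MvPolynomial σ K}
    (h : F.IsLift y i z b) (hb : b ∈ I ⊔ Ideal.span {y 0}) : F.IsBoundary y (i + 1) i z := by
  induction i generalizing b with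
  | zero =>
    rw [zero_add, isBoundary_one_zero_iff hF]
    intro s
    rwa [h s]
  | succ i ih =>
    obtain ⟨w, h1, h2⟩ := h
    obtain ⟨u, hu⟩ := ih (by omega) h1 hb
    exact isBoundary_of_sub_smul (isBoundary_of_le hF hy (by omega) le_rfl (isCycle_sub_smul h2 hu))

theorem IsLift.mem (hF : F.IsMinimalCyclicResolution I) (hy : IsGorensteinSystem I m y)
    {i : ℕ} (hi : i ≤ m) {z : Fin (F.rank i) → MvPolynomial σ K} {b : MvPolynomial σ K}
    (h : F.IsLift y i z b) (hz : F.IsBoundary y (i + 1) i z) : b ∈ I ⊔ Ideal.span {y 0} := by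
  induction i generalizing b with
  | zero =>
    rw [zero_add, isBoundary_one_zero_iff hF] at hz
    have s : Fin (F.rank 0) := ⟨0, by rw [hF.rank_zero]; exact Nat.zero_lt_one⟩
    rw [← h s]
    exact hz s
  | succ i ih =>
    obtain ⟨w, h1, h2⟩ := h
    refine ih (by omega) h1 ?_
    obtain ⟨u, hu⟩ := hz
    obtain ⟨v, hv⟩ := exists_sub_smul_mem hu
    -- apply the differential to `z = φ(u) + y_{i+1} v + …` and cancel `y_{i+1}`
    refine ⟨v, fun s => hy.regular (i + 1) hi _ ?_⟩
    have h3 := mulVec_mem hv s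
    rw [Matrix.mulVec_sub, Matrix.mulVec_sub, mulVec_mulVec_eq_zero hF, Matrix.mulVec_smul] at h3
    convert sub_mem h3 (h2 s) using 1
    simp only [Pi.sub_apply, Pi.smul_apply, Pi.zero_apply, smul_eq_mul]
    ring

/-- The image of the iterated connecting map consists of the classes annihilated by
`y_1, …, y_i`. -/
theorem exists_isLift (hF : F.IsMinimalCyclicResolution I) (hy : IsGorensteinSystem I m y)
    {i : ℕ} (hi : i ≤ m) {b : MvPolynomial σ K}
    (hb : ∀ t, 1 ≤ t → t ≤ i → y t * b ∈ I ⊔ Ideal.span {y 0}) : ∃ z, F.IsLift y i z b := by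
  induction i with
  | zero => exact ⟨fun _ => b, fun _ => rfl⟩
  | succ i ih =>
    obtain ⟨w, hw⟩ := ih (by omega) fun t h1 h2 => hb t h1 (by omega)
    obtain ⟨z, hz⟩ := (hw.smul (y (i + 1))).isBoundary hF hy (by omega)
      (hb (i + 1) (by omega) le_rfl)
    refine ⟨z, w, hw, fun s => ?_⟩
    rw [← neg_sub]
    exact neg_mem (hz s)

theorem exists_isLift_of_isCycle (hF : F.IsMinimalCyclicResolution I)
    (hy : IsGorensteinSystem I m y) {i : ℕ} (hi : i ≤ m) {j : ℤ}
    {z : Fin (F.rank i) → MvPolynomial σ K} (hj : F.IsHomVec i j z)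
    (hz : F.IsCycle y (i + 1) i z) :
    ∃ b, F.IsLift y i z b ∧ IsHomogeneousOfDegree b (j - i) ∧
      ∀ t, 1 ≤ t → t ≤ i → y t * b ∈ I ⊔ Ideal.span {y 0} := by
  induction i generalizing j with
  | zero =>
    let s : Fin (F.rank 0) := ⟨0, by rw [hF.rank_zero]; exact Nat.zero_lt_one⟩
    have : Subsingleton (Fin (F.rank 0)) := by rw [hF.rank_zero]; infer_instance
    refine ⟨z s, fun s' => by rw [Subsingleton.elim s' s], ?_, fun t h1 h2 => by omega⟩
    have := hj s
    rwa [hF.deg_zero] at this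
  | succ i ih =>
    obtain ⟨w, hw⟩ := exists_sub_smul_mem hz
    have hw1 := vcomp_mem hy.homogeneous hw j
    rw [vcomp_sub, vcomp_mulVec hF.graded, hj.vcomp_eq, vcomp_smul (hy.homogeneous _)] at hw1
    obtain ⟨b, hb1, hb2, hb3⟩ := ih (by omega) (isHomVec_vcomp _ (j - 1) w)
      (isCycle_of_sub_smul_mem hF hy hi hw1)
    refine ⟨b, ⟨_, hb1, hw1⟩, by convert hb2 using 1; push_cast; ring, fun t h1 h2 => ?_⟩
    rcases Nat.lt_or_ge i t with h | h
    · obtain rfl : t = i + 1 := by omega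
      refine (hb1.smul (y (i + 1))).mem hF hy (by omega) ⟨z, fun s => ?_⟩
      rw [← neg_sub]
      exact neg_mem (hw1 s)
    · exact hb3 t h1 h

/-- `F ⊗ R ⧸ (y_0, …, y_i)` has no homology of degree `k + 2` in homological degrees `k < i`.
For `k = i - 1` the homology of `F ⊗ R ⧸ (y_0, …, y_{i-1})` of this degree is the socle of
`R ⧸ (I + (y_0))`, and it is the image of the multiplication by `y_i`. -/
theorem homologyVanishes_add_two (hF : F.IsMinimalCyclicResolution I)
    (hy : IsGorensteinSystem I m y) {i k : ℕ} (hi : i ≤ m) (hk : k < i) :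
    F.HomologyVanishes y (i + 1) k (k + 2) := by
  induction i generalizing k with
  | zero => omega
  | succ i ih =>
    have key : ∀ z, F.IsHomVec k (k + 2) z → F.IsCycle y (i + 1) k z →
        F.IsBoundary y (i + 1 + 1) k z := by
      intro z hz hc
      rcases Nat.lt_or_ge k i with h | h
      · exact (ih (by omega) h z hz hc).mono (Nat.le_succ _)
      obtain rfl : k = i := by omega
      obtain ⟨c, hc1, hc2, -⟩ := exists_isLift_of_isCycle hF hy (by omega) hz hc
      obtain ⟨b, hb1, hb2, hb3⟩ := hy.dual (k + 1) (by omega) hi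
      obtain ⟨w, hw⟩ := exists_isLift hF hy (i := k) (by omega)
        fun t h1 h2 => hb2 t h1 (by omega)
      have hc3 : c.IsHomogeneous 2 := by
        rw [add_sub_cancel_left] at hc2
        exact isHomogeneousOfDegree_natCast.1 hc2
      obtain ⟨α, β, hαβ, h1⟩ := hy.quadrics c _ hc3 ((hy.homogeneous (k + 1)).mul hb1)
      have hα : α ≠ 0 := by
        rintro rfl
        have hβ : β ≠ 0 := by simpa using hαβ
        refine hb3 ?_
        have h2 := Ideal.mul_mem_left _ (C β⁻¹) h1
        rwa [C_0, zero_mul, zero_add, ← mul_assoc, ← C_mul, inv_mul_cancel₀ hβ, C_1,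
          one_mul] at h2
      obtain ⟨u, hu⟩ := ((hc1.smul (C α)).add ((hw.smul (y (k + 1))).smul (C β))).isBoundary hF hy
        (by omega) h1
      refine isBoundary_of_sub_smul (u := -(C (α⁻¹ * β) : MvPolynomial σ K) • w)
        ⟨(C α⁻¹ : MvPolynomial σ K) • u, fun s => ?_⟩
      convert Ideal.mul_mem_left _ (C α⁻¹) (hu s) using 1
      have h3 : (C α⁻¹ * C α : MvPolynomial σ K) = 1 := by
        rw [← C_mul, inv_mul_cancel₀ hα, C_1]
      rw [Matrix.mulVec_smul]
      simp only [Pi.sub_apply, Pi.add_apply, Pi.smul_apply, smul_eq_mul, C_mul]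
      linear_combination (-z s) * h3
    cases k with
    | zero => exact fun z hz _ => key z hz trivial
    | succ k =>
      refine homologyVanishes_succ_succ hF hy hi key ?_
      convert ih (k := k) (by omega) (by omega) using 1
      push_cast
      ring

/-! ### The ranks and degrees of the resolution -/

theorem single_ne_mulVec_add (hF : F.IsMinimalCyclicResolution I) {k : ℕ} (s : Fin (F.rank k))
    (u : Fin (F.rank (k + 1)) → MvPolynomial σ K) :
    ¬ ∀ t, ((Pi.single s 1 : Fin (F.rank k) → MvPolynomial σ K) - (F.diff k).mulVec u) t ∈
      Ideal.span (Set.range (X : σ → MvPolynomial σ K)) := by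
  intro h
  have h1 : (F.diff k).mulVec u s ∈ Ideal.span (Set.range (X : σ → MvPolynomial σ K)) := by
    rw [Matrix.mulVec, dotProduct]
    exact Ideal.sum_mem _ fun t _ => Ideal.mul_mem_right _ _ (hF.minimal k s t)
  have h2 := add_mem (h s) h1
  rw [Pi.sub_apply, sub_add_cancel, Pi.single_eq_same, ← Set.image_univ, mem_ideal_span_X_image]
    at h2
  obtain ⟨i, -, hi⟩ := h2 0 (by simp)
  exact hi rfl

theorem isHomVec_single {k : ℕ} (s : Fin (F.rank k)) :
    F.IsHomVec k (F.deg k s) (Pi.single s 1) := by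
  intro t
  rcases eq_or_ne t s with rfl | h
  · rw [Pi.single_eq_same, sub_self]
    exact Or.inr ⟨0, rfl, isHomogeneous_one _ _⟩
  · rw [Pi.single_eq_of_ne h]
    exact Or.inl rfl

theorem isCycle_top (hF : F.IsMinimalCyclicResolution I) (hy : IsGorensteinSystem I m y) :
    ∀ (k : ℕ) (z : Fin (F.rank k) → MvPolynomial σ K), F.IsCycle y (m + 1) k z
  | 0, _ => trivial
  | k + 1, z => fun s => by
    rw [hy.initialIdeal_eq, Matrix.mulVec, dotProduct]
    exact Ideal.sum_mem _ fun t _ => Ideal.mul_mem_right _ _ (hF.minimal k s t)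

theorem not_isBoundary_single (hF : F.IsMinimalCyclicResolution I)
    (hy : IsGorensteinSystem I m y) {k : ℕ} (s : Fin (F.rank k)) :
    ¬ F.IsBoundary y (m + 1) k (Pi.single s 1) := by
  rintro ⟨u, hu⟩
  rw [hy.initialIdeal_eq] at hu
  exact single_ne_mulVec_add hF s u hu

/-- As the resolution is minimal, `F_k ⊗ K` is its own homology, and `y_0, …, y_m` generate the
irrelevant ideal. -/
theorem rank_eq_zero (hF : F.IsMinimalCyclicResolution I) (hy : IsGorensteinSystem I m y) :
    F.rank (m + 1) = 0 := by
  by_contra h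
  exact not_isBoundary_single hF hy ⟨0, Nat.pos_of_ne_zero h⟩
    (isBoundary_of_le hF hy le_rfl le_rfl (isCycle_top hF hy _ _))

/-- The degrees of a minimal resolution increase, and `I` contains no linear forms. -/
theorem add_two_le_deg (hF : F.IsMinimalCyclicResolution I) (hy : IsGorensteinSystem I m y)
    (k : ℕ) (s : Fin (F.rank (k + 1))) : (k : ℤ) + 2 ≤ F.deg (k + 1) s := by
  -- otherwise the basis vector `s` would be a boundary
  obtain ⟨t, ht⟩ : ∃ t, F.diff k t s ≠ 0 := by
    by_contra! h
    obtain ⟨u, hu⟩ := (hF.exact k (Pi.single s 1)).1 (funext fun t => by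
      simp [h])
    exact single_ne_mulVec_add hF s u fun t => by
      rw [← hu]
      simp
  obtain h | ⟨d, hd, hd'⟩ := hF.graded k t s
  · exact absurd h ht
  cases k with
  | zero =>
    rw [hF.deg_zero, sub_zero] at hd
    by_contra hlt
    rw [← hd, Nat.cast_zero] at hlt
    refine ht (hy.eq_zero_of_mem d (by omega) _ hd' ?_)
    have := (hF.range _).1 ⟨Pi.single s 1, rfl⟩ t
    simpa using this
  | succ k =>
    have h1 := add_two_le_deg hF hy k t
    have h2 : d ≠ 0 := by
      rintro rfl
      have h3 := hF.minimal _ t s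
      rw [← Set.image_univ, mem_ideal_span_X_image] at h3
      rw [← mem_homogeneousSubmodule, homogeneousSubmodule_zero] at hd'
      obtain ⟨c, hc⟩ := Submodule.mem_one.1 hd'
      rw [← hc] at h3 ht
      obtain ⟨i, -, hi⟩ := h3 0 (by simpa using ht)
      exact hi rfl
    push_cast
    omega

/-- A basis vector of `F_{k+1}` of another degree would be a nonzero homology class of
`F ⊗ R ⧸ (y_0, …, y_m)`, in a degree in which the homology vanishes. -/
theorem deg_eq (hF : F.IsMinimalCyclicResolution I) (hy : IsGorensteinSystem I m y)
    {k : ℕ} (hk : k + 1 < m) (s : Fin (F.rank (k + 1))) : F.deg (k + 1) s = k + 2 := by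
  refine le_antisymm ?_ (add_two_le_deg hF hy k s)
  by_contra! h
  have h1 := isHomVec_single s
  refine not_isBoundary_single hF hy s ?_
  rcases eq_or_ne (F.deg (k + 1) s) (((k + 1 : ℕ) : ℤ) + 2) with h2 | h2
  · rw [h2] at h1
    exact homologyVanishes_add_two hF hy le_rfl hk _ h1 (isCycle_top hF hy _ _)
  · exact homologyVanishes_of_three_le hF hy le_rfl (by push_cast at h2 ⊢; omega) _ h1
      (isCycle_top hF hy _ _)

/-- The top module of the resolution corresponds to the socle of `R ⧸ (I + (y_0))`. -/
theorem rank_and_deg_top (hF : F.IsMinimalCyclicResolution I) (hy : IsGorensteinSystem I m y)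
    (hm : 1 ≤ m) : F.rank m = 1 ∧ ∀ s, F.deg m s = m + 2 := by
  have key : ∀ s : Fin (F.rank m), F.deg m s = m + 2 ∧
      ∃ b, F.IsLift y m (Pi.single s 1) b ∧ b.IsHomogeneous 2 := by
    intro s
    obtain ⟨b, hb1, hb2, hb3⟩ := exists_isLift_of_isCycle hF hy le_rfl (isHomVec_single s)
      (isCycle_top hF hy _ _)
    have hb4 : b ∉ I ⊔ Ideal.span {y 0} := fun h =>
      not_isBoundary_single hF hy s (hb1.isBoundary hF hy le_rfl h)
    obtain rfl | ⟨d, hd, hd'⟩ := hb2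
    · exact absurd (zero_mem _) hb4
    have h1 : d = 2 := by
      by_contra h
      rcases Nat.lt_or_ge d 2 with h1 | h1
      · exact hb4 (hy.socle d (by omega) b hd' hb3)
      · exact hb4 (hy.mem_of_three_le d (by omega) b hd')
    subst h1
    exact ⟨by push_cast at hd; omega, b, hb1, hd'⟩
  refine ⟨?_, fun s => (key s).1⟩
  obtain ⟨b, hb1, -, hb3⟩ := hy.dual 1 le_rfl hm
  have h0 : F.rank m ≠ 0 := by
    intro h0
    obtain ⟨z, hz⟩ := exists_isLift hF hy (i := m) (b := y 1 * b) le_rfl fun t _ _ =>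
      hy.mem_of_three_le 3 le_rfl _ ((hy.homogeneous t).mul ((hy.homogeneous 1).mul hb1))
    refine hb3 (hz.mem hF hy le_rfl ⟨0, fun s => ?_⟩)
    rw [h0] at s
    exact s.elim0
  by_contra h1
  let s : Fin (F.rank m) := ⟨0, by omega⟩
  let t : Fin (F.rank m) := ⟨1, by omega⟩
  have hst : s ≠ t := by simp [s, t]
  obtain ⟨-, c, hc, hc'⟩ := key s
  obtain ⟨-, d, hd, hd'⟩ := key t
  obtain ⟨α, β, hαβ, h2⟩ := hy.quadrics c d hc' hd'
  obtain ⟨u, hu⟩ := ((hc.smul (C α)).add (hd.smul (C β))).isBoundary hF hy le_rfl h2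
  have h3 : ∀ r : Fin (F.rank m), ((C α : MvPolynomial σ K) • Pi.single s 1 +
      (C β : MvPolynomial σ K) • Pi.single t 1 : Fin (F.rank m) → MvPolynomial σ K) r ∈
      Ideal.span (Set.range (X : σ → MvPolynomial σ K)) := by
    intro r
    have h4 : (F.diff m).mulVec u r ∈ Ideal.span (Set.range (X : σ → MvPolynomial σ K)) := by
      rw [Matrix.mulVec, dotProduct]
      exact Ideal.sum_mem _ fun t _ => Ideal.mul_mem_right _ _ (hF.minimal m r t)
    rw [hy.initialIdeal_eq] at hu
    simpa using add_mem (hu r) h4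
  have h5 : ∀ c : K, C c ∈ Ideal.span (Set.range (X : σ → MvPolynomial σ K)) → c = 0 := by
    intro c hc
    by_contra h
    rw [← Set.image_univ, mem_ideal_span_X_image] at hc
    obtain ⟨i, -, hi⟩ := hc 0 (by simpa using h)
    exact hi rfl
  have hs := h3 s
  have ht := h3 t
  simp only [Pi.add_apply, Pi.smul_apply, Pi.single_eq_same, Pi.single_eq_of_ne hst,
    Pi.single_eq_of_ne hst.symm, smul_eq_mul, mul_one, mul_zero, add_zero, zero_add] at hs ht
  rcases hαβ with h | h
  · exact h (h5 α hs)
  · exact h (h5 β ht)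

end FreeSequence

/-! ### The multiplication on the resolution -/

/-- The bilinear map between free modules with prescribed values on pairs of basis vectors. -/
noncomputable def bilinOfBasis {R : Type*} [CommRing R] {a b c : ℕ}
    (f : Fin a → Fin b → Fin c → R) : (Fin a → R) →ₗ[R] (Fin b → R) →ₗ[R] (Fin c → R) :=
  LinearMap.mk₂ R (fun x y => ∑ i, ∑ j, (x i * y j) • f i j)
    (fun x x' y => by simp only [Pi.add_apply, add_mul, add_smul, Finset.sum_add_distrib])
    (fun r x y => by simp only [Pi.smul_apply, smul_eq_mul, mul_assoc, mul_smul, Finset.smul_sum])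
    (fun x y y' => by simp only [Pi.add_apply, mul_add, add_smul, Finset.sum_add_distrib])
    (fun r x y => by
      simp only [Pi.smul_apply, smul_eq_mul, mul_left_comm _ r, mul_smul r, Finset.smul_sum])

theorem bilinOfBasis_apply {R : Type*} [CommRing R] {a b c : ℕ} (f : Fin a → Fin b → Fin c → R)
    (x : Fin a → R) (y : Fin b → R) :
    bilinOfBasis f x y = ∑ i, ∑ j, (x i * y j) • f i j := rfl

theorem bilinOfBasis_single {R : Type*} [CommRing R] {a b c : ℕ} (f : Fin a → Fin b → Fin c → R)
    (i : Fin a) (j : Fin b) : bilinOfBasis f (Pi.single i 1) (Pi.single j 1) = f i j := by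
  rw [bilinOfBasis_apply, Finset.sum_eq_single i, Finset.sum_eq_single j] <;>
    simp +contextual [Pi.single_apply]

theorem ext_bilin {R : Type*} [CommRing R] {a b : ℕ} {M : Type*} [AddCommGroup M] [Module R M]
    {f g : (Fin a → R) →ₗ[R] (Fin b → R) →ₗ[R] M}
    (h : ∀ i j, f (Pi.single i 1) (Pi.single j 1) = g (Pi.single i 1) (Pi.single j 1)) : f = g :=
  LinearMap.ext_basis (Pi.basisFun R (Fin a)) (Pi.basisFun R (Fin b)) (by simpa using h)

namespace FreeSequence

variable {σ K : Type*} [Field K] (F : FreeSequence σ K)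

/-- The differential `F_k → F_{k-1}`; it is zero for `k = 0`. -/
noncomputable def boundary : (k : ℕ) →
    (Fin (F.rank k) → MvPolynomial σ K) →ₗ[MvPolynomial σ K]
      (Fin (F.rank (k - 1)) → MvPolynomial σ K)
  | 0 => 0
  | k + 1 => (F.diff k).mulVecLin

open Classical in
/-- A multiplication `F_k ⊗ F_l → F_n`, meant for `n = k + l`. The basis vector of `F_0` acts as
the identity, and the products of other basis vectors are chosen such that the Leibniz rule
holds. -/
noncomputable def mult : (n k l : ℕ) →
    (Fin (F.rank k) → MvPolynomial σ K) →ₗ[MvPolynomial σ K]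
      (Fin (F.rank l) → MvPolynomial σ K) →ₗ[MvPolynomial σ K] (Fin (F.rank n) → MvPolynomial σ K)
  | _, 0, _ => bilinOfBasis fun _ j a => if (a : ℕ) = j then 1 else 0
  | 0, _ + 1, _ => 0
  | _ + 1, _ + 1, 0 => bilinOfBasis fun i _ a => if (a : ℕ) = i then 1 else 0
  | n + 1, k + 1, l + 1 => bilinOfBasis fun i j =>
      if h : ∃ u, F.boundary (n + 1) u =
          mult n k (l + 1) (F.boundary (k + 1) (Pi.single i 1)) (Pi.single j 1) +
          (-1 : MvPolynomial σ K) ^ (k + 1) •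
            mult n (k + 1) l (Pi.single i 1) (F.boundary (l + 1) (Pi.single j 1))
      then h.choose else 0

variable {F} {I : Ideal (MvPolynomial σ K)}

theorem boundary_boundary (hF : F.IsMinimalCyclicResolution I) (k : ℕ)
    (x : Fin (F.rank k) → MvPolynomial σ K) : F.boundary (k - 1) (F.boundary k x) = 0 := by
  match k, x with
  | 0, x => rfl
  | 1, x => rfl
  | k + 2, x => exact mulVec_mulVec_eq_zero hF k x

theorem exists_boundary_eq (hF : F.IsMinimalCyclicResolution I) {n : ℕ} (hn : 1 ≤ n)
    {x : Fin (F.rank n) → MvPolynomial σ K} (hx : F.boundary n x = 0) :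
    ∃ u, F.boundary (n + 1) u = x := by
  obtain ⟨n, rfl⟩ : ∃ n', n = n' + 1 := ⟨n - 1, by omega⟩
  exact (hF.exact n x).1 hx

theorem mult_zero_left (n : ℕ) (x : Fin (F.rank 0) → MvPolynomial σ K)
    (y : Fin (F.rank n) → MvPolynomial σ K) : F.mult n 0 n x y = (∑ i, x i) • y := by
  have : F.mult n 0 n = bilinOfBasis fun _ j a => if (a : ℕ) = j then 1 else 0 := by
    cases n <;> rw [mult]
  rw [this, bilinOfBasis_apply]
  ext1 a
  simp [Finset.sum_apply, ← Fin.ext_iff, Finset.sum_mul]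

theorem mult_zero_right (hF : F.IsMinimalCyclicResolution I) (n : ℕ)
    (x : Fin (F.rank n) → MvPolynomial σ K) (y : Fin (F.rank 0) → MvPolynomial σ K) :
    F.mult n n 0 x y = (∑ i, y i) • x := by
  cases n with
  | zero =>
    rw [mult_zero_left]
    have : Subsingleton (Fin (F.rank 0)) := by rw [hF.rank_zero]; infer_instance
    ext1 s
    have h : ∀ z : Fin (F.rank 0) → MvPolynomial σ K, ∑ i, z i = z s :=
      fun z => Fintype.sum_subsingleton z s
    rw [Pi.smul_apply, Pi.smul_apply, h, h, smul_eq_mul, smul_eq_mul, mul_comm]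
  | succ n =>
    rw [mult, bilinOfBasis_apply]
    ext1 a
    simp [Finset.sum_apply, ← Fin.ext_iff, Finset.mul_sum, mul_comm]

/-- The Leibniz rule for the products of total degree `n`. -/
def Leibniz (F : FreeSequence σ K) (n : ℕ) : Prop :=
  ∀ k l, k + l = n → ∀ x y, F.boundary n (F.mult n k l x y) =
    F.mult (n - 1) (k - 1) l (F.boundary k x) y +
      (-1 : MvPolynomial σ K) ^ k • F.mult (n - 1) k (l - 1) x (F.boundary l y)

theorem Leibniz.boundary_eq_zero (hF : F.IsMinimalCyclicResolution I) {n : ℕ} (h : F.Leibniz n)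
    {k l : ℕ} (hn : k + l + 1 = n) (x : Fin (F.rank (k + 1)) → MvPolynomial σ K)
    (y : Fin (F.rank (l + 1)) → MvPolynomial σ K) :
    F.boundary n (F.mult n k (l + 1) (F.boundary (k + 1) x) y + (-1 : MvPolynomial σ K) ^ (k + 1) •
      F.mult n (k + 1) l x (F.boundary (l + 1) y)) = 0 := by
  rw [map_add, map_smul, h k (l + 1) (by omega), h (k + 1) l (by omega)]
  have h1 : F.boundary k (F.boundary (k + 1) x) = 0 := boundary_boundary hF (k + 1) x
  have h2 : F.boundary l (F.boundary (l + 1) y) = 0 := boundary_boundary hF (l + 1) y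
  have h3 : F.mult (n - 1) (k + 1 - 1) l (F.boundary (k + 1) x) (F.boundary (l + 1) y) =
    F.mult (n - 1) k (l + 1 - 1) (F.boundary (k + 1) x) (F.boundary (l + 1) y) := rfl
  rw [h1, h2, h3]
  simp [pow_succ]

theorem leibniz (hF : F.IsMinimalCyclicResolution I) (n : ℕ) : F.Leibniz n := by
  induction n with
  | zero =>
    intro k l hkl x y
    obtain rfl : k = 0 := by omega
    obtain rfl : l = 0 := by omega
    simp [boundary]
  | succ n ih =>
    intro k l hkl x y
    match k, l with
    | 0, l =>
      obtain rfl : l = n + 1 := by omega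
      simp only [mult_zero_left, map_smul]
      simp [boundary]
    | k + 1, 0 =>
      obtain rfl : k = n := by omega
      simp only [mult_zero_right hF, map_smul]
      simp [boundary]
    | k + 1, l + 1 =>
      have key : (F.mult (n + 1) (k + 1) (l + 1)).compr₂ (F.boundary (n + 1)) =
          (F.mult n k (l + 1)).comp (F.boundary (k + 1)) + (-1 : MvPolynomial σ K) ^ (k + 1) •
            (F.mult n (k + 1) l).compl₂ (F.boundary (l + 1)) := by
        refine ext_bilin fun i j => ?_
        have h := exists_boundary_eq hF (by omega)
          (ih.boundary_eq_zero hF (k := k) (l := l) (by omega) (Pi.single i 1) (Pi.single j 1))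
        rw [LinearMap.compr₂_apply, mult, bilinOfBasis_single, dif_pos h]
        exact h.choose_spec
      exact LinearMap.congr_fun₂ key x y

/-- In the top degree the products are dual to each other under the differentials. -/
theorem mult_boundary_add (hF : F.IsMinimalCyclicResolution I) {m : ℕ} (hm : F.rank (m + 1) = 0)
    {k l : ℕ} (h : k + l + 1 = m) (x : Fin (F.rank (k + 1)) → MvPolynomial σ K)
    (y : Fin (F.rank (l + 1)) → MvPolynomial σ K) :
    F.mult m k (l + 1) (F.boundary (k + 1) x) y + (-1 : MvPolynomial σ K) ^ (k + 1) •
      F.mult m (k + 1) l x (F.boundary (l + 1) y) = 0 := by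
  obtain ⟨u, hu⟩ := exists_boundary_eq hF (by omega)
    ((leibniz hF m).boundary_eq_zero hF h x y)
  have : IsEmpty (Fin (F.rank (m + 1))) := by rw [hm]; infer_instance
  rw [← hu, Subsingleton.elim u 0, map_zero]

/-- The degrees of a resolution of `R ⧸ I` that is linear except at its two ends, and whose
top module has rank one. -/
structure IsGorensteinLinear (F : FreeSequence σ K) (m : ℕ) : Prop where
  rank_top : F.rank m = 1
  rank_succ : F.rank (m + 1) = 0
  deg_middle : ∀ k, k + 1 < m → ∀ s, F.deg (k + 1) s = k + 2
  deg_top : ∀ s, F.deg m s = m + 2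

/-- The constant term of the pairing `F_k ⊗ F_l → F_m = R`. -/
noncomputable def pairing (F : FreeSequence σ K) {m : ℕ} (t : Fin (F.rank m)) (k l : ℕ) :
    Matrix (Fin (F.rank k)) (Fin (F.rank l)) (MvPolynomial σ K) :=
  fun i j => C (constantCoeff (F.mult m k l (Pi.single i 1) (Pi.single j 1) t))

theorem IsGorensteinLinear.exists_degree {m : ℕ} (hD : F.IsGorensteinLinear m)
    (hF : F.IsMinimalCyclicResolution I) {k l : ℕ} (h : k + l + 1 = m) :
    ∃ d : ℤ, (∀ i j, IsHomogeneousOfDegree (F.diff k i j) d) ∧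
      ∀ i j, IsHomogeneousOfDegree (F.diff l i j) d := by
  have key : ∃ d : ℤ, (∀ i j, F.deg (k + 1) j - F.deg k i = d) ∧
      ∀ i j, F.deg (l + 1) j - F.deg l i = d := by
    match k, l with
    | 0, 0 =>
      obtain rfl : m = 1 := by omega
      refine ⟨3, fun i j => ?_, fun i j => ?_⟩ <;>
      · rw [hF.deg_zero, hD.deg_top]
        norm_num
    | 0, l + 1 =>
      obtain rfl : m = l + 2 := by omega
      refine ⟨2, fun i j => ?_, fun i j => ?_⟩
      · rw [hF.deg_zero, hD.deg_middle 0 (by omega)]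
        norm_num
      · rw [hD.deg_middle l (by omega), hD.deg_top]
        push_cast
        ring
    | k + 1, 0 =>
      obtain rfl : m = k + 2 := by omega
      refine ⟨2, fun i j => ?_, fun i j => ?_⟩
      · rw [hD.deg_middle k (by omega), hD.deg_top]
        push_cast
        ring
      · rw [hF.deg_zero, hD.deg_middle 0 (by omega)]
        norm_num
    | k + 1, l + 1 =>
      refine ⟨1, fun i j => ?_, fun i j => ?_⟩
      · rw [hD.deg_middle k (by omega), hD.deg_middle (k + 1) (by omega)]
        push_cast
        ring
      · rw [hD.deg_middle l (by omega), hD.deg_middle (l + 1) (by omega)]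
        push_cast
        ring
  obtain ⟨d, h1, h2⟩ := key
  exact ⟨d, fun i j => h1 i j ▸ hF.graded k i j, fun i j => h2 i j ▸ hF.graded l i j⟩

/-- As the matrices `φ_{k+1}` and `φ_{l+1}` are homogeneous of the same degree if `k + l + 1 = m`,
already the constant terms of the pairings are dual under the differentials. -/
theorem transpose_diff_mul_pairing (hF : F.IsMinimalCyclicResolution I) {m : ℕ}
    (hD : F.IsGorensteinLinear m) (t : Fin (F.rank m)) {k l : ℕ} (h : k + l + 1 = m)
    (i : Fin (F.rank (k + 1))) (j : Fin (F.rank (l + 1))) :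
    ∑ a, F.diff k a i * F.pairing t k (l + 1) a j =
      (-1) ^ k * ∑ b, F.pairing t (k + 1) l i b * F.diff l b j := by
  obtain ⟨d, h1, h2⟩ := hD.exists_degree hF h
  have h3 := congrFun (mult_boundary_add hF hD.rank_succ h (Pi.single i 1) (Pi.single j 1)) t
  have e1 : F.boundary (k + 1) (Pi.single i 1) = ∑ a, F.diff k a i • Pi.single a 1 := by
    ext1 s
    simp [boundary, Finset.sum_apply, Pi.single_apply]
  have e2 : F.boundary (l + 1) (Pi.single j 1) = ∑ b, F.diff l b j • Pi.single b 1 := by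
    ext1 s
    simp [boundary, Finset.sum_apply, Pi.single_apply]
  rw [e1, e2] at h3
  simp only [map_sum, map_smul, LinearMap.sum_apply, LinearMap.smul_apply, Pi.add_apply,
    Pi.smul_apply, Finset.sum_apply, smul_eq_mul, Pi.zero_apply] at h3
  have h4 := congrArg (comp d) h3
  have h5 : IsHomogeneousOfDegree ((-1 : MvPolynomial σ K) ^ (k + 1)) 0 :=
    Or.inr ⟨0, rfl, by simpa using ((isHomogeneous_one σ K).neg).pow (k + 1)⟩
  rw [map_add, map_zero, map_sum, comp_mul h5, map_sum, sub_zero,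
    Finset.sum_congr rfl fun a _ => comp_mul (h1 a i) d _,
    Finset.sum_congr rfl fun b _ => comp_mul (h2 b j) d _] at h4
  simp only [sub_self, comp_zero] at h4
  rw [pow_succ] at h4
  simp only [pairing, mul_comm (C _)]
  linear_combination h4

end FreeSequence

/-! ### Products of derivatives of the matrices of the resolution -/

/-- The directional derivative `∑_a v_a ∂/∂x_a`. -/
noncomputable def dirDeriv {σ K : Type*} [CommRing K] (v : σ → K) :
    Derivation K (MvPolynomial σ K) (MvPolynomial σ K) :=
  mkDerivation K fun a => C (v a)

theorem dirDeriv_add {σ K : Type*} [CommRing K] (v w : σ → K) (p : MvPolynomial σ K) :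
    dirDeriv (v + w) p = dirDeriv v p + dirDeriv w p := by
  have : dirDeriv (v + w) = dirDeriv v + dirDeriv w :=
    derivation_ext fun i => by simp [dirDeriv, mkDerivation_X]
  rw [this, Derivation.add_apply]

theorem dirDeriv_smul {σ K : Type*} [CommRing K] (c : K) (v : σ → K) (p : MvPolynomial σ K) :
    dirDeriv (c • v) p = c • dirDeriv v p := by
  have : dirDeriv (c • v) = c • dirDeriv v :=
    derivation_ext fun i => by simp [dirDeriv, mkDerivation_X, smul_eq_C_mul]
  rw [this, Derivation.smul_apply]

theorem dirDeriv_single {σ K : Type*} [CommRing K] [DecidableEq σ] (a : σ) :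
    dirDeriv (Pi.single a (1 : K)) = pderiv a :=
  derivation_ext fun i => by
    rw [dirDeriv, mkDerivation_X, pderiv_X]
    rcases eq_or_ne i a with rfl | h
    · simp
    · simp [h]

theorem dirDeriv_comm {σ K : Type*} [CommRing K] (v w : σ → K) (p : MvPolynomial σ K) :
    dirDeriv v (dirDeriv w p) = dirDeriv w (dirDeriv v p) := by
  have h : ⁅dirDeriv v, dirDeriv w⁆ = 0 := derivation_ext fun i => by
    simp [Derivation.commutator_apply, dirDeriv, mkDerivation_X]
  have h1 := congrArg (fun D : Derivation K (MvPolynomial σ K) (MvPolynomial σ K) => D p) h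
  simpa [Derivation.commutator_apply, sub_eq_zero] using h1

theorem IsHomogeneousOfDegree.dirDeriv {σ K : Type*} [CommRing K] [Fintype σ]
    {p : MvPolynomial σ K} {e : ℤ} (hp : IsHomogeneousOfDegree p e) (v : σ → K) :
    IsHomogeneousOfDegree (PointsResolution.dirDeriv v p) (e - 1) := by
  classical
  have h0 (q : MvPolynomial σ K) : (∑ a, v a • pderiv a : Derivation K (MvPolynomial σ K) _) q =
      ∑ a, C (v a) * pderiv a q := by
    have h := congrFun (map_sum Derivation.coeFnAddMonoidHom (fun a => v a • pderiv a)
      Finset.univ) q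
    refine Eq.trans h ?_
    rw [Finset.sum_apply]
    exact Finset.sum_congr rfl fun a _ => smul_eq_C_mul _ _
  have h1 : PointsResolution.dirDeriv v p = ∑ a, C (v a) * pderiv a p := by
    rw [← h0]
    refine DFunLike.congr_fun (derivation_ext fun i => by
    rw [h0]
    simp [PointsResolution.dirDeriv, mkDerivation_X, pderiv_X, Pi.single_apply]) p
  rw [h1]
  refine .sum fun a _ => ?_
  rw [← zero_add (e - 1)]
  refine IsHomogeneousOfDegree.mul (Or.inr ⟨0, rfl, isHomogeneous_C _ _⟩) ?_
  rw [isHomogeneousOfDegree_iff] at *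
  intro d hd
  rw [coeff_pderiv] at hd
  have h2 := hp (d + Finsupp.single a 1) fun h => hd (by rw [h]; simp)
  rw [map_add, Finsupp.degree_single] at h2
  push_cast at h2
  omega

theorem map_dirDeriv_mul {σ K ι κ μ : Type*} [CommRing K] [Fintype κ] (v : σ → K)
    (A : Matrix ι κ (MvPolynomial σ K)) (B : Matrix κ μ (MvPolynomial σ K)) :
    (A * B).map (dirDeriv v) = A.map (dirDeriv v) * B + A * B.map (dirDeriv v) := by
  ext1 i j
  simp only [Matrix.map_apply, Matrix.mul_apply, Matrix.add_apply, map_sum, Derivation.leibniz,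
    smul_eq_mul, ← Finset.sum_add_distrib]
  exact Finset.sum_congr rfl fun _ _ => by ring

namespace FreeSequence

/-- The product `A_0 A_1 ⋯ A_{k-1}` of matrices `A_i` of the same sizes as `φ_{i+1}`. -/
noncomputable def chain {σ K : Type*} [CommRing K] (F : FreeSequence σ K)
    (A : ∀ k, Matrix (Fin (F.rank k)) (Fin (F.rank (k + 1))) (MvPolynomial σ K)) :
    (k : ℕ) → Matrix (Fin (F.rank 0)) (Fin (F.rank k)) (MvPolynomial σ K)
  | 0 => 1
  | k + 1 => F.chain A k * A k

/-- The derivatives `∂φ_{k+1}` in the directions `a_k`. -/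
noncomputable def derivs {σ K : Type*} [CommRing K] (F : FreeSequence σ K) (a : ℕ → σ → K)
    (k : ℕ) : Matrix (Fin (F.rank k)) (Fin (F.rank (k + 1))) (MvPolynomial σ K) :=
  (F.diff k).map (dirDeriv (a k))

/-- The matrices `φ_1, ∂φ_2, ∂φ_3, …`, with derivatives in the directions `a_1, a_2, …`. -/
noncomputable def tailDerivs {σ K : Type*} [CommRing K] (F : FreeSequence σ K) (a : ℕ → σ → K) :
    (k : ℕ) → Matrix (Fin (F.rank k)) (Fin (F.rank (k + 1))) (MvPolynomial σ K)
  | 0 => F.diff 0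
  | k + 1 => F.derivs a (k + 1)

variable {σ K : Type*} [Field K] {F : FreeSequence σ K} {I : Ideal (MvPolynomial σ K)} {m : ℕ}

theorem chain_congr {A B : ∀ k, Matrix (Fin (F.rank k)) (Fin (F.rank (k + 1))) (MvPolynomial σ K)}
    {k : ℕ} (h : ∀ i < k, A i = B i) : F.chain A k = F.chain B k := by
  induction k with
  | zero => rfl
  | succ k ih => rw [chain, chain, ih fun i hi => h i (by omega), h k (by omega)]

theorem exists_chain_eq_mul
    (A : ∀ k, Matrix (Fin (F.rank k)) (Fin (F.rank (k + 1))) (MvPolynomial σ K)) {r k : ℕ}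
    (hk : r ≤ k) : ∃ M : Matrix (Fin (F.rank r)) (Fin (F.rank k)) (MvPolynomial σ K),
      ∀ B, (∀ i, r ≤ i → B i = A i) → F.chain B k = F.chain B r * M := by
  induction k, hk using Nat.le_induction with
  | base => exact ⟨1, fun B _ => (Matrix.mul_one _).symm⟩
  | succ k hk ih =>
    obtain ⟨M, hM⟩ := ih
    refine ⟨M * A k, fun B hB => ?_⟩
    rw [chain, hM B hB, hB k hk, Matrix.mul_assoc]

theorem diff_mul_diff (hF : F.IsMinimalCyclicResolution I) (k : ℕ) :
    F.diff k * F.diff (k + 1) = 0 := by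
  ext1 i j
  have h := congrFun (mulVec_mulVec_eq_zero hF k (Pi.single j 1)) i
  rw [Matrix.mulVec_mulVec] at h
  simpa using h

theorem derivs_mul_diff (hF : F.IsMinimalCyclicResolution I) (v : σ → K) (k : ℕ) :
    (F.diff k).map (dirDeriv v) * F.diff (k + 1) =
      -(F.diff k * (F.diff (k + 1)).map (dirDeriv v)) := by
  rw [eq_neg_iff_add_eq_zero, ← map_dirDeriv_mul, diff_mul_diff hF]
  ext1 i j
  simp

theorem derivs_mul_derivs_add (hF : F.IsMinimalCyclicResolution I) (v w : σ → K) (k : ℕ) :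
    (F.diff k).map (dirDeriv v) * (F.diff (k + 1)).map (dirDeriv w) +
      (F.diff k).map (dirDeriv w) * (F.diff (k + 1)).map (dirDeriv v) =
    -(((F.diff k).map (dirDeriv v)).map (dirDeriv w) * F.diff (k + 1) +
      F.diff k * ((F.diff (k + 1)).map (dirDeriv v)).map (dirDeriv w)) := by
  have h := congrArg (fun M => M.map (dirDeriv w)) (derivs_mul_diff hF v k)
  have h1 : (-(F.diff k * (F.diff (k + 1)).map (dirDeriv v))).map (dirDeriv w) =
      -((F.diff k * (F.diff (k + 1)).map (dirDeriv v)).map (dirDeriv w)) := by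
    ext1 i j
    simp
  simp only [h1, map_dirDeriv_mul] at h
  rw [eq_neg_iff_add_eq_zero]
  rw [eq_neg_iff_add_eq_zero] at h
  rw [← h]
  abel

/-- The middle matrices of the resolution are linear. -/
theorem IsGorensteinLinear.map_map_diff [Fintype σ] (hD : F.IsGorensteinLinear m)
    (hF : F.IsMinimalCyclicResolution I) {k : ℕ} (hk : k + 2 < m) (v w : σ → K) :
    ((F.diff (k + 1)).map (dirDeriv v)).map (dirDeriv w) = 0 := by
  ext1 i j
  have h := ((hF.graded (k + 1) i j).dirDeriv v).dirDeriv w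
  rw [hD.deg_middle k (by omega), hD.deg_middle (k + 1) (by omega)] at h
  obtain h | ⟨d, hd, -⟩ := h
  · exact h
  · push_cast at hd
    omega

theorem sum_transpose_derivs_mul_pairing (hF : F.IsMinimalCyclicResolution I)
    (hD : F.IsGorensteinLinear m) (t : Fin (F.rank m)) {k l : ℕ} (h : k + l + 1 = m)
    (v : σ → K) (i : Fin (F.rank (k + 1))) (j : Fin (F.rank (l + 1))) :
    ∑ a, dirDeriv v (F.diff k a i) * F.pairing t k (l + 1) a j =
      (-1) ^ k * ∑ b, F.pairing t (k + 1) l i b * dirDeriv v (F.diff l b j) := by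
  have h1 := congrArg (dirDeriv v) (transpose_diff_mul_pairing hF hD t h i j)
  have h2 : ∀ k l i j, dirDeriv v (F.pairing t k l i j) = 0 := fun k l i j => by
    simp [pairing, ← algebraMap_eq]
  have h3 : dirDeriv v ((-1 : MvPolynomial σ K) ^ k) = 0 := by
    rw [Derivation.leibniz_pow]
    simp
  simpa [h2, h3, Derivation.leibniz, map_sum, mul_comm] using h1

/-- Reversing the order of the directions multiplies the product of the derivatives of all
matrices by a sign, because the resolution is self-dual via its multiplication. -/
theorem chain_derivs_reverse (hF : F.IsMinimalCyclicResolution I) (hD : F.IsGorensteinLinear m)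
    {a b : ℕ → σ → K} (hab : ∀ k l, k + l + 1 = m → b l = a k) (s : Fin (F.rank 0))
    (t : Fin (F.rank m)) : F.chain (F.derivs a) m s t =
      (-1) ^ (∑ k ∈ Finset.range m, k) * F.chain (F.derivs b) m s t := by
  have hs : Subsingleton (Fin (F.rank 0)) := by rw [hF.rank_zero]; infer_instance
  have ht : Subsingleton (Fin (F.rank m)) := by rw [hD.rank_top]; infer_instance
  -- the vectors `q_l = ∂φ_{l+1} ⋯ ∂φ_m e_t ∈ F_l`
  obtain ⟨q, hq, hq'⟩ : ∃ q : ∀ l, Fin (F.rank l) → MvPolynomial σ K, q m = Pi.single t 1 ∧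
      ∀ l < m, q l = (F.derivs b l).mulVec (q (l + 1)) := by
    suffices ∀ r ≤ m, ∃ q : ∀ l, Fin (F.rank l) → MvPolynomial σ K, q m = Pi.single t 1 ∧
        ∀ l, r ≤ l → l < m → q l = (F.derivs b l).mulVec (q (l + 1)) by
      obtain ⟨q, h1, h2⟩ := this 0 (Nat.zero_le m)
      exact ⟨q, h1, fun l => h2 l (Nat.zero_le l)⟩
    intro r hr
    induction hr using Nat.decreasingInduction with
    | self => exact ⟨Function.update 0 m (Pi.single t 1), by simp, fun l h1 h2 => by omega⟩
    | of_succ r _ ih =>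
      obtain ⟨q, h1, h2⟩ := ih
      refine ⟨Function.update q r ((F.derivs b r).mulVec (q (r + 1))), ?_, fun l h3 h4 => ?_⟩
      · rw [Function.update_of_ne (by omega), h1]
      · rw [Function.update_of_ne (show l + 1 ≠ r by omega)]
        rcases eq_or_ne l r with rfl | h
        · rw [Function.update_self]
        · rw [Function.update_of_ne h, h2 l (by omega) h4]
  have key : ∀ k ≤ m, ∀ l, k + l = m → ∀ i, F.chain (F.derivs a) k s i =
      (-1) ^ (∑ j ∈ Finset.range k, j) * ∑ j, F.pairing t k l i j * q l j := by
    intro k hk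
    induction k with
    | zero =>
      intro l hl i
      obtain rfl : l = m := by omega
      have h1 : F.chain (F.derivs a) 0 s i = 1 := by
        rw [Subsingleton.elim i s, chain, Matrix.one_apply_eq]
      rw [h1, hq, Fintype.sum_subsingleton _ t, pairing, mult_zero_left]
      simp
    | succ k ih =>
      intro l hl i
      have e1 : ∑ c, F.chain (F.derivs a) k s c * F.derivs a k c i =
          (-1) ^ (∑ j ∈ Finset.range k, j) * ∑ j, (∑ c, dirDeriv (a k) (F.diff k c i) *
            F.pairing t k (l + 1) c j) * q (l + 1) j := by
        simp only [ih (by omega) (l + 1) (by omega), derivs, Matrix.map_apply, Finset.mul_sum,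
          Finset.sum_mul]
        rw [Finset.sum_comm]
        exact Finset.sum_congr rfl fun _ _ => Finset.sum_congr rfl fun _ _ => by ring
      have e2 : ∑ c, F.pairing t (k + 1) l i c * q l c = ∑ j, (∑ c, F.pairing t (k + 1) l i c *
          dirDeriv (a k) (F.diff l c j)) * q (l + 1) j := by
        rw [hq' l (by omega)]
        simp only [Matrix.mulVec, dotProduct, derivs, Matrix.map_apply, Finset.mul_sum,
          Finset.sum_mul, hab k l (by omega)]
        rw [Finset.sum_comm]
        exact Finset.sum_congr rfl fun _ _ => Finset.sum_congr rfl fun _ _ => by ring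
      have e3 := Finset.sum_congr rfl fun j (_ : j ∈ Finset.univ) => congrArg (· * q (l + 1) j)
        (sum_transpose_derivs_mul_pairing hF hD t (show k + l + 1 = m by omega) (a k) i j)
      simp only [mul_assoc, ← Finset.mul_sum] at e3
      rw [chain, Matrix.mul_apply, Finset.sum_range_succ, pow_add, e1, e2, e3, mul_assoc]
  have h1 : ∀ k ≤ m, (F.chain (F.derivs b) k).mulVec (q k) = q 0 := by
    intro k hk
    induction k with
    | zero => rw [chain, Matrix.one_mulVec]
    | succ k ih => rw [chain, ← Matrix.mulVec_mulVec, ← hq' k (by omega), ih (by omega)]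
  have h2 := congrFun (h1 m le_rfl) s
  rw [hq] at h2
  rw [key m le_rfl 0 (by omega) t, Fintype.sum_subsingleton _ s, pairing, mult_zero_right hF, ← h2]
  simp

end FreeSequence

/-! ### Alternation -/

/-- A function of `n` arguments that changes its sign under transpositions of neighbours is
multiplied by the sign under every permutation. -/
theorem map_comp_perm_of_swap {W A : Type*} [AddCommGroup A] {n : ℕ} (f : (Fin n → W) → A)
    (h : ∀ (c : Fin n → W) (i j : Fin n), (j : ℕ) = i + 1 → f (c ∘ Equiv.swap i j) = -f c)
    (π : Equiv.Perm (Fin n)) (c : Fin n → W) : f (c ∘ π) = Equiv.Perm.sign π • f c := by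
  cases n with
  | zero =>
    rw [Subsingleton.elim π 1]
    simp
  | succ n =>
    have hπ : π ∈ Submonoid.closure
        (Set.range fun i : Fin n => Equiv.swap i.castSucc i.succ) := by
      rw [Equiv.Perm.mclosure_swap_castSucc_succ]
      trivial
    induction hπ using Submonoid.closure_induction generalizing c with
    | mem π hπ =>
      obtain ⟨i, rfl⟩ := hπ
      rw [h c _ _ (by simp), Equiv.Perm.sign_swap (Fin.castSucc_lt_succ).ne]
      simp
    | one => simp
    | mul π π' _ _ h1 h2 =>
      rw [Equiv.Perm.coe_mul, ← Function.comp_assoc, h2, h1, smul_smul, Equiv.Perm.sign_mul,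
        mul_comm]

theorem sign_revPerm (n : ℕ) :
    Equiv.Perm.sign (Fin.revPerm : Equiv.Perm (Fin n)) = (-1) ^ (∑ k ∈ Finset.range n, k) := by
  induction n with
  | zero =>
    rw [Subsingleton.elim Fin.revPerm 1]
    simp
  | succ n ih =>
    have h : (Fin.revPerm : Equiv.Perm (Fin (n + 1))) =
        (finRotate (n + 1))⁻¹ * Equiv.Perm.decomposeFin.symm (0, Fin.revPerm) := by
      rw [eq_inv_mul_iff_mul_eq]
      ext1 i
      refine Fin.cases ?_ (fun i => ?_) i
      · simp
      · simp [Fin.rev_succ]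
    rw [h, Equiv.Perm.sign_mul, Equiv.Perm.sign_inv, sign_finRotate,
      Equiv.Perm.decomposeFin.symm_sign, ih, Finset.sum_range_succ, pow_add]
    simp [mul_comm]

/-- A finite tuple as an infinite sequence. -/
def extendSeq {W : Type*} [Zero W] {n : ℕ} (c : Fin n → W) (i : ℕ) : W :=
  if h : i < n then c ⟨i, h⟩ else 0

theorem extendSeq_of_lt {W : Type*} [Zero W] {n : ℕ} (c : Fin n → W) {i : ℕ} (h : i < n) :
    extendSeq c i = c ⟨i, h⟩ := dif_pos h

namespace FreeSequence

variable {σ K : Type*} [Field K] {F : FreeSequence σ K} {I : Ideal (MvPolynomial σ K)} {m : ℕ}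

theorem tailDerivs_congr {a b : ℕ → σ → K} {k : ℕ} (h : 1 ≤ k → a k = b k) :
    F.tailDerivs a k = F.tailDerivs b k := by
  cases k with
  | zero => rfl
  | succ k => rw [tailDerivs, tailDerivs, derivs, derivs, h (by omega)]

theorem chain_tailDerivs_mul_diff (hF : F.IsMinimalCyclicResolution I) (a : ℕ → σ → K) (k : ℕ) :
    F.chain (F.tailDerivs a) (k + 1) * F.diff (k + 1) = 0 := by
  induction k with
  | zero => simp [chain, tailDerivs, diff_mul_diff hF]
  | succ k ih =>
    rw [chain, tailDerivs, derivs, Matrix.mul_assoc, derivs_mul_diff hF, Matrix.mul_neg,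
      ← Matrix.mul_assoc, ih, Matrix.zero_mul, neg_zero]

/-- Two neighbouring directions `a_r, a_{r+1}` in `φ_1 ∂φ_2 ∂φ_3 ⋯` are exchanged by means of the
second derivatives of `φ_{r+1} φ_{r+2} = 0`; the terms with an underived matrix vanish. -/
theorem chain_tailDerivs_swap [Fintype σ] (hF : F.IsMinimalCyclicResolution I)
    (hD : F.IsGorensteinLinear m) {a b : ℕ → σ → K} {r : ℕ} (hr : 1 ≤ r) (hrm : r + 1 < m)
    (h1 : b r = a (r + 1)) (h2 : b (r + 1) = a r) (h : ∀ i, 1 ≤ i → i ≠ r → i ≠ r + 1 → b i = a i)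
    {k : ℕ} (hk : r + 2 ≤ k) :
    F.chain (F.tailDerivs b) k = -F.chain (F.tailDerivs a) k := by
  obtain ⟨M, hM⟩ := exists_chain_eq_mul (F.tailDerivs a) hk
  rw [hM _ fun _ _ => rfl, hM (F.tailDerivs b) fun i hi =>
    tailDerivs_congr fun h' => h i h' (by omega) (by omega), ← Matrix.neg_mul]
  congr 1
  obtain ⟨r, rfl⟩ : ∃ r', r = r' + 1 := ⟨r - 1, by omega⟩
  have h3 : F.chain (F.tailDerivs b) (r + 1) = F.chain (F.tailDerivs a) (r + 1) :=
    chain_congr fun i hi => tailDerivs_congr fun h' => h i h' (by omega) (by omega)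
  have h4 := derivs_mul_derivs_add hF (a (r + 1)) (a (r + 1 + 1)) (r + 1)
  rw [hD.map_map_diff hF (by omega), Matrix.zero_mul, zero_add] at h4
  have h5 := congrArg (F.chain (F.tailDerivs a) (r + 1) * ·) h4
  simp only [Matrix.mul_neg, ← Matrix.mul_assoc, chain_tailDerivs_mul_diff hF, Matrix.zero_mul,
    neg_zero, Matrix.mul_add] at h5
  have hc (c : ℕ → σ → K) : F.chain (F.tailDerivs c) (r + 1 + 2) =
      F.chain (F.tailDerivs c) (r + 1) * (F.diff (r + 1)).map (dirDeriv (c (r + 1))) *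
        (F.diff (r + 1 + 1)).map (dirDeriv (c (r + 1 + 1))) := rfl
  rw [eq_neg_iff_add_eq_zero, hc, hc, h3, h1, h2]
  exact (add_comm _ _).trans h5

/-- For the directions of two linear matrices the exchange of neighbours only needs
`∂_v ∂_w (φ_{r+1} φ_{r+2}) = 0`. -/
theorem chain_derivs_swap [Fintype σ] (hF : F.IsMinimalCyclicResolution I)
    (hD : F.IsGorensteinLinear m) {a b : ℕ → σ → K} {r : ℕ} (hr : 1 ≤ r) (hrm : r + 2 < m)
    (h1 : b r = a (r + 1)) (h2 : b (r + 1) = a r) (h : ∀ i, i ≠ r → i ≠ r + 1 → b i = a i)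
    {k : ℕ} (hk : r + 2 ≤ k) :
    F.chain (F.derivs b) k = -F.chain (F.derivs a) k := by
  obtain ⟨M, hM⟩ := exists_chain_eq_mul (F.derivs a) hk
  rw [hM _ fun _ _ => rfl, hM (F.derivs b) fun i hi => by
    rw [derivs, derivs, h i (by omega) (by omega)], ← Matrix.neg_mul]
  congr 1
  obtain ⟨r, rfl⟩ : ∃ r', r = r' + 1 := ⟨r - 1, by omega⟩
  have h3 : F.chain (F.derivs b) (r + 1) = F.chain (F.derivs a) (r + 1) :=
    chain_congr fun i hi => by rw [derivs, derivs, h i (by omega) (by omega)]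
  have h4 := derivs_mul_derivs_add hF (a (r + 1)) (a (r + 1 + 1)) (r + 1)
  rw [hD.map_map_diff hF (by omega), hD.map_map_diff hF (by omega), Matrix.zero_mul, zero_add,
    Matrix.mul_zero, neg_zero] at h4
  have hc (c : ℕ → σ → K) : F.chain (F.derivs c) (r + 1 + 2) =
      F.chain (F.derivs c) (r + 1) * ((F.diff (r + 1)).map (dirDeriv (c (r + 1))) *
        (F.diff (r + 1 + 1)).map (dirDeriv (c (r + 1 + 1)))) := Matrix.mul_assoc _ _ _
  rw [eq_neg_iff_add_eq_zero, hc, hc, h3, h1, h2, ← Matrix.mul_add]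
  exact (congrArg (F.chain (F.derivs a) (r + 1) * ·) ((add_comm _ _).trans h4)).trans
    (Matrix.mul_zero _)

theorem map_chain_tailDerivs [Fintype σ] (hF : F.IsMinimalCyclicResolution I)
    (hD : F.IsGorensteinLinear m) (a : ℕ → σ → K) {k : ℕ} (hk : k + 1 < m) :
    (F.chain (F.tailDerivs a) (k + 1)).map (dirDeriv (a 0)) = F.chain (F.derivs a) (k + 1) := by
  induction k with
  | zero => simp [chain, tailDerivs, derivs]
  | succ k ih =>
    rw [chain, map_dirDeriv_mul, ih (by omega), tailDerivs, derivs,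
      hD.map_map_diff hF (by omega), Matrix.mul_zero, add_zero]
    rfl

/-- Only the derivatives of `φ_m` contribute second derivatives to the derivative of
`φ_1 ∂φ_2 ⋯ ∂φ_m`, and these cancel in the difference. -/
theorem chain_derivs_sub [Fintype σ] (hF : F.IsMinimalCyclicResolution I) {n : ℕ}
    (hD : F.IsGorensteinLinear (n + 2)) {a b : ℕ → σ → K} (h1 : b 0 = a (n + 1))
    (h2 : b (n + 1) = a 0) (h : ∀ i, 1 ≤ i → i ≤ n → b i = a i) :
    F.chain (F.derivs a) (n + 2) - F.chain (F.derivs b) (n + 2) =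
      (F.chain (F.tailDerivs a) (n + 2)).map (dirDeriv (a 0)) -
        (F.chain (F.tailDerivs b) (n + 2)).map (dirDeriv (b 0)) := by
  have h3 : F.chain (F.tailDerivs b) (n + 1) = F.chain (F.tailDerivs a) (n + 1) :=
    chain_congr fun i hi => tailDerivs_congr fun h' => h i h' (by omega)
  have h5 : ((F.diff (n + 1)).map (dirDeriv (a (n + 1)))).map (dirDeriv (a 0)) =
      ((F.diff (n + 1)).map (dirDeriv (b (n + 1)))).map (dirDeriv (b 0)) := by
    rw [h1, h2]
    ext1 i j
    exact dirDeriv_comm _ _ _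
  have hc (c : ℕ → σ → K) : (F.chain (F.tailDerivs c) (n + 2)).map (dirDeriv (c 0)) =
      F.chain (F.derivs c) (n + 2) + F.chain (F.tailDerivs c) (n + 1) *
        ((F.diff (n + 1)).map (dirDeriv (c (n + 1)))).map (dirDeriv (c 0)) := by
    rw [chain, map_dirDeriv_mul, map_chain_tailDerivs hF hD c (by omega)]
    rfl
  rw [hc, hc, h3, h5]
  abel

/-- The exchange of the first and the last direction is the reversal followed by the reversal of the
directions in between, and the signs of both are known. -/
theorem chain_derivs_swap_ends [Fintype σ] (hF : F.IsMinimalCyclicResolution I) {n : ℕ}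
    (hD : F.IsGorensteinLinear (n + 2)) {a b : ℕ → σ → K} (h1 : b 0 = a (n + 1))
    (h2 : b (n + 1) = a 0) (h : ∀ i, 1 ≤ i → i ≤ n → b i = a i) (s : Fin (F.rank 0))
    (t : Fin (F.rank (n + 2))) :
    F.chain (F.derivs b) (n + 2) s t = -F.chain (F.derivs a) (n + 2) s t := by
  -- the sequence `a` with the entries `a_1, …, a_n` replaced by `c`
  let mid (c : Fin n → σ → K) (i : ℕ) : σ → K :=
    if h : 1 ≤ i ∧ i - 1 < n then c ⟨i - 1, h.2⟩ else a i
  have hmid := map_comp_perm_of_swap (fun c => F.chain (F.derivs (mid c)) (n + 2) s t)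
    (fun c i j hij => by
      have hi := i.2
      have hj := j.2
      have := chain_derivs_swap hF hD (a := mid c) (b := mid (c ∘ Equiv.swap i j)) (r := i + 1)
        (by omega) (by omega) ?_ ?_ ?_ (k := n + 2) (by omega)
      · exact congrFun (congrFun this s) t
      · simp only [mid]
        rw [dif_pos (by omega), dif_pos (by omega)]
        have e1 : (⟨(i : ℕ) + 1 - 1, by omega⟩ : Fin n) = i := Fin.ext (by simp)
        have e2 : (⟨(i : ℕ) + 1 + 1 - 1, by omega⟩ : Fin n) = j := Fin.ext (by simp; omega)
        rw [e1, e2, Function.comp_apply, Equiv.swap_apply_left]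
      · simp only [mid]
        rw [dif_pos (by omega), dif_pos (by omega)]
        have e1 : (⟨(i : ℕ) + 1 - 1, by omega⟩ : Fin n) = i := Fin.ext (by simp)
        have e2 : (⟨(i : ℕ) + 1 + 1 - 1, by omega⟩ : Fin n) = j := Fin.ext (by simp; omega)
        rw [e1, e2, Function.comp_apply, Equiv.swap_apply_right]
      · intro l h3 h4
        simp only [mid]
        split_ifs with h5
        · rw [Function.comp_apply, Equiv.swap_apply_of_ne_of_ne] <;>
          · rw [Ne, Fin.ext_iff]
            simp only
            omega
        · rfl)
    Fin.revPerm (fun i => a (i + 1))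
  have e1 : F.chain (F.derivs (mid fun i => a (i + 1))) (n + 2) = F.chain (F.derivs a) (n + 2) := by
    refine chain_congr fun i _ => ?_
    have : mid (fun i => a (i + 1)) i = a i := by
      simp only [mid]
      split_ifs with h5
      · rw [Nat.sub_add_cancel h5.1]
      · rfl
    rw [derivs, derivs, this]
  have e2 := chain_derivs_reverse hF hD (a := b)
    (b := mid ((fun i : Fin n => a (i + 1)) ∘ Fin.revPerm)) ?_ s t
  · rw [e2, hmid, e1, sign_revPerm, Finset.sum_range_succ, Finset.sum_range_succ, pow_add, pow_add,
      Units.smul_def, zsmul_eq_mul]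
    push_cast
    have h6 : ((-1 : MvPolynomial σ K) ^ (∑ k ∈ Finset.range n, k)) *
        (-1) ^ (∑ k ∈ Finset.range n, k) = 1 := by
      rw [← mul_pow]
      simp
    have h7 : ((-1 : MvPolynomial σ K) ^ n) * (-1) ^ n = 1 := by
      rw [← mul_pow]
      simp
    rw [pow_succ]
    linear_combination (-F.chain (F.derivs a) (n + 2) s t) * h7 -
      (F.chain (F.derivs a) (n + 2) s t) * (-1) ^ n * (-1) ^ n * h6
  · intro k l hkl
    simp only [mid]
    split_ifs with h5
    · rw [Function.comp_apply, h k (by omega) (by omega)]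
      simp only [Fin.revPerm_apply, Fin.val_rev]
      congr 1
      omega
    · obtain h6 | h6 : l = 0 ∨ l = n + 1 := by omega
      · subst h6
        obtain rfl : k = n + 1 := by omega
        rw [h2]
      · subst h6
        obtain rfl : k = 0 := by omega
        rw [h1]

theorem two_mul_chain_derivs [Fintype σ] (hF : F.IsMinimalCyclicResolution I) {n : ℕ}
    (hD : F.IsGorensteinLinear (n + 2)) {a b : ℕ → σ → K} (h1 : b 0 = a (n + 1))
    (h2 : b (n + 1) = a 0) (h : ∀ i, 1 ≤ i → i ≤ n → b i = a i) (s : Fin (F.rank 0))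
    (t : Fin (F.rank (n + 2))) :
    2 * F.chain (F.derivs a) (n + 2) s t =
      dirDeriv (a 0) (F.chain (F.tailDerivs a) (n + 2) s t) -
        dirDeriv (b 0) (F.chain (F.tailDerivs b) (n + 2) s t) := by
  have h3 := congrFun (congrFun (chain_derivs_sub hF hD h1 h2 h) s) t
  simp only [Matrix.sub_apply, Matrix.map_apply] at h3
  rw [← h3, chain_derivs_swap_ends hF hD h1 h2 h]
  ring

end FreeSequence

namespace FreeSequence

variable {σ K : Type*} [Field K] {F : FreeSequence σ K} {I : Ideal (MvPolynomial σ K)}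

/-- The sequence whose entries with the indices `1, …, n` are `c`. -/
def shiftSeq {W : Type*} [Zero W] {n : ℕ} (c : Fin n → W) (i : ℕ) : W := extendSeq c (i - 1)

theorem shiftSeq_succ {W : Type*} [Zero W] {n : ℕ} (c : Fin n → W) (i : Fin n) :
    shiftSeq c ((i : ℕ) + 1) = c i := extendSeq_of_lt c i.2

theorem shiftSeq_of_ne {W : Type*} [Zero W] {n : ℕ} {c d : Fin n → W} {i : Fin n}
    (h : ∀ j, j ≠ i → d j = c j) {k : ℕ} (hk : 1 ≤ k) (hki : k ≠ i + 1) :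
    shiftSeq d k = shiftSeq c k := by
  rw [shiftSeq, shiftSeq, extendSeq, extendSeq]
  split_ifs with h1
  · exact h _ fun h2 => hki (by rw [← h2]; simp; omega)
  · rfl

theorem chain_tailDerivs_linear {n : ℕ} {c d e : Fin n → σ → K} {i : Fin n} (x y : K)
    (h : e i = x • c i + y • d i) (hc : ∀ j, j ≠ i → e j = c j) (hd : ∀ j, j ≠ i → e j = d j) :
    F.chain (F.tailDerivs (shiftSeq e)) (n + 1) =
      x • F.chain (F.tailDerivs (shiftSeq c)) (n + 1) +
        y • F.chain (F.tailDerivs (shiftSeq d)) (n + 1) := by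
  obtain ⟨M, hM⟩ := exists_chain_eq_mul (F.tailDerivs (shiftSeq e))
    (show (i : ℕ) + 2 ≤ n + 1 by omega)
  have h1 : ∀ {f : Fin n → σ → K}, (∀ j, j ≠ i → e j = f j) → ∀ k : ℕ, k ≠ (i : ℕ) + 1 →
      F.tailDerivs (shiftSeq f) k = F.tailDerivs (shiftSeq e) k := fun hf k hk =>
    tailDerivs_congr fun h2 => (shiftSeq_of_ne hf h2 hk).symm
  have h2 : ∀ {f : Fin n → σ → K}, (∀ j, j ≠ i → e j = f j) →
      F.chain (F.tailDerivs (shiftSeq f)) (i + 2) = F.chain (F.tailDerivs (shiftSeq e)) (i + 1) *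
        (F.diff (i + 1)).map (dirDeriv (f i)) := fun {f} hf => by
    rw [chain, chain_congr (fun k hk => h1 hf k (by omega)), tailDerivs, derivs, shiftSeq_succ]
  have h3 : (F.diff (i + 1)).map (dirDeriv (e i)) =
      x • (F.diff (i + 1)).map (dirDeriv (c i)) + y • (F.diff (i + 1)).map (dirDeriv (d i)) := by
    ext1 s t
    simp only [Matrix.map_apply, Matrix.add_apply, Matrix.smul_apply, h, dirDeriv_add,
      dirDeriv_smul]
  rw [hM _ fun _ _ => rfl, hM _ fun k hk => h1 hc k (by omega),
    hM _ fun k hk => h1 hd k (by omega), h2 hc, h2 hd, h2 (f := e) fun _ _ => rfl, h3]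
  simp only [Matrix.mul_add, Matrix.add_mul, Matrix.mul_smul, Matrix.smul_mul]

/-- The entries of `φ_1 ∂φ_2 ⋯ ∂φ_m` as an alternating form in the directions of the
derivatives. -/
noncomputable def tailForm [Fintype σ] (hK : (2 : K) ≠ 0) (hF : F.IsMinimalCyclicResolution I)
    {n : ℕ} (hD : F.IsGorensteinLinear (n + 1)) (s : Fin (F.rank 0)) (t : Fin (F.rank (n + 1))) :
    (σ → K) [⋀^Fin n]→ₗ[K] MvPolynomial σ K where
  toFun c := F.chain (F.tailDerivs (shiftSeq c)) (n + 1) s t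
  map_update_add' c i v w := by
    have := chain_tailDerivs_linear (F := F) (c := Function.update c i v)
      (d := Function.update c i w) (e := Function.update c i (v + w)) (i := i) 1 1 (by simp)
      (fun j hj => by simp [hj]) (fun j hj => by simp [hj])
    rw [this]
    simp
  map_update_smul' c i x v := by
    have := chain_tailDerivs_linear (F := F) (c := Function.update c i v)
      (d := Function.update c i v) (e := Function.update c i (x • v)) (i := i) x 0 (by simp)
      (fun j hj => by simp [hj]) (fun j hj => by simp [hj])
    rw [this]
    simp
  map_eq_zero_of_eq' c i j hij hne := by
    have h := map_comp_perm_of_swap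
      (fun c : Fin n → σ → K => F.chain (F.tailDerivs (shiftSeq c)) (n + 1) s t)
      (fun c i j hij => by
        have hj := j.2
        have := chain_tailDerivs_swap hF hD (a := shiftSeq c) (b := shiftSeq (c ∘ Equiv.swap i j))
          (r := i + 1) (by omega) (by omega) ?_ ?_ ?_ (k := n + 1) (by omega)
        · exact congrFun (congrFun this s) t
        · rw [shiftSeq_succ, ← hij, shiftSeq_succ]
          simp
        · rw [shiftSeq_succ, ← hij, shiftSeq_succ]
          simp
        · intro k h0 h1 h2
          rw [shiftSeq, shiftSeq, extendSeq, extendSeq]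
          split_ifs with h3
          · rw [Function.comp_apply, Equiv.swap_apply_of_ne_of_ne] <;>
            · rw [Ne, Fin.ext_iff]
              simp only
              omega
          · rfl)
      (Equiv.swap i j) c
    have h1 : c ∘ Equiv.swap i j = c := by
      ext1 k
      rw [Function.comp_apply]
      rcases eq_or_ne k i with rfl | hki
      · rw [Equiv.swap_apply_left, hij]
      rcases eq_or_ne k j with rfl | hkj
      · rw [Equiv.swap_apply_right, hij]
      rw [Equiv.swap_apply_of_ne_of_ne hki hkj]
    rw [h1, Equiv.Perm.sign_swap hne, Units.smul_def, Units.val_neg, Units.val_one, neg_one_smul,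
      eq_neg_iff_add_eq_zero, ← two_mul] at h
    have h2 : (2 : MvPolynomial σ K) ≠ 0 := by
      rw [← map_ofNat C 2]
      exact (map_ne_zero_iff _ (C_injective σ K)).2 hK
    exact (mul_eq_zero.1 h).resolve_left h2

/-- The exterior derivative of `tailForm`. -/
noncomputable def tailFormDeriv [Fintype σ] (hK : (2 : K) ≠ 0)
    (hF : F.IsMinimalCyclicResolution I) {n : ℕ} (hD : F.IsGorensteinLinear (n + 1))
    (s : Fin (F.rank 0)) (t : Fin (F.rank (n + 1))) :
    (σ → K) [⋀^Fin (n + 1)]→ₗ[K] MvPolynomial σ K :=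
  AlternatingMap.alternatizeUncurryFin
    { toFun := fun v => (dirDeriv v).toLinearMap.compAlternatingMap (tailForm hK hF hD s t)
      map_add' := fun v w => by
        ext1 c
        exact dirDeriv_add v w _
      map_smul' := fun x v => by
        ext1 c
        exact dirDeriv_smul x v _ }

theorem tailForm_apply [Fintype σ] (hK : (2 : K) ≠ 0) (hF : F.IsMinimalCyclicResolution I)
    {n : ℕ} (hD : F.IsGorensteinLinear (n + 1)) (s : Fin (F.rank 0)) (t : Fin (F.rank (n + 1)))
    (c : Fin n → σ → K) : tailForm hK hF hD s t c =
      F.chain (F.tailDerivs (shiftSeq c)) (n + 1) s t := rfl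

theorem tailForm_eq [Fintype σ] (hK : (2 : K) ≠ 0) (hF : F.IsMinimalCyclicResolution I)
    {n : ℕ} (hD : F.IsGorensteinLinear (n + 1)) (s : Fin (F.rank 0)) (t : Fin (F.rank (n + 1)))
    {c : Fin n → σ → K} {a : ℕ → σ → K} (h : ∀ i : Fin n, a (i + 1) = c i) :
    tailForm hK hF hD s t c = F.chain (F.tailDerivs a) (n + 1) s t := by
  rw [tailForm_apply, chain_congr fun k hk => tailDerivs_congr fun h1 => ?_]
  obtain ⟨k, rfl⟩ : ∃ k', k = k' + 1 := ⟨k - 1, by omega⟩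
  rw [h ⟨k, by omega⟩]
  exact shiftSeq_succ c ⟨k, by omega⟩

/-- Twice the product of the derivatives of all matrices is the sum of the two partial derivatives
of `tailForm` in the directions of the first and the last factor, up to signs. -/
theorem two_mul_chain_derivs_extendSeq [Fintype σ] (hK : (2 : K) ≠ 0)
    (hF : F.IsMinimalCyclicResolution I) {n : ℕ} (hD : F.IsGorensteinLinear (n + 1))
    (s : Fin (F.rank 0)) (t : Fin (F.rank (n + 1))) (v : Fin (n + 1) → σ → K) :
    2 * F.chain (F.derivs (extendSeq v)) (n + 1) s t =
      dirDeriv (v 0) (tailForm hK hF hD s t (v ∘ Fin.succ)) +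
        (-1) ^ n * dirDeriv (v (Fin.last n)) (tailForm hK hF hD s t (v ∘ Fin.castSucc)) := by
  cases n with
  | zero =>
    rw [tailForm_apply, tailForm_apply]
    simp only [chain, tailDerivs, derivs, extendSeq_of_lt v (Nat.zero_lt_one), Matrix.one_mul,
      Matrix.map_apply]
    have h1 : (⟨0, Nat.zero_lt_one⟩ : Fin 1) = 0 := rfl
    have h2 : Fin.last 0 = 0 := rfl
    rw [h1, h2]
    ring
  | succ n =>
    have hv (i : Fin (n + 2)) : extendSeq v i = v i := extendSeq_of_lt v i.2
    let b (i : ℕ) : σ → K := if i = 0 then extendSeq v (n + 1) else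
      if i = n + 1 then extendSeq v 0 else extendSeq v i
    have h1 := two_mul_chain_derivs hF hD (a := extendSeq v) (b := b) (by simp [b]) (by simp [b])
      (fun i h1 h2 => by
        simp only [b]
        rw [if_neg (by omega), if_neg (by omega)]) s t
    have h2 : tailForm hK hF hD s t (v ∘ Fin.succ) =
        F.chain (F.tailDerivs (extendSeq v)) (n + 2) s t :=
      tailForm_eq hK hF hD s t fun i => hv i.succ
    have h3 : tailForm hK hF hD s t ((v ∘ Fin.castSucc) ∘ finRotate (n + 1)) =
        F.chain (F.tailDerivs b) (n + 2) s t := by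
      refine tailForm_eq hK hF hD s t fun i => ?_
      simp only [b, Function.comp_apply]
      rw [if_neg (by omega)]
      rcases eq_or_ne i (Fin.last n) with rfl | h
      · rw [if_pos (by simp), finRotate_last]
        exact hv 0
      · have h4 := coe_finRotate_of_ne_last h
        have h5 : (i : ℕ) ≠ n := fun h' => h (Fin.ext h')
        rw [if_neg (by omega), ← h4]
        exact hv (finRotate (n + 1) i).castSucc
    rw [AlternatingMap.map_perm, sign_finRotate, Nat.add_sub_cancel, Units.smul_def,
      zsmul_eq_mul] at h3
    push_cast at h3
    have h4 : b 0 = v (Fin.last (n + 1)) := by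
      simp only [b, if_true]
      exact hv (Fin.last (n + 1))
    have h5 : dirDeriv (v (Fin.last (n + 1))) ((-1 : MvPolynomial σ K) ^ n) = 0 := by
      rw [Derivation.leibniz_pow]
      simp
    have h6 : extendSeq v 0 = v 0 := hv 0
    rw [h1, h2, ← h3, h4, Derivation.leibniz, h5, h6]
    simp only [smul_eq_mul]
    ring

theorem tailFormDeriv_apply [Fintype σ] (hK : (2 : K) ≠ 0)
    (hF : F.IsMinimalCyclicResolution I) {n : ℕ} (hD : F.IsGorensteinLinear (n + 1))
    (s : Fin (F.rank 0)) (t : Fin (F.rank (n + 1))) (v : Fin (n + 1) → σ → K) :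
    tailFormDeriv hK hF hD s t v = ∑ i : Fin (n + 1), (-1) ^ (i : ℕ) •
      dirDeriv (v i) (tailForm hK hF hD s t (v ∘ i.succAbove)) := by
  rw [tailFormDeriv, AlternatingMap.alternatizeUncurryFin_apply]
  rfl

/-- Up to its sign, a partial derivative of `tailForm` with permuted arguments only depends on the
direction of the derivative. -/
theorem sign_smul_dirDeriv_tailForm [Fintype σ] (hK : (2 : K) ≠ 0)
    (hF : F.IsMinimalCyclicResolution I) {n : ℕ} (hD : F.IsGorensteinLinear (n + 1))
    (s : Fin (F.rank 0)) (t : Fin (F.rank (n + 1))) (v : Fin (n + 1) → σ → K)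
    (π : Equiv.Perm (Fin (n + 1))) :
    Equiv.Perm.sign π • dirDeriv (v (π 0)) (tailForm hK hF hD s t (v ∘ π ∘ Fin.succ)) =
      (-1) ^ (π 0 : ℕ) • dirDeriv (v (π 0)) (tailForm hK hF hD s t (v ∘ (π 0).succAbove)) := by
  obtain ⟨⟨p, e⟩, he⟩ := Equiv.Perm.decomposeFin.symm.surjective ((π 0).cycleRange * π)
  have hp : p = 0 := by
    have := congrArg (· 0) he
    simpa using this
  subst hp
  have hsucc (j : Fin n) : π j.succ = (π 0).succAbove (e j) := by
    have h1 := congrArg (· j.succ) he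
    simp only [Equiv.Perm.decomposeFin_symm_apply_succ, Equiv.swap_self, Equiv.refl_apply,
      Equiv.Perm.mul_apply] at h1
    rw [← Fin.cycleRange_symm_succ, h1, Equiv.symm_apply_apply]
  have hsign : Equiv.Perm.sign π = (-1) ^ (π 0 : ℕ) * Equiv.Perm.sign e := by
    have h1 := congrArg Equiv.Perm.sign he
    rw [Equiv.Perm.sign_mul, Fin.sign_cycleRange, Equiv.Perm.decomposeFin.symm_sign, if_pos rfl,
      one_mul] at h1
    rw [h1, ← mul_assoc, ← mul_pow]
    simp
  have h2 : v ∘ π ∘ Fin.succ = (v ∘ (π 0).succAbove) ∘ e := funext fun j => by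
    simp only [Function.comp_apply, hsucc]
  rw [h2, AlternatingMap.map_perm, hsign]
  simp only [Units.smul_def, map_zsmul, smul_smul]
  congr 1
  push_cast
  rw [mul_assoc, ← Units.val_mul, Int.units_mul_self, Units.val_one, mul_one]

theorem sum_Icc_one_eq_sum_range {M : Type*} [AddCommMonoid M] (f : ℕ → M) (N : ℕ) :
    ∑ k ∈ Finset.Icc 1 N, f k = ∑ k ∈ Finset.range N, f (k + 1) := by
  induction N with
  | zero => simp
  | succ N ih => rw [Finset.sum_Icc_succ_top (by omega), ih, Finset.sum_range_succ]

/-- The double bracket is the exterior derivative of `tailForm`; in particular it is alternating.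
Each summand of the double bracket is half the sum of two partial derivatives of `tailForm`, and
every partial derivative occurs in two summands. -/
theorem sum_chain_derivs_rotate [Fintype σ] (hK : (2 : K) ≠ 0)
    (hF : F.IsMinimalCyclicResolution I) {n : ℕ} (hD : F.IsGorensteinLinear (n + 1))
    (s : Fin (F.rank 0)) (t : Fin (F.rank (n + 1))) (v : Fin (n + 1) → σ → K) :
    ∑ k ∈ Finset.Icc 1 (n + 1),
      F.chain (F.derivs (extendSeq fun i => v ((finRotate (n + 1) ^ (2 * k)) i))) (n + 1) s t =
    tailFormDeriv hK hF hD s t v := by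
  set ρ := finRotate (n + 1) with hρ
  -- the summands of the exterior derivative
  let g (i : Fin (n + 1)) : MvPolynomial σ K :=
    (-1) ^ (i : ℕ) • dirDeriv (v i) (tailForm hK hF hD s t (v ∘ i.succAbove))
  let h (l : ℕ) : MvPolynomial σ K := g ((ρ ^ l) 0)
  have hsign (l : ℕ) : Equiv.Perm.sign (ρ ^ l) = ((-1) ^ n) ^ l := by
    rw [map_pow, hρ, sign_finRotate, Nat.add_sub_cancel]
  have heven (k : ℕ) : (((-1 : ℤˣ) ^ n) ^ (2 * k)) = 1 := by
    rw [← pow_mul, mul_left_comm, pow_mul]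
    simp
  have hlast : ρ (Fin.last n) = 0 := finRotate_last
  have hcast (i : Fin n) : ρ i.castSucc = i.succ := by
    refine Fin.ext ?_
    rw [hρ, coe_finRotate_of_ne_last (Fin.castSucc_lt_last i).ne]
    simp
  have hterm (k : ℕ) :
      2 * F.chain (F.derivs (extendSeq fun i => v ((ρ ^ (2 * (k + 1))) i))) (n + 1) s t =
      h (2 * k + 2) + h (2 * k + 1) := by
    rw [two_mul_chain_derivs_extendSeq hK hF hD]
    have h1 := sign_smul_dirDeriv_tailForm hK hF hD s t v (ρ ^ (2 * (k + 1)))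
    have h2 := sign_smul_dirDeriv_tailForm hK hF hD s t v (ρ ^ (2 * k + 1))
    rw [hsign, heven, one_smul] at h1
    rw [hsign, pow_succ, heven, one_mul, Units.smul_def, zsmul_eq_mul] at h2
    have h3 (i : Fin (n + 1)) : (ρ ^ (2 * (k + 1))) i = (ρ ^ (2 * k + 1)) (ρ i) := by
      rw [← Equiv.Perm.mul_apply, ← pow_succ]
      rfl
    have h4 : v ((ρ ^ (2 * (k + 1))) (Fin.last n)) =
        v ((ρ ^ (2 * k + 1)) 0) := by
      simp only [h3, hlast]
    have h5 : (fun i => v ((ρ ^ (2 * (k + 1))) i)) ∘ Fin.castSucc =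
        v ∘ (ρ ^ (2 * k + 1)) ∘ Fin.succ := funext fun i => by
      simp only [h3, Function.comp_apply, hcast]
    rw [h4, h5]
    push_cast at h2
    exact congrArg₂ (· + ·) h1 h2
  have hpow (l : ℕ) : ((ρ ^ l) 0 : ℕ) = l % (n + 1) := by
    induction l with
    | zero => simp
    | succ l ih =>
      rw [pow_succ', Equiv.Perm.mul_apply]
      nth_rw 1 [hρ]
      rw [coe_finRotate]
      split_ifs with h1
      · rw [Fin.ext_iff, ih, Fin.val_last] at h1
        rw [Nat.add_mod, h1]
        rcases n with _ | n <;> simp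
      · rw [Fin.ext_iff, ih, Fin.val_last] at h1
        have h2 : l % (n + 1) < n + 1 := Nat.mod_lt l (Nat.succ_pos n)
        rw [ih, Nat.add_mod, Nat.mod_eq_of_lt (a := 1) (by omega)]
        exact (Nat.mod_eq_of_lt (by omega)).symm
  have hper (l : ℕ) : h (l + (n + 1)) = h l :=
    congrArg g (Fin.ext (by rw [hpow, hpow, Nat.add_mod_right]))
  have hsum (M : ℕ) : ∑ k ∈ Finset.range M, (h (2 * k + 2) + h (2 * k + 1)) =
      ∑ l ∈ Finset.range (2 * M), h (l + 1) := by
    induction M with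
    | zero => simp
    | succ M ih =>
      rw [Finset.sum_range_succ, ih, Nat.mul_succ, Finset.sum_range_succ, Finset.sum_range_succ]
      ring
  have hshift : ∑ l ∈ Finset.range (n + 1), h (l + 1) = ∑ i, g i := by
    have h1 := Finset.sum_range_succ' h (n + 1)
    have h2 : h (n + 1) = h 0 := by simpa using hper 0
    rw [Finset.sum_range_succ, h2] at h1
    rw [← add_right_cancel h1, Finset.sum_range]
    exact Finset.sum_congr rfl fun i _ =>
      congrArg g (Fin.ext (by rw [hpow, Nat.mod_eq_of_lt i.2]))
  have h2 : (2 : MvPolynomial σ K) ≠ 0 := by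
    rw [← map_ofNat C 2]
    exact (map_ne_zero_iff _ (C_injective σ K)).2 hK
  refine mul_left_cancel₀ h2 ?_
  rw [tailFormDeriv_apply, sum_Icc_one_eq_sum_range, Finset.mul_sum,
    Finset.sum_congr rfl fun k _ => hterm k, hsum, two_mul, two_mul, Finset.sum_range_add, hshift]
  refine congrArg (_ + ·) (Eq.trans ?_ hshift)
  exact Finset.sum_congr rfl fun l _ => by rw [← hper (l + 1)]; congr 1; ring

end FreeSequence

/-! ### Changes of coordinates -/

/-- An alternating form of top degree is a multiple of the determinant. -/
theorem alternatingMap_map_rows {K N : Type*} [Field K] [AddCommGroup N] [Module K N] {n : ℕ}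
    (β : (Fin n → K) [⋀^Fin n]→ₗ[K] N) (A : Matrix (Fin n) (Fin n) K) :
    β (fun j => A j) = A.det • β fun j => Pi.single j 1 := by
  have h : β = (LinearMap.toSpanSingleton K N (β fun j => Pi.single j 1)).compAlternatingMap
      Matrix.detRowAlternating := by
    refine (Pi.basisFun K (Fin n)).ext_alternating fun v hv => ?_
    obtain ⟨π, rfl⟩ : ∃ π : Equiv.Perm (Fin n), v = π :=
      ⟨Equiv.ofBijective v (Finite.injective_iff_bijective.1 hv), rfl⟩
    have h1 := β.map_perm (fun j => Pi.single j 1) π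
    have h2 := (Matrix.detRowAlternating (R := K)).map_perm (fun j : Fin n => Pi.single j 1) π
    have h3 : Matrix.detRowAlternating (fun j : Fin n => Pi.single j (1 : K)) = 1 := by
      have : (fun j : Fin n => Pi.single j (1 : K)) = (1 : Matrix (Fin n) (Fin n) K) := by
        ext i j
        simp [Matrix.one_apply, Pi.single_apply, eq_comm]
      rw [this]
      exact Matrix.det_one
    rw [h3] at h2
    simp only [Pi.basisFun_apply, LinearMap.compAlternatingMap_apply]
    refine h1.trans ?_
    have h4 : (Matrix.detRowAlternating fun i => Pi.single (π i) (1 : K)) =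
      Equiv.Perm.sign π • (1 : K) := h2
    rw [h4, LinearMap.toSpanSingleton_apply]
    rcases Int.units_eq_one_or (Equiv.Perm.sign π) with h5 | h5 <;> simp [h5]
  exact DFunLike.congr_fun h _

variable {K : Type*} [Field K] {m : ℕ}

theorem subst_X (g : GL (Fin (m + 1)) K) (j : Fin (m + 1)) :
    subst g (X j) = ∑ i, C (g.1 i j) * X i := by
  rw [subst, aeval_X]

theorem subst_subst (g h : GL (Fin (m + 1)) K) (p : MvPolynomial (Fin (m + 1)) K) :
    subst g (subst h p) = subst (g * h) p := by
  have : (subst g).comp (subst h) = subst (g * h) := by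
    refine algHom_ext fun j => ?_
    rw [AlgHom.comp_apply, subst_X, subst_X, map_sum]
    simp only [map_mul, subst_X, Units.val_mul, Matrix.mul_apply, map_sum, Finset.mul_sum,
      Finset.sum_mul, ← algebraMap_eq, AlgHom.commutes]
    rw [Finset.sum_comm]
    exact Finset.sum_congr rfl fun _ _ => Finset.sum_congr rfl fun _ _ => by ring
  exact DFunLike.congr_fun this p

theorem subst_one (p : MvPolynomial (Fin (m + 1)) K) :
    subst (1 : GL (Fin (m + 1)) K) p = p := by
  have : subst (1 : GL (Fin (m + 1)) K) = AlgHom.id K _ := by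
    refine algHom_ext fun j => ?_
    rw [subst_X]
    simp [Matrix.one_apply, apply_ite C, ite_mul]
  rw [this, AlgHom.id_apply]

theorem constantCoeff_subst (g : GL (Fin (m + 1)) K) (p : MvPolynomial (Fin (m + 1)) K) :
    constantCoeff (subst g p) = constantCoeff p := by
  have : (constantCoeff : MvPolynomial (Fin (m + 1)) K →+* K).comp (subst g).toRingHom =
      constantCoeff := by
    refine ringHom_ext (fun r => ?_) fun i => ?_
    · simp [subst]
    · simp [subst_X]
  exact RingHom.congr_fun this p

/-- The chain rule. -/
theorem dirDeriv_subst (g : GL (Fin (m + 1)) K) (v : Fin (m + 1) → K)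
    (p : MvPolynomial (Fin (m + 1)) K) :
    dirDeriv v (subst g p) = subst g (dirDeriv (Matrix.vecMul v g.1) p) := by
  induction p using MvPolynomial.induction_on with
  | C a =>
    have (w : Fin (m + 1) → K) : dirDeriv w (C a) = 0 := derivation_C _ a
    rw [this, map_zero, subst, aeval_C, algebraMap_eq, this]
  | add p q hp hq => simp only [map_add, hp, hq]
  | mul_X p i hp =>
    have h : dirDeriv v (subst g (X i)) = subst g (dirDeriv (Matrix.vecMul v g.1) (X i)) := by
      rw [subst_X, map_sum]
      simp [dirDeriv, mkDerivation_X, Matrix.vecMul, dotProduct, subst, mul_comm]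
    simp only [map_mul, map_add, Derivation.leibniz, smul_eq_mul, hp, h]

/-- The linear functional on linear forms given by the evaluation at the vector `v`, encoded as the
constant term of the derivative in the direction `v`. -/
noncomputable def dualVec (K : Type*) [Field K] (m : ℕ) :
    (Fin (m + 1) → K) →ₗ[K] Module.Dual K (Forms K m 1) where
  toFun v := (lcoeff K 0).comp ((dirDeriv v).toLinearMap.comp (Forms K m 1).subtype)
  map_add' v w := by
    ext p
    simp [dirDeriv_add]
  map_smul' c v := by
    ext p
    simp [dirDeriv_smul]

theorem dualVec_apply (v : Fin (m + 1) → K) (p : Forms K m 1) :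
    dualVec K m v p = constantCoeff (dirDeriv v (p : MvPolynomial (Fin (m + 1)) K)) := rfl

theorem dualVec_single (j : Fin (m + 1)) : dualVec K m (Pi.single j 1) = dualVar K j := by
  ext p
  rw [dualVec_apply, dirDeriv_single, constantCoeff_eq, coeff_pderiv]
  simp [dualVar]

theorem actDual_dualVec (g : GL (Fin (m + 1)) K) (v : Fin (m + 1) → K) :
    actDual g (dualVec K m (Matrix.vecMul v g.1)) = dualVec K m v := by
  ext p
  have h : ((actForms g⁻¹ 1 p : Forms K m 1) : MvPolynomial (Fin (m + 1)) K) =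
    subst g⁻¹ (p : MvPolynomial (Fin (m + 1)) K) := rfl
  change dualVec K m (Matrix.vecMul v g.1) (actForms g⁻¹ 1 p) = _
  rw [dualVec_apply, dualVec_apply, h, ← constantCoeff_subst g, ← dirDeriv_subst, subst_subst,
    mul_inv_cancel, subst_one]

/-- The alternating map `(v_0, …, v_n) ↦ ∑_j (-1)^j l(v_j) ⊗ β(v_0, …, v̂_j, …, v_n)`. -/
noncomputable def tensorWedge {W N N' : Type*} [AddCommGroup W] [Module K W] [AddCommGroup N]
    [Module K N] [AddCommGroup N'] [Module K N'] {n : ℕ} (l : W →ₗ[K] N)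
    (β : W [⋀^Fin n]→ₗ[K] N') : W [⋀^Fin (n + 1)]→ₗ[K] N ⊗[K] N' :=
  AlternatingMap.alternatizeUncurryFin
    ({ toFun := fun v => (TensorProduct.mk K N N' (l v)).compAlternatingMap β
       map_add' := fun v w => AlternatingMap.ext fun c => by simp
       map_smul' := fun x v => AlternatingMap.ext fun c => by simp } :
      W →ₗ[K] W [⋀^Fin n]→ₗ[K] N ⊗[K] N')

theorem tensorWedge_apply {W N N' : Type*} [AddCommGroup W] [Module K W] [AddCommGroup N]
    [Module K N] [AddCommGroup N'] [Module K N'] {n : ℕ} (l : W →ₗ[K] N)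
    (β : W [⋀^Fin n]→ₗ[K] N') (v : Fin (n + 1) → W) : tensorWedge l β v =
      ∑ j : Fin (n + 1), (-1 : K) ^ (j : ℕ) • (l (v j) ⊗ₜ[K] β fun i => v (j.succAbove i)) := by
  rw [tensorWedge, AlternatingMap.alternatizeUncurryFin_apply]
  refine Finset.sum_congr rfl fun j _ => ?_
  rcases Nat.even_or_odd (j : ℕ) with h | h <;> simp [h.neg_one_pow] <;> rfl
theorem tensorWedge_map_rows {N N' : Type*} [AddCommGroup N] [Module K N] [AddCommGroup N']
    [Module K N'] {n : ℕ} (l : (Fin (n + 1) → K) →ₗ[K] N)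
    (β : (Fin (n + 1) → K) [⋀^Fin n]→ₗ[K] N') (A : Matrix (Fin (n + 1)) (Fin (n + 1)) K) :
    tensorWedge l β (fun j => A j) = A.det • tensorWedge l β fun j => Pi.single j 1 :=
  alternatingMap_map_rows (tensorWedge l β) A

namespace FreeSequence

theorem bracket_eq_chain (F : FreeSequence (Fin (m + 1)) K) (k : ℕ) {a : Fin k → Fin (m + 1)}
    {b : ℕ → Fin (m + 1) → K} (h : ∀ i : Fin k, b i = Pi.single (a i) 1) :
    F.bracket k a = F.chain (F.derivs b) k := by
  induction k with
  | zero => rfl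
  | succ k ih =>
    have h1 : b k = Pi.single (a (Fin.last k)) 1 := h (Fin.last k)
    rw [bracket, chain, ih fun i => h i.castSucc, derivs, h1, dirDeriv_single]

theorem chain_derivs_changeCoordinates (F : FreeSequence (Fin (m + 1)) K)
    (g : GL (Fin (m + 1)) K) (b : ℕ → Fin (m + 1) → K) (k : ℕ) :
    (F.changeCoordinates g).chain ((F.changeCoordinates g).derivs b) k =
      (F.chain (F.derivs fun i => Matrix.vecMul (b i) g.1) k).map (subst g) := by
  induction k with
  | zero =>
    rw [chain, chain]
    exact ((subst g).toRingHom.mapMatrix.map_one).symm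
  | succ k ih =>
    have h : (F.changeCoordinates g).derivs b k =
        (F.derivs (fun i => Matrix.vecMul (b i) g.1) k).map (subst g) := by
      ext1 i j
      exact dirDeriv_subst g (b k) (F.diff k i j)
    rw [chain, chain, ih, h]
    exact (Matrix.map_mul (f := (subst g).toRingHom)).symm

theorem isHomogeneousOfDegree_chain_derivs {I : Ideal (MvPolynomial (Fin (m + 1)) K)}
    {F : FreeSequence (Fin (m + 1)) K} (hF : F.IsMinimalCyclicResolution I)
    (b : ℕ → Fin (m + 1) → K) (k : ℕ) (s : Fin (F.rank 0)) (t : Fin (F.rank k)) :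
    IsHomogeneousOfDegree (F.chain (F.derivs b) k s t) (F.deg k t - k) := by
  induction k with
  | zero =>
    rw [chain, Matrix.one_apply, hF.deg_zero]
    split_ifs
    · exact Or.inr ⟨0, rfl, isHomogeneous_one _ _⟩
    · exact Or.inl rfl
  | succ k ih =>
    rw [chain, Matrix.mul_apply]
    refine .sum fun i _ => ?_
    have := (ih i).mul ((hF.graded k i t).dirDeriv (b k))
    convert this using 1
    · rfl
    · push_cast
      ring

/-- The forms `Ω_j` in terms of directional derivatives along basis vectors. -/
theorem omega_apply (F : FreeSequence (Fin (m + 1)) K) (j : Fin (m + 1)) (s : Fin (F.rank 0))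
    (t : Fin (F.rank m)) : F.omega j s t = (-1) ^ ((j : ℕ) + 1) * ∑ k ∈ Finset.Icc 1 m,
      F.chain (F.derivs (extendSeq fun i =>
        Pi.single (j.succAbove ((finRotate m ^ (2 * k)) i)) 1)) m s t := by
  rw [omega, doubleBracket, Matrix.smul_apply, Matrix.sum_apply, smul_eq_mul]
  congr 1
  refine Finset.sum_congr rfl fun k _ => ?_
  exact congrFun (congrFun (F.bracket_eq_chain m fun i => extendSeq_of_lt _ i.2) s) t

theorem omega_changeCoordinates (F : FreeSequence (Fin (m + 1)) K) (g : GL (Fin (m + 1)) K)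
    (j : Fin (m + 1)) (s : Fin (F.rank 0)) (t : Fin (F.rank m)) :
    (F.changeCoordinates g).omega j s t = (-1) ^ ((j : ℕ) + 1) *
      subst g (∑ k ∈ Finset.Icc 1 m, F.chain (F.derivs (extendSeq fun i =>
        g.1 (j.succAbove ((finRotate m ^ (2 * k)) i)))) m s t) := by
  refine ((F.changeCoordinates g).omega_apply j s t).trans ?_
  rw [map_sum]
  congr 1
  refine Finset.sum_congr rfl fun k _ => ?_
  refine (congrFun (congrFun (F.chain_derivs_changeCoordinates g _ m) s) t).trans ?_
  refine congrArg (subst g) (congrFun (congrFun (chain_congr fun i hi => ?_) s) t)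
  rw [derivs, derivs, extendSeq_of_lt _ hi, extendSeq_of_lt _ hi, Matrix.single_one_vecMul]
  rfl

end FreeSequence

open FreeSequence

section

variable {n : ℕ} {F : FreeSequence (Fin (n + 2)) K} {I : Ideal (MvPolynomial (Fin (n + 2)) K)}
  (hK : (2 : K) ≠ 0) (hF : F.IsMinimalCyclicResolution I) (hD : F.IsGorensteinLinear (n + 1))
  (s : Fin (F.rank 0)) (t : Fin (F.rank (n + 1)))

theorem tailFormDeriv_mem_forms (v : Fin (n + 1) → Fin (n + 2) → K) :
    tailFormDeriv hK hF hD s t v ∈ Forms K (n + 1) 2 := by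
  rw [← sum_chain_derivs_rotate]
  refine Submodule.sum_mem _ fun k _ => ?_
  rw [mem_homogeneousSubmodule, ← isHomogeneousOfDegree_natCast]
  convert isHomogeneousOfDegree_chain_derivs hF _ (n + 1) s t using 1
  rw [hD.deg_top]
  push_cast
  ring

theorem omega_eq_tailFormDeriv (j : Fin (n + 2)) : F.omega j s t =
    (-1) ^ ((j : ℕ) + 1) * tailFormDeriv hK hF hD s t fun i => Pi.single (j.succAbove i) 1 := by
  rw [← sum_chain_derivs_rotate]
  exact F.omega_apply j s t

theorem omega_changeCoordinates_apply (g : GL (Fin (n + 2)) K) (j : Fin (n + 2)) :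
    (F.changeCoordinates g).omega j s t = (-1) ^ ((j : ℕ) + 1) *
      subst g (tailFormDeriv hK hF hD s t fun i => g.1 (j.succAbove i)) := by
  rw [← sum_chain_derivs_rotate]
  exact F.omega_changeCoordinates g j s t

/-- The double bracket as an alternating form with values in `S² V`. -/
noncomputable def bracketForm : (Fin (n + 2) → K) [⋀^Fin (n + 1)]→ₗ[K] Forms K (n + 1) 2 :=
  (tailFormDeriv hK hF hD s t).codRestrict _ (tailFormDeriv_mem_forms hK hF hD s t)

/-- The alternating map `(v_0, …, v_m) ↦ ∑_j (-1)^j v_j ⊗ [[v_0, …, v̂_j, …, v_m]]` with values in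
`V^* ⊗ S² V`, whose value at the standard basis is `-Ω`. -/
noncomputable def omegaForm : (Fin (n + 2) → K) [⋀^Fin (n + 2)]→ₗ[K]
    Module.Dual K (Forms K (n + 1) 1) ⊗[K] Forms K (n + 1) 2 :=
  tensorWedge (dualVec K (n + 1)) (bracketForm hK hF hD s t)

theorem omegaForm_apply (v : Fin (n + 2) → Fin (n + 2) → K) : omegaForm hK hF hD s t v =
    ∑ j : Fin (n + 2), (-1 : K) ^ (j : ℕ) •
      (dualVec K (n + 1) (v j) ⊗ₜ[K] bracketForm hK hF hD s t fun i => v (j.succAbove i)) :=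
  tensorWedge_apply _ _ v

theorem tensorOf_eq_neg_smul (a q : Fin (n + 2) → Forms K (n + 1) 2)
    (h : ∀ j, (q j : MvPolynomial (Fin (n + 2)) K) =
      (-1) ^ ((j : ℕ) + 1) * (a j : MvPolynomial _ K)) :
    tensorOf q = (-1 : K) • ∑ j : Fin (n + 2), (-1 : K) ^ (j : ℕ) • (dualVar K j ⊗ₜ[K] a j) := by
  rw [tensorOf, Finset.smul_sum]
  refine Finset.sum_congr rfl fun j _ => ?_
  have h1 : q j = ((-1 : K) * (-1 : K) ^ (j : ℕ)) • a j := by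
    refine Subtype.ext ?_
    rw [h j, Submodule.coe_smul, smul_eq_C_mul]
    simp only [map_mul, map_neg, map_one, map_pow]
    ring
  rw [h1, TensorProduct.tmul_smul, smul_smul]

end

/-- Under a change of coordinates the alternating map `omegaForm` is evaluated at the rows of the
matrix `g` instead of the standard basis, which accounts for the factor `det g`. -/
theorem tensorOf_omega_changeCoordinates {n : ℕ} {F : FreeSequence (Fin (n + 2)) K}
    {I : Ideal (MvPolynomial (Fin (n + 2)) K)} (hK : (2 : K) ≠ 0)
    (hF : F.IsMinimalCyclicResolution I) (hD : F.IsGorensteinLinear (n + 1))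
    (s : Fin (F.rank 0)) (t : Fin (F.rank (n + 1))) (g : GL (Fin (n + 2)) K) :
    ∃ (h : ∀ j, F.omega j s t ∈ Forms K (n + 1) 2)
      (h' : ∀ j, (F.changeCoordinates g).omega j s t ∈ Forms K (n + 1) 2),
      tensorOf (fun j => ⟨(F.changeCoordinates g).omega j s t, h' j⟩) =
        Matrix.det (g : Matrix (Fin (n + 2)) (Fin (n + 2)) K) •
          actTensor g (tensorOf (fun j => ⟨F.omega j s t, h j⟩)) := by
  have hmul (k : ℕ) (p : MvPolynomial (Fin (n + 2)) K) (hp : p ∈ Forms K (n + 1) 2) :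
      (-1) ^ k * p ∈ Forms K (n + 1) 2 := by
    rcases neg_one_pow_eq_or (MvPolynomial (Fin (n + 2)) K) k with h | h <;> rw [h]
    · rwa [one_mul]
    · rw [neg_one_mul]
      exact Submodule.neg_mem _ hp
  refine ⟨fun j => ?_, fun j => ?_, ?_⟩
  · rw [omega_eq_tailFormDeriv hK hF hD]
    exact hmul _ _ (tailFormDeriv_mem_forms hK hF hD s t _)
  · rw [omega_changeCoordinates_apply hK hF hD]
    exact hmul _ _ (subst_mem_forms g 2 _ (tailFormDeriv_mem_forms hK hF hD s t _))
  · have h1 : omegaForm hK hF hD s t (fun j => g.1 j) =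
        g.1.det • omegaForm hK hF hD s t fun j => Pi.single j 1 := tensorWedge_map_rows _ _ _
    rw [tensorOf_eq_neg_smul
        (fun j => actForms g 2 (bracketForm hK hF hD s t fun i => g.1 (j.succAbove i))) _
        fun j => omega_changeCoordinates_apply hK hF hD s t g j,
      tensorOf_eq_neg_smul
        (fun j => bracketForm hK hF hD s t fun i => Pi.single (j.succAbove i) 1) _
        fun j => omega_eq_tailFormDeriv hK hF hD s t j]
    rw [map_smul, smul_comm, ← map_smul]
    congr 1
    have h2 : ∑ j : Fin (n + 2), (-1 : K) ^ (j : ℕ) • (dualVar K j ⊗ₜ[K]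
        bracketForm hK hF hD s t fun i => Pi.single (j.succAbove i) 1) =
        omegaForm hK hF hD s t fun j => Pi.single j 1 := by
      rw [omegaForm_apply]
      simp only [dualVec_single]
    rw [h2]
    refine Eq.trans ?_ (congrArg (actTensor g) h1)
    rw [omegaForm_apply, map_sum]
    refine Finset.sum_congr rfl fun j _ => ?_
    rw [map_smul, actTensor, TensorProduct.map_tmul, ← dualVec_single, ← actDual_dualVec g,
      Matrix.single_one_vecMul]
    rfl


/-! ### The Gorenstein duality of points in general position -/

/-- The radical of the pairing `(c, b) ↦ λ(E(c) E(b))` is spanned by the vector `l` with `E(l) = 1`: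
if `w ↦ λ(E(c) w)` vanishes on the kernel of `λ`, it is a multiple of `λ`, whence `E(c)` is
constant. -/
theorem eq_smul_of_pairing_eq_zero {L V ι : Type*} [Field L] [AddCommGroup V] [Module L V]
    [DecidableEq ι] {E : V →ₗ[L] ι → L} {lam : Module.Dual L (ι → L)}
    (hE : Function.Injective E) (hlam : LinearMap.range E = LinearMap.ker lam)
    (hsingle : ∀ P, lam (Pi.single P 1) ≠ 0) {l : V} (hl : E l = 1) {c : V}
    (h : ∀ b, lam (E c * E b) = 0) : ∃ a : L, c = a • l := by
  have h1 : LinearMap.ker lam ≤ LinearMap.ker (lam.comp (LinearMap.mulLeft L (E c))) := by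
    intro w hw
    rw [← hlam] at hw
    obtain ⟨b, rfl⟩ := hw
    exact h b
  obtain ⟨a, ha⟩ := Submodule.mem_span_singleton.1 <| by
    simpa using mem_span_of_iInf_ker_le_ker (ι := Unit) (L := fun _ => lam)
      ((iInf_le _ ()).trans h1)
  refine ⟨a, hE (funext fun P => ?_)⟩
  have h2 := LinearMap.congr_fun ha (Pi.single P 1)
  have h3 : E c * Pi.single P 1 = E c P • Pi.single P (1 : L) := by
    ext Q
    by_cases hQ : Q = P
    · subst hQ; simp
    · simp [hQ]
  have h4 : a * lam (Pi.single P 1) = E c P * lam (Pi.single P 1) := by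
    simpa [h3] using h2
  rw [map_smul, hl, ← mul_right_cancel₀ (hsingle P) h4]
  simp

/-- As `c_0` spans the radical, the functionals `b ↦ λ(E(c_i) E(b))` for `1 ≤ i ≤ m` are linearly
independent. -/
theorem exists_pairing_ne_zero {L V ι : Type*} [Field L] [AddCommGroup V] [Module L V]
    [DecidableEq ι] {E : V →ₗ[L] ι → L} {lam : Module.Dual L (ι → L)}
    (hE : Function.Injective E) (hlam : LinearMap.range E = LinearMap.ker lam)
    (hsingle : ∀ P, lam (Pi.single P 1) ≠ 0) {m : ℕ} {c : ℕ → V} (hl : E (c 0) = 1)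
    (hc : LinearIndependent L fun j : Fin (m + 1) => c j) {i : ℕ} (hi : 1 ≤ i) (him : i ≤ m) :
    ∃ b, (∀ t, 1 ≤ t → t < i → lam (E (c t) * E b) = 0) ∧ lam (E (c i) * E b) ≠ 0 := by
  by_contra! hcon
  let φ : V →ₗ[L] Module.Dual L V := LinearMap.mk₂ L (fun x b => lam (E x * E b))
    (fun _ _ _ => by rw [map_add, add_mul, map_add])
    (fun _ _ _ => by rw [map_smul, smul_mul_assoc, map_smul])
    (fun _ _ _ => by rw [map_add, mul_add, map_add])
    (fun _ _ _ => by rw [map_smul, mul_smul_comm, map_smul])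
  let s : Fin (i - 1) → Fin (m + 1) := fun t => ⟨t + 1, by omega⟩
  have h1 : φ (c i) ∈ Submodule.span L (Set.range fun t => φ (c (s t))) := by
    refine mem_span_of_iInf_ker_le_ker fun b hb => ?_
    rw [Submodule.mem_iInf] at hb
    refine hcon b fun t ht hti => ?_
    have := hb ⟨t - 1, by omega⟩
    have h2 : ((s ⟨t - 1, by omega⟩ : Fin (m + 1)) : ℕ) = t := by simp [s]; omega
    rw [h2] at this
    exact this
  obtain ⟨a, ha⟩ := (Submodule.mem_span_range_iff_exists_fun L).1 h1
  have h3 : φ (c i - ∑ t, a t • c (s t)) = 0 := by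
    rw [map_sub, map_sum, ← ha]
    simp
  obtain ⟨a0, ha0⟩ := eq_smul_of_pairing_eq_zero hE hlam hsingle hl fun b =>
    LinearMap.congr_fun h3 b
  have h4 : c i ∈ Submodule.span L ((fun j : Fin (m + 1) => c j) '' {j | (j : ℕ) ≠ i}) := by
    rw [sub_eq_iff_eq_add.1 ha0]
    refine Submodule.add_mem _ (Submodule.smul_mem _ _ (Submodule.subset_span ⟨0, ?_, rfl⟩))
      (Submodule.sum_mem _ fun t _ => Submodule.smul_mem _ _
        (Submodule.subset_span ⟨s t, ?_, rfl⟩))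
    · simp; omega
    · simp [s]; omega
  exact hc.notMem_span_image (x := ⟨i, by omega⟩) (s := {j | (j : ℕ) ≠ i}) (by simp) h4

/-- The linear form with coefficient vector `c`. -/
noncomputable def linForm {L : Type*} [Field L] {m : ℕ} :
    (Fin (m + 1) → L) →ₗ[L] MvPolynomial (Fin (m + 1)) L where
  toFun c := ∑ i, C (c i) * X i
  map_add' c c' := by simp [add_mul, Finset.sum_add_distrib]
  map_smul' a c := by simp [smul_eq_C_mul, Finset.mul_sum, mul_assoc]

section

variable {L : Type*} [Field L] {m : ℕ}

theorem isHomogeneous_linForm (c : Fin (m + 1) → L) : (linForm c).IsHomogeneous 1 :=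
  IsHomogeneous.sum _ _ _ fun i _ => by
    simpa using (isHomogeneous_C (Fin (m + 1)) (c i)).mul (isHomogeneous_X L i)

theorem eval_linForm (c v : Fin (m + 1) → L) : eval v (linForm c) = c ⬝ᵥ v := by
  simp [linForm, dotProduct]

theorem exists_linForm_eq {f : MvPolynomial (Fin (m + 1)) L} (hf : f.IsHomogeneous 1) :
    ∃ c, f = linForm c := by
  refine ⟨fun i => constantCoeff (pderiv i f), ?_⟩
  have h (i : Fin (m + 1)) : pderiv i f = C (constantCoeff (pderiv i f)) := by
    have h1 := hf.pderiv (i := i)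
    rw [constantCoeff_eq]
    exact totalDegree_eq_zero_iff_eq_C.1 ((totalDegree_zero_iff_isHomogeneous _).2 h1)
  have h2 := hf.sum_X_mul_pderiv
  rw [one_smul] at h2
  change f = ∑ i, C _ * X i
  rw [← h2]
  refine Finset.sum_congr rfl fun i _ => ?_
  rw [h2, ← h, mul_comm]

/-- The vectors of values of linear forms at `m + 2` points in general position form a hyperplane,
the kernel of a functional `λ`. The coefficients of `λ` are nonzero, because no nonzero linear form
vanishes at all the points but one. -/
theorem exists_dual_of_generalPosition {ι : Type*} [Fintype ι] [DecidableEq ι]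
    {v : ι → Fin (m + 1) → L} (hcard : Fintype.card ι = m + 2)
    (hv : ∀ c : Fin (m + 1) → L, c ≠ 0 → ∀ P₀, ∃ P, P ≠ P₀ ∧ c ⬝ᵥ v P ≠ 0) :
    ∃ (E : (Fin (m + 1) → L) →ₗ[L] ι → L) (lam : Module.Dual L (ι → L)),
      (∀ c P, E c P = c ⬝ᵥ v P) ∧ Function.Injective E ∧
      LinearMap.range E = LinearMap.ker lam ∧ ∀ P, lam (Pi.single P 1) ≠ 0 := by
  let E : (Fin (m + 1) → L) →ₗ[L] ι → L :=
    { toFun := fun c P => c ⬝ᵥ v P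
      map_add' := fun c c' => by ext; simp [add_dotProduct]
      map_smul' := fun c c' => by ext; simp [smul_dotProduct] }
  have hE : Function.Injective E := by
    refine (injective_iff_map_eq_zero E).2 fun c hc => ?_
    by_contra h0
    have : Nonempty ι := Fintype.card_pos_iff.1 (by omega)
    obtain ⟨P, -, hP⟩ := hv c h0 (Classical.arbitrary ι)
    exact hP (congrFun hc P)
  have hfin : Module.finrank L (LinearMap.range E) = m + 1 := by
    rw [LinearMap.finrank_range_of_inj hE]; simp
  have hlt : LinearMap.range E < ⊤ := by
    rw [lt_top_iff_ne_top]
    intro h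
    rw [h, finrank_top] at hfin
    simp [hcard] at hfin
  obtain ⟨lam, hlam0, hlam⟩ := Submodule.exists_le_ker_of_lt_top _ hlt
  have heq : LinearMap.range E = LinearMap.ker lam := by
    refine Submodule.eq_of_le_of_finrank_le hlam ?_
    have h1 := LinearMap.finrank_range_add_finrank_ker lam
    have h2 : LinearMap.range lam = ⊤ := LinearMap.range_eq_top.2 (LinearMap.surjective hlam0)
    rw [h2, finrank_top] at h1
    simp [hcard] at h1
    omega
  refine ⟨E, lam, fun _ _ => rfl, hE, heq, fun P hP => ?_⟩
  have : Pi.single P 1 ∈ LinearMap.range E := by rw [heq]; exact hP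
  obtain ⟨c, hc⟩ := this
  have hc0 : c ≠ 0 := by
    rintro rfl
    simpa using congrFun hc P
  obtain ⟨Q, hQ, h⟩ := hv c hc0 P
  refine h ((congrFun hc Q).trans ?_)
  simp [hQ]

theorem exists_gl_of_ne_zero {c : Fin (m + 1) → L} (hc : c ≠ 0) :
    ∃ g : GL (Fin (m + 1)) L, ∀ i, g.1 i 0 = c i := by
  obtain ⟨k, hk⟩ := Function.ne_iff.1 hc
  let A : Matrix (Fin (m + 1)) (Fin (m + 1)) L :=
    ((1 : Matrix (Fin (m + 1)) (Fin (m + 1)) L).updateCol k c).submatrix id (Equiv.swap 0 k)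
  have hA : A.det ≠ 0 := by
    rw [Matrix.det_permute', ← Matrix.cramer_apply, Matrix.cramer_one]
    refine mul_ne_zero ?_ hk
    rcases Int.units_eq_one_or (Equiv.Perm.sign (Equiv.swap 0 k)) with h | h <;> simp [h]
  exact ⟨Matrix.GeneralLinearGroup.mkOfDetNeZero A hA, fun i => by
    simp [A, Matrix.GeneralLinearGroup.mkOfDetNeZero]⟩

/-- In the coordinates `y_0, …, y_m` the ideal `(y_0, …, y_{i-1})` is generated by variables. -/
theorem isRegular_of_subst (g : GL (Fin (m + 1)) L) {y : ℕ → MvPolynomial (Fin (m + 1)) L}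
    (hy : ∀ j : Fin (m + 1), y j = subst g (X j)) {i : ℕ} (hi : i ≤ m)
    {f : MvPolynomial (Fin (m + 1)) L} (hf : y i * f ∈ initialIdeal y i) :
    f ∈ initialIdeal y i := by
  have hmap : initialIdeal y i = (Ideal.span (X '' {j : Fin (m + 1) | (j : ℕ) < i})).map
      (subst g).toRingHom := by
    rw [Ideal.map_span, initialIdeal, Set.image_image]
    congr 1
    ext p
    constructor
    · rintro ⟨j, hj, rfl⟩
      exact ⟨⟨j, lt_of_lt_of_le hj (by omega)⟩, hj, (hy _).symm⟩
    · rintro ⟨j, hj, rfl⟩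
      exact ⟨j, hj, hy j⟩
  have hinv (p : MvPolynomial (Fin (m + 1)) L) : subst g (subst g⁻¹ p) = p := by
    rw [subst_subst, mul_inv_cancel, subst_one]
  have hinv' (p : MvPolynomial (Fin (m + 1)) L) : subst g⁻¹ (subst g p) = p := by
    rw [subst_subst, inv_mul_cancel, subst_one]
  have hmem (p : MvPolynomial (Fin (m + 1)) L) : p ∈ initialIdeal y i ↔
      subst g⁻¹ p ∈ Ideal.span (X '' {j : Fin (m + 1) | (j : ℕ) < i}) := by
    rw [hmap]
    constructor
    · intro h
      have h1 := Ideal.mem_map_of_mem (subst g⁻¹).toRingHom h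
      have h2 : (subst g⁻¹).toRingHom.comp (subst g).toRingHom = RingHom.id _ :=
        RingHom.ext hinv'
      rwa [Ideal.map_map, h2, Ideal.map_id] at h1
    · intro h
      rw [← hinv p]
      exact Ideal.mem_map_of_mem (subst g).toRingHom h
  have hX : subst g⁻¹ (y i) = X ⟨i, by omega⟩ := by
    rw [show y i = _ from hy ⟨i, by omega⟩, hinv']
  rw [hmem, map_mul, hX, mem_ideal_span_X_image] at hf
  rw [hmem, mem_ideal_span_X_image]
  intro d hd
  obtain ⟨j, hj, hne⟩ := hf (Finsupp.single ⟨i, by omega⟩ 1 + d) (by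
    rw [mem_support_iff, coeff_X_mul]
    exact mem_support_iff.1 hd)
  refine ⟨j, hj, fun h0 => hne ?_⟩
  have hji : (⟨i, by omega⟩ : Fin (m + 1)) ≠ j := fun h => by
    have h1 : i = j := congrArg Fin.val h
    have h2 : (j : ℕ) < i := hj
    omega
  rw [Finsupp.add_apply, h0, Finsupp.single_apply, if_neg hji]

theorem initialIdeal_eq_of_subst (g : GL (Fin (m + 1)) L) {y : ℕ → MvPolynomial (Fin (m + 1)) L}
    (hy : ∀ j : Fin (m + 1), y j = subst g (X j)) :
    initialIdeal y (m + 1) = Ideal.span (Set.range X) := by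
  rw [initialIdeal]
  refine le_antisymm (Ideal.span_le.2 ?_) (Ideal.span_le.2 ?_)
  · rintro _ ⟨j, hj, rfl⟩
    have h := hy ⟨j, hj⟩
    rw [subst_X] at h
    refine h ▸ Ideal.sum_mem _ fun i _ => Ideal.mul_mem_left _ _ (Ideal.subset_span ⟨i, rfl⟩)
  · rintro _ ⟨j, rfl⟩
    have h : X j = subst g (subst g⁻¹ (X j)) := by rw [subst_subst, mul_inv_cancel, subst_one]
    rw [SetLike.mem_coe, h, subst_X, map_sum]
    refine Ideal.sum_mem _ fun i _ => ?_
    rw [map_mul, ← hy]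
    exact Ideal.mul_mem_left _ _ (Ideal.subset_span ⟨i, i.2, rfl⟩)

/-- A homogeneous ideal `I` defining `m + 2` points in general position is Gorenstein: the pairing
of linear forms modulo `l` is `(f, g) ↦ λ(f g)`, where `λ` is the linear relation between the values
of linear forms at the points. -/
theorem exists_isGorensteinSystem {ι : Type*} [Fintype ι] (hm : 1 ≤ m)
    {v : ι → Fin (m + 1) → L} (hcard : Fintype.card ι = m + 2)
    (hv : ∀ c : Fin (m + 1) → L, c ≠ 0 → ∀ P₀, ∃ P, P ≠ P₀ ∧ c ⬝ᵥ v P ≠ 0)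
    {l : Fin (m + 1) → L} (hl : ∀ P, l ⬝ᵥ v P = 1) {I : Ideal (MvPolynomial (Fin (m + 1)) L)}
    (hI : ∀ p, p ∈ I ↔ ∀ (d : ℕ) P, eval (v P) (comp d p) = 0) :
    ∃ y, IsGorensteinSystem I m y := by
  classical
  obtain ⟨E, lam, hE, hEinj, hrange, hsingle⟩ := exists_dual_of_generalPosition hcard hv
  have : Nonempty ι := Fintype.card_pos_iff.1 (by omega)
  have hEl : E l = 1 := funext fun P => (hE l P).trans (hl P)
  have hl0 : l ≠ 0 := by
    rintro rfl
    simpa using hl (Classical.arbitrary ι)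
  obtain ⟨g, hg⟩ := exists_gl_of_ne_zero hl0
  let c : ℕ → Fin (m + 1) → L := fun j => if h : j < m + 1 then fun i => g.1 i ⟨j, h⟩ else 0
  have hc0 : c 0 = l := by
    funext i
    simp only [c, Nat.zero_lt_succ, dif_pos]
    exact hg i
  have hcg (j : Fin (m + 1)) : c j = fun i => g.1 i j := by
    simp only [c, dif_pos j.2]
  have hsubst (j : Fin (m + 1)) : linForm (c j) = subst g (X j) := by
    rw [hcg, subst_X]
    rfl
  have hind : LinearIndependent L fun j : Fin (m + 1) => c j := by
    simp only [hcg]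
    exact Matrix.linearIndependent_cols_of_isUnit g.isUnit
  have hspan : Submodule.span L (Set.range fun j : Fin (m + 1) => c j) = ⊤ :=
    hind.span_eq_top_of_card_eq_finrank (by simp)
  -- the homogeneous version of the description of `I`
  have hIhom {d : ℕ} {p : MvPolynomial (Fin (m + 1)) L} (hp : p.IsHomogeneous d) :
      p ∈ I ↔ ∀ P, eval (v P) p = 0 := by
    have h1 := comp_eq_self (isHomogeneousOfDegree_natCast.2 hp)
    rw [hI]
    refine ⟨fun h P => ?_, fun h e P => ?_⟩
    · rw [← h1]
      exact h d P
    · by_cases he : (e : ℤ) = d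
      · rw [he, h1, h]
      · have : comp e p = 0 := by
          rw [← h1]
          ext x
          rw [coeff_comp, coeff_comp, coeff_zero]
          split_ifs with h2 h3
          · exact absurd (h2.symm.trans h3) he
          · rfl
          · rfl
        rw [this, map_zero]
  have hll : IsHomogeneousOfDegree (linForm l) 1 := Or.inr ⟨1, rfl, isHomogeneous_linForm l⟩
  have hlev (P : ι) : eval (v P) (linForm l) = 1 := by rw [eval_linForm, hl]
  have hmem {d : ℕ} {f : MvPolynomial (Fin (m + 1)) L} (hf : f.IsHomogeneous (d + 1)) :
      f ∈ I ⊔ Ideal.span {linForm l} ↔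
        ∃ h : MvPolynomial (Fin (m + 1)) L, h.IsHomogeneous d ∧
          ∀ P, eval (v P) f = eval (v P) h := by
    rw [mem_sup_span_singleton]
    constructor
    · rintro ⟨a, ha⟩
      have h2 : (comp (d : ℤ) a).IsHomogeneous d :=
        isHomogeneousOfDegree_natCast.1 (isHomogeneousOfDegree_comp _ _)
      refine ⟨comp d a, h2, fun P => ?_⟩
      have h3 := (hI _).1 ha (d + 1) P
      rw [map_sub, comp_mul hll, comp_eq_self (isHomogeneousOfDegree_natCast.2 hf)] at h3
      push_cast at h3
      rw [add_sub_cancel_right, map_sub, map_mul, hlev, one_mul] at h3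
      exact sub_eq_zero.1 h3
    · rintro ⟨h, hh, hfh⟩
      have hlh : (linForm l * h).IsHomogeneous (d + 1) := by
        rw [mul_comm]
        exact hh.mul (isHomogeneous_linForm l)
      refine ⟨h, (hIhom (hf.sub hlh)).2 fun P => ?_⟩
      · rw [map_sub, map_mul, hlev, one_mul, hfh, sub_self]
  have hquad {f : MvPolynomial (Fin (m + 1)) L} (hf : f.IsHomogeneous 2) :
      f ∈ I ⊔ Ideal.span {linForm l} ↔ lam (fun P => eval (v P) f) = 0 := by
    rw [hmem hf, ← LinearMap.mem_ker, ← hrange]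
    constructor
    · rintro ⟨h, hh, hfh⟩
      obtain ⟨b, rfl⟩ := exists_linForm_eq hh
      exact ⟨b, funext fun P => by rw [hE, hfh, eval_linForm]⟩
    · rintro ⟨b, hb⟩
      exact ⟨linForm b, isHomogeneous_linForm b, fun P => by
        rw [eval_linForm, ← hE, hb]⟩
  have hmul (a b : Fin (m + 1) → L) :
      linForm a * linForm b ∈ I ⊔ Ideal.span {linForm l} ↔ lam (E a * E b) = 0 := by
    rw [hquad ((isHomogeneous_linForm a).mul (isHomogeneous_linForm b))]
    have : (fun P => eval (v P) (linForm a * linForm b)) = E a * E b := by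
      funext P
      rw [map_mul, eval_linForm, eval_linForm, Pi.mul_apply, hE, hE]
    rw [this]
  have hzero (d : ℕ) (hd : d ≤ 1) (f : MvPolynomial (Fin (m + 1)) L) (hf : f.IsHomogeneous d)
      (hfI : f ∈ I) : f = 0 := by
    have h1 := (hIhom hf).1 hfI
    interval_cases d
    · rw [← totalDegree_zero_iff_isHomogeneous, totalDegree_eq_zero_iff_eq_C] at hf
      have := h1 (Classical.arbitrary ι)
      rw [hf, eval_C] at this
      rw [hf, this, map_zero]
    · obtain ⟨a, rfl⟩ := exists_linForm_eq hf
      have : a = 0 := hEinj (funext fun P => by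
        rw [hE, map_zero, ← eval_linForm]
        exact h1 P)
      rw [this, map_zero]
  have hpair {i : ℕ} (hi : 1 ≤ i) (him : i ≤ m) :=
    exists_pairing_ne_zero hEinj hrange hsingle (by rw [hc0, hEl]) hind hi him
  refine ⟨fun j => linForm (c j), ⟨fun j => isHomogeneous_linForm _,
    fun i hi f hf => isRegular_of_subst g hsubst hi hf, initialIdeal_eq_of_subst g hsubst,
    ?_, ?_, ?_, ?_, ?_, hzero⟩⟩
  · intro f hf
    rw [hc0] at hf
    rw [hI] at hf ⊢
    intro d P
    have := hf (d + 1) P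
    rw [comp_mul hll] at this
    push_cast at this
    rwa [add_sub_cancel_right, map_mul, hlev, one_mul] at this
  · intro d hd f hf
    obtain ⟨d, rfl⟩ : ∃ e, d = e + 3 := ⟨d - 3, by omega⟩
    obtain ⟨b, -, hb⟩ := hpair le_rfl hm
    rw [hc0, hmem hf]
    -- combinations of `c₁ b` and the products with `l` take all values at the points
    let q : ι → L := E (c 1) * E b
    let w : ι → L := fun P => eval (v P) f
    have h1 : w - (lam w / lam q) • q ∈ LinearMap.range E := by
      rw [hrange, LinearMap.mem_ker, map_sub, map_smul, smul_eq_mul, div_mul_cancel₀ _ hb, sub_self]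
    obtain ⟨a, ha⟩ := h1
    have hlp : (linForm l ^ d).IsHomogeneous d := by
      simpa using (isHomogeneous_linForm l).pow d
    refine ⟨linForm l ^ d * (linForm l * linForm a +
      C (lam w / lam q) * (linForm (c 1) * linForm b)), ?_, fun P => ?_⟩
    · refine hlp.mul (((isHomogeneous_linForm l).mul (isHomogeneous_linForm a)).add ?_)
      simpa using (isHomogeneous_C (Fin (m + 1)) (lam w / lam q)).mul
        ((isHomogeneous_linForm (c 1)).mul (isHomogeneous_linForm b))
    · have h2 := congrFun ha P
      simp only [map_mul, map_pow, map_add, hlev, one_pow, one_mul, eval_C, eval_linForm, ← hE, h2]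
      simp [w, q]
  · intro f h hf hh
    rw [hc0]
    have key (a b : L) : C a * f + C b * h ∈ I ⊔ Ideal.span {linForm l} ↔
        a * lam (fun P => eval (v P) f) + b * lam (fun P => eval (v P) h) = 0 := by
      rw [hquad]
      · have : (fun P => eval (v P) (C a * f + C b * h)) =
            a • (fun P => eval (v P) f) + b • fun P => eval (v P) h := by
          funext P
          simp
        rw [this, map_add, map_smul, map_smul, smul_eq_mul, smul_eq_mul]
      · simpa using ((isHomogeneous_C (Fin (m + 1)) a).mul hf).add
          ((isHomogeneous_C (Fin (m + 1)) b).mul hh)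
    simp only [key]
    by_cases h0 : lam (fun P => eval (v P) f) = 0
    · exact ⟨1, 0, Or.inl one_ne_zero, by simp [h0]⟩
    · exact ⟨-lam (fun P => eval (v P) h), lam (fun P => eval (v P) f), Or.inr h0, by ring⟩
  · intro i hi him
    obtain ⟨b, hb, hb'⟩ := hpair hi him
    rw [hc0]
    exact ⟨linForm b, isHomogeneous_linForm b, fun t ht hti => (hmul _ _).2 (hb t ht hti),
      fun h => hb' ((hmul _ _).1 h)⟩
  · intro d hd f hf h
    rw [hc0] at h ⊢
    interval_cases d
    · rw [← totalDegree_zero_iff_isHomogeneous, totalDegree_eq_zero_iff_eq_C] at hf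
      rw [hf]
      by_contra hne
      have ha : coeff 0 f ≠ 0 := fun h0 => hne (by rw [h0, map_zero]; exact Ideal.zero_mem _)
      -- a nonzero constant `f` would give `y₁ ∈ I + (l)`
      obtain ⟨b, -, hb⟩ := hpair le_rfl hm
      refine hb ((hmul _ _).1 ?_)
      have h1 := h 1 le_rfl hm
      rw [hf] at h1
      have h2 := Ideal.mul_mem_right (C (coeff 0 f)⁻¹ * linForm b) _ h1
      convert h2 using 1
      rw [show linForm (c 1) * C (coeff 0 f) * (C (coeff 0 f)⁻¹ * linForm b) =
        C (coeff 0 f * (coeff 0 f)⁻¹) * (linForm (c 1) * linForm b) by rw [C_mul]; ring,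
        mul_inv_cancel₀ ha, map_one, one_mul]
    · obtain ⟨a, rfl⟩ := exists_linForm_eq hf
      have h1 : ∀ b, lam (E a * E b) = 0 := by
        have h2 : LinearMap.ker ((lam.comp (LinearMap.mulLeft L (E a))).comp E) = ⊤ := by
          rw [eq_top_iff, ← hspan, Submodule.span_le]
          rintro _ ⟨t, rfl⟩
          refine Eq.trans ?_ ((hmul (c t) a).1 ?_)
          · simp [mul_comm]
          · by_cases ht : (t : ℕ) = 0
            · rw [ht, hc0]
              exact Ideal.mul_mem_right _ _
                (Ideal.mem_sup_right (Ideal.mem_span_singleton_self _))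
            · exact h t (by omega) (by omega)
        intro b
        have : b ∈ LinearMap.ker ((lam.comp (LinearMap.mulLeft L (E a))).comp E) := by
          rw [h2]; trivial
        exact this
      obtain ⟨r, rfl⟩ := eq_smul_of_pairing_eq_zero hEinj hrange hsingle hEl h1
      rw [map_smul, smul_eq_C_mul]
      exact Ideal.mul_mem_left _ _ (Ideal.mem_sup_right (Ideal.mem_span_singleton_self _))

end


/-! ### The ideal of a set of points -/

theorem aeval_smul_of_isHomogeneous {σ K L : Type*} [Fintype σ] [CommRing K] [CommRing L]
    [Algebra K L] {p : MvPolynomial σ K} {d : ℕ} (hp : p.IsHomogeneous d) (s : L) (x : σ → L) :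
    aeval (s • x) p = s ^ d * aeval x p := by
  rw [aeval_def, aeval_def, eval₂_eq', eval₂_eq', Finset.mul_sum]
  refine Finset.sum_congr rfl fun e he => ?_
  have h : ∑ i, e i = d := by
    rw [← Finsupp.degree_eq_sum]
    by_contra hne
    exact mem_support_iff.1 he (hp.coeff_eq_zero hne)
  simp only [Pi.smul_apply, smul_eq_mul, mul_pow, Finset.prod_mul_distrib,
    Finset.prod_pow_eq_pow_sum,
    h]
  ring

theorem sum_comp {σ K : Type*} [CommRing K] (p : MvPolynomial σ K) :
    ∑ d ∈ Finset.range (p.totalDegree + 1), comp (d : ℤ) p = p := by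
  conv_rhs => rw [← sum_homogeneousComponent p]
  exact Finset.sum_congr rfl fun d _ => by simp [comp]

theorem isHomogeneous_comp {σ K : Type*} [CommRing K] (d : ℕ) (p : MvPolynomial σ K) :
    (comp (d : ℤ) p).IsHomogeneous d :=
  isHomogeneousOfDegree_natCast.1 (isHomogeneousOfDegree_comp _ _)

theorem comp_eq_zero_of_totalDegree_lt {σ K : Type*} [CommRing K] {p : MvPolynomial σ K} {d : ℕ}
    (h : p.totalDegree < d) : comp (d : ℤ) p = 0 := by
  simp [comp, homogeneousComponent_eq_zero d p h]

section

variable {K L : Type*} [Field K] [Field L] [Algebra K L] {m : ℕ}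
  {X : Finset (ℙ L (Fin (m + 1) → L))}

theorem smul_mem_cone {x : Fin (m + 1) → L} (hx : x ∈ cone X) {s : L} (hs : s ≠ 0) :
    s • x ∈ cone X := by
  obtain ⟨h0, h⟩ := hx
  refine ⟨smul_ne_zero hs h0, ?_⟩
  rwa [(Projectivization.mk_eq_mk_iff' L (s • x) x _ h0).2 ⟨s, rfl⟩]

/-- The ideal of a set of points over an infinite field is homogeneous. -/
theorem mem_vanishingIdeal_cone_iff [Infinite L] {p : MvPolynomial (Fin (m + 1)) K} :
    p ∈ vanishingIdeal K (cone X) ↔ ∀ (d : ℕ), ∀ x ∈ cone X, aeval x (comp (d : ℤ) p) = 0 := by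
  rw [mem_vanishingIdeal_iff]
  constructor
  · intro h d x hx
    -- the value of `p` at `s • x` is a polynomial in `s` that vanishes for `s ≠ 0`
    let Q : Polynomial L := ∑ e ∈ Finset.range (p.totalDegree + 1),
      Polynomial.monomial e (aeval x (comp (e : ℤ) p))
    have hQ : Q = 0 := by
      refine Polynomial.eq_zero_of_infinite_isRoot Q
        ((Set.infinite_univ.sdiff (Set.finite_singleton (0 : L))).mono fun s hs => ?_)
      have h1 := h _ (smul_mem_cone hx (s := s) (by simpa using hs))
      rw [← sum_comp p, map_sum] at h1
      change Q.eval s = 0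
      rw [← h1, Polynomial.eval_finsetSum]
      refine Finset.sum_congr rfl fun e _ => ?_
      rw [Polynomial.eval_monomial, aeval_smul_of_isHomogeneous (isHomogeneous_comp e p), mul_comm]
    have h2 := congrArg (fun q => Polynomial.coeff q d) hQ
    simp only [Q, Polynomial.finsetSum_coeff, Polynomial.coeff_monomial, Polynomial.coeff_zero,
      Finset.sum_ite_eq', Finset.mem_range] at h2
    by_cases hd : d < p.totalDegree + 1
    · rwa [if_pos hd] at h2
    · rw [comp_eq_zero_of_totalDegree_lt (by omega), map_zero]
  · intro h x hx
    rw [← sum_comp p, map_sum]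
    exact Finset.sum_eq_zero fun d _ => h d x hx

theorem constantCoeff_eq_zero_of_mem_vanishingIdeal [Infinite L] (hX : X.Nonempty)
    {p : MvPolynomial (Fin (m + 1)) K} (hp : p ∈ vanishingIdeal K (cone X)) :
    constantCoeff p = 0 := by
  obtain ⟨P, hP⟩ := hX
  have h := mem_vanishingIdeal_cone_iff.1 hp 0 P.rep ⟨P.rep_nonzero, by rwa [P.mk_rep]⟩
  rw [Nat.cast_zero, comp_zero, aeval_C] at h
  exact (algebraMap K L).injective (h.trans (map_zero _).symm)

end

/-- The coordinate vectors of the points are normalized by a linear form `l` that vanishes at none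
of them; it exists because the field is infinite. -/
theorem IsPointsInGeneralPosition.exists_isGorensteinSystem {K : Type*} [Field K] {m : ℕ}
    (hm : 1 ≤ m) {X : Finset (ℙ (AlgebraicClosure K) (Fin (m + 1) → AlgebraicClosure K))}
    (hX : IsPointsInGeneralPosition K X) :
    ∃ y, IsGorensteinSystem (vanishingIdeal (AlgebraicClosure K) (cone X)) m y := by
  classical
  set L := AlgebraicClosure K with hL
  have hinf : Infinite L := IsAlgClosed.instInfinite
  obtain ⟨f, hf⟩ := Module.exists_dual_forall_apply_ne_zero (K := L)
    (fun P : X => P.1.rep) fun P => P.1.rep_nonzero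
  let v : X → Fin (m + 1) → L := fun P => (f P.1.rep)⁻¹ • P.1.rep
  let l : Fin (m + 1) → L := fun i => f (Pi.single i 1)
  have hl (x : Fin (m + 1) → L) : l ⬝ᵥ x = f x := by
    conv_rhs => rw [pi_eq_sum_univ' x, map_sum]
    simp only [dotProduct, l, map_smul, smul_eq_mul]
    exact Finset.sum_congr rfl fun i _ => by rw [mul_comm]
  have hvcone (P : X) : v P ∈ cone X :=
    smul_mem_cone ⟨P.1.rep_nonzero, by rw [Projectivization.mk_rep]; exact P.2⟩ (inv_ne_zero (hf P))
  have hcone (x : Fin (m + 1) → L) (hx : x ∈ cone X) : ∃ (P : X) (s : L), x = s • v P := by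
    obtain ⟨h0, hx⟩ := hx
    obtain ⟨a, ha⟩ := (Projectivization.mk_eq_mk_iff' L x (Projectivization.mk L x h0).rep h0
      (Projectivization.rep_nonzero _)).1 (Projectivization.mk_rep _).symm
    refine ⟨⟨_, hx⟩, a * f (Projectivization.mk L x h0).rep, ?_⟩
    rw [smul_smul, mul_assoc, mul_inv_cancel₀ (hf ⟨_, hx⟩), mul_one]
    exact ha.symm
  refine PointsResolution.exists_isGorensteinSystem (v := v) (l := l) hm ?_ (fun c hc P₀ => ?_)
    (fun P => ?_) (fun p => ?_)
  · rw [Fintype.card_coe, hX.card_eq]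
  · obtain ⟨P, hP, hne⟩ := hX.not_in_hyperplane (X.erase P₀) (Finset.erase_subset _ _)
      (by rw [Finset.card_erase_of_mem P₀.2, hX.card_eq]; rfl)
      { toFun := fun x => c ⬝ᵥ x
        map_add' := dotProduct_add c
        map_smul' := fun a x => dotProduct_smul a c x }
      (fun h => hc (dotProduct_eq_zero_iff.1 fun x => by
        exact LinearMap.congr_fun h x))
    refine ⟨⟨P, Finset.mem_of_mem_erase hP⟩, fun h =>
      Finset.ne_of_mem_erase hP (congrArg Subtype.val h), ?_⟩
    rw [dotProduct_smul, smul_eq_mul]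
    exact mul_ne_zero (inv_ne_zero (hf ⟨P, _⟩)) hne
  · rw [hl, map_smul, smul_eq_mul, inv_mul_cancel₀ (hf P)]
  · rw [mem_vanishingIdeal_cone_iff]
    refine ⟨fun h d P => h d _ (hvcone P), fun h d x hx => ?_⟩
    obtain ⟨P, s, rfl⟩ := hcone x hx
    rw [aeval_smul_of_isHomogeneous (isHomogeneous_comp d p)]
    exact mul_eq_zero_of_right _ (h d P)


/-! ### Extension of the base field -/

/-- The map on polynomials that applies the additive map `f` to all the coefficients. -/
noncomputable def mapCoeff {σ K L : Type*} [CommSemiring K] [CommSemiring L] (f : L →+ K)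
    (p : MvPolynomial σ L) : MvPolynomial σ K :=
  ∑ d ∈ p.support, monomial d (f (coeff d p))

theorem coeff_mapCoeff {σ K L : Type*} [CommSemiring K] [CommSemiring L] (f : L →+ K)
    (p : MvPolynomial σ L) (d : σ →₀ ℕ) : coeff d (mapCoeff f p) = f (coeff d p) := by
  classical
  rw [mapCoeff, coeff_sum]
  simp only [coeff_monomial, Finset.sum_ite_eq']
  split_ifs with h
  · rfl
  · rw [notMem_support_iff.1 h, map_zero]

theorem mapCoeff_zero {σ K L : Type*} [CommSemiring K] [CommSemiring L] (f : L →+ K) :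
    mapCoeff f (0 : MvPolynomial σ L) = 0 := by
  simp [mapCoeff]

section

variable {σ K L : Type*} [Field K] [Field L] [Algebra K L]

theorem mapCoeff_map_mul (f : L →ₗ[K] K) (p : MvPolynomial σ K) (q : MvPolynomial σ L) :
    mapCoeff f.toAddMonoidHom (map (algebraMap K L) p * q) =
      p * mapCoeff f.toAddMonoidHom q := by
  classical
  ext d
  rw [coeff_mapCoeff, coeff_mul, coeff_mul, map_sum]
  refine Finset.sum_congr rfl fun x _ => ?_
  rw [coeff_mapCoeff, coeff_map, ← Algebra.smul_def]
  exact f.map_smul _ _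

theorem mapCoeff_mulVec {a b : ℕ} (f : L →ₗ[K] K)
    (A : Matrix (Fin a) (Fin b) (MvPolynomial σ K)) (z : Fin b → MvPolynomial σ L) (i : Fin a) :
    mapCoeff f.toAddMonoidHom ((A.map (map (algebraMap K L))).mulVec z i) =
      A.mulVec (fun j => mapCoeff f.toAddMonoidHom (z j)) i := by
  simp only [Matrix.mulVec, dotProduct, Matrix.map_apply, ← mapCoeff_map_mul]
  ext d
  simp only [coeff_mapCoeff, coeff_sum, map_sum]

/-- A vector of polynomials over `L` is a combination, with coefficients in a basis of `L` over `K`,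
of vectors of polynomials over `K`. -/
theorem exists_eq_sum_C_mul_map_mapCoeff {ι : Type*} (b : Module.Basis ι K L) {n : ℕ}
    (z : Fin n → MvPolynomial σ L) : ∃ s : Finset ι, ∀ j, z j = ∑ β ∈ s, C (b β) *
      map (algebraMap K L) (mapCoeff (b.coord β).toAddMonoidHom (z j)) := by
  classical
  let s : Finset ι := Finset.univ.biUnion fun j : Fin n =>
    (z j).support.biUnion fun d => (b.repr (coeff d (z j))).support
  refine ⟨s, fun j => ?_⟩
  ext d
  have h : (b.repr (coeff d (z j))).support ⊆ s := by
    intro β hβ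
    have hd : d ∈ (z j).support := by
      by_contra h
      rw [notMem_support_iff.1 h] at hβ
      simp at hβ
    exact Finset.mem_biUnion.2 ⟨j, Finset.mem_univ _, Finset.mem_biUnion.2 ⟨d, hd, hβ⟩⟩
  conv_lhs => rw [← b.linearCombination_repr (coeff d (z j)), Finsupp.linearCombination_apply,
    Finsupp.sum_of_support_subset _ h _ (by simp)]
  rw [coeff_sum]
  refine Finset.sum_congr rfl fun β _ => ?_
  rw [coeff_C_mul, coeff_map, coeff_mapCoeff, Algebra.smul_def, mul_comm]
  rfl

/-- Exactness over `K` is applied to each of the components with respect to a basis of `L`. -/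
theorem exact_map_mulVecLin {a b c : ℕ} {A : Matrix (Fin a) (Fin b) (MvPolynomial σ K)}
    {B : Matrix (Fin b) (Fin c) (MvPolynomial σ K)}
    (h : Function.Exact B.mulVecLin A.mulVecLin) :
    Function.Exact (B.map (map (algebraMap K L))).mulVecLin
      (A.map (map (algebraMap K L))).mulVecLin := by
  intro z
  simp only [Matrix.mulVecLin_apply, Set.mem_range]
  constructor
  · intro hz
    let β := Module.Basis.ofVectorSpace K L
    obtain ⟨s, hs⟩ := exists_eq_sum_C_mul_map_mapCoeff β z
    have hz' (t) : A.mulVec (fun j => mapCoeff (β.coord t).toAddMonoidHom (z j)) = 0 := by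
      funext i
      rw [← mapCoeff_mulVec, hz]
      exact mapCoeff_zero _
    choose u hu using fun t => (h _).1 (hz' t)
    refine ⟨fun k => ∑ t ∈ s, C (β t) * map (algebraMap K L) (u t k), funext fun j => ?_⟩
    rw [hs j]
    simp only [Matrix.mulVec, dotProduct, Finset.mul_sum, Matrix.map_apply]
    rw [Finset.sum_comm]
    refine Finset.sum_congr rfl fun t _ => ?_
    rw [← congrFun (hu t) j, Matrix.mulVecLin_apply, Matrix.mulVec, dotProduct, map_sum,
      Finset.mul_sum]
    exact Finset.sum_congr rfl fun k _ => by rw [map_mul]; ring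
  · rintro ⟨u, rfl⟩
    have h1 : A * B = 0 := by
      have h2 := h.linearMap_comp_eq_zero
      rw [← Matrix.mulVecLin_mul] at h2
      exact Matrix.toLin'.injective (by rw [map_zero]; exact h2)
    rw [Matrix.mulVec_mulVec, ← Matrix.map_mul, h1]
    simp

/-- The sequence of matrices obtained by extending the field of coefficients. -/
noncomputable def FreeSequence.baseChange (L : Type*) [Field L] [Algebra K L]
    (F : FreeSequence σ K) : FreeSequence σ L where
  rank := F.rank
  deg := F.deg
  diff k := (F.diff k).map (map (algebraMap K L))

theorem FreeSequence.IsMinimalCyclicResolution.baseChange (L : Type*) [Field L] [Algebra K L]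
    {F : FreeSequence σ K} {I : Ideal (MvPolynomial σ K)} (hF : F.IsMinimalCyclicResolution I) :
    (F.baseChange L).IsMinimalCyclicResolution (I.map (map (algebraMap K L))) where
  rank_zero := hF.rank_zero
  deg_zero := hF.deg_zero
  graded k i j := by
    rcases hF.graded k i j with h | ⟨d, hd, h⟩
    · exact Or.inl (by
        change map (algebraMap K L) (F.diff k i j) = 0
        rw [h, map_zero])
    · exact Or.inr ⟨d, hd, h.map _⟩
  exact k := exact_map_mulVecLin (hF.exact k)
  minimal k i j := by
    have h := Ideal.mem_map_of_mem (map (algebraMap K L)) (hF.minimal k i j)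
    rw [Ideal.map_span, ← Set.range_comp] at h
    have hX : map (algebraMap K L) ∘ X = (X : σ → MvPolynomial σ L) := funext fun s => map_X _ s
    rwa [hX] at h
  range z := by
    have hsub : ∀ s t : Fin (F.rank 0), s = t := fun s t => Fin.ext (by
      have := s.2; have := t.2; have := hF.rank_zero; omega)
    constructor
    · rintro ⟨u, rfl⟩ s
      change ∑ j, map (algebraMap K L) (F.diff 0 s j) * u j ∈ _
      refine Ideal.sum_mem _ fun j _ => Ideal.mul_mem_right _ _ ?_
      refine Ideal.mem_map_of_mem (map (algebraMap K L)) ?_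
      exact (hF.range ((F.diff 0).col j)).1 ⟨Pi.single j 1, Matrix.mulVec_single_one _ _⟩ s
    · intro hz
      let s : Fin (F.rank 0) := ⟨0, by rw [hF.rank_zero]; exact Nat.one_pos⟩
      have key : ∀ x ∈ I.map (map (algebraMap K L)),
          ∃ u, ((F.baseChange L).diff 0).mulVec u = fun _ => x := by
        intro x hx
        refine Submodule.span_induction (p := fun x _ =>
          ∃ u, ((F.baseChange L).diff 0).mulVec u = fun _ => x) ?_ ?_ ?_ ?_ hx
        · rintro _ ⟨p, hp, rfl⟩
          obtain ⟨u, hu⟩ := (hF.range fun _ => p).2 fun _ => hp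
          refine ⟨fun j => map (algebraMap K L) (u j), funext fun i => ?_⟩
          change _ = map (algebraMap K L) p
          rw [← congrFun hu i]
          simp only [Matrix.mulVec, dotProduct, map_sum, map_mul]
          rfl
        · exact ⟨0, Matrix.mulVec_zero _⟩
        · rintro x y - - ⟨u, hu⟩ ⟨u', hu'⟩
          exact ⟨u + u', by rw [Matrix.mulVec_add, hu, hu']; rfl⟩
        · rintro a x - ⟨u, hu⟩
          exact ⟨a • u, by rw [Matrix.mulVec_smul, hu]; rfl⟩
      obtain ⟨u, hu⟩ := key _ (hz s)
      exact ⟨u, hu.trans (funext fun t => by rw [hsub s t])⟩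

/-! ### Minimal free resolutions of cyclic modules -/

/-- By minimality and Nakayama's lemma `F_0` is generated by one element, which the augmentation
sends to a unit. -/
theorem FreeSequence.IsMinimalFreeResolution.isMinimalCyclicResolution {F : FreeSequence σ K}
    {I : Ideal (MvPolynomial σ K)} (hF : F.IsMinimalFreeResolution I)
    (hI : ∀ p ∈ I, constantCoeff p = 0) : F.IsMinimalCyclicResolution I := by
  classical
  obtain ⟨ε, hsurj, hexact, hp⟩ := hF.augmentation
  choose p hpdeg hεp using hp
  have hε (z : Fin (F.rank 0) → MvPolynomial σ K) :
      ε z = Ideal.Quotient.mk I (∑ i, z i * p i) := by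
    conv_lhs => rw [pi_eq_sum_univ' z, map_sum]
    rw [map_sum]
    refine Finset.sum_congr rfl fun i _ => ?_
    rw [map_smul, map_mul, ← hεp]
    rfl
  have hker (z : Fin (F.rank 0) → MvPolynomial σ K) :
      (∃ u, (F.diff 0).mulVec u = z) ↔ ∑ i, z i * p i ∈ I := by
    rw [← Ideal.Quotient.eq_zero_iff_mem, ← hε]
    exact (hexact z).symm
  have hX (q : MvPolynomial σ K) (hq : q ∈ Ideal.span (Set.range (X : σ → MvPolynomial σ K))) :
      constantCoeff q = 0 := by
    have : Ideal.span (Set.range (X : σ → MvPolynomial σ K)) ≤ RingHom.ker constantCoeff :=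
      Ideal.span_le.2 (by rintro _ ⟨i, rfl⟩; simp)
    exact this hq
  have hmin (z) (hz : ∃ u, (F.diff 0).mulVec u = z) (i) : constantCoeff (z i) = 0 := by
    obtain ⟨u, rfl⟩ := hz
    rw [Matrix.mulVec, dotProduct, map_sum]
    exact Finset.sum_eq_zero fun j _ => by
      rw [map_mul, hX _ (hF.minimal 0 i j), zero_mul]
  -- by surjectivity some `p i` has a constant term
  obtain ⟨i, hi⟩ : ∃ i, constantCoeff (p i) ≠ 0 := by
    by_contra! h
    obtain ⟨z, hz⟩ := hsurj (Ideal.Quotient.mk I 1)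
    rw [hε, Ideal.Quotient.eq] at hz
    have h1 := hI _ hz
    rw [map_sub, map_sum, map_one, Finset.sum_eq_zero fun i _ => by rw [map_mul, h, mul_zero]] at h1
    simp at h1
  -- the Koszul relation `p_i e_j - p_j e_i` is in the image of `F_1`, hence in `𝔪 F_0`
  have huniq (j : Fin (F.rank 0)) : j = i := by
    by_contra hne
    have h1 := hmin (p i • Pi.single j 1 - p j • Pi.single i 1) ((hker _).2 ?_) j
    · simp [hne] at h1
      exact hi h1
    · simp [mul_sub, Finset.sum_sub_distrib, Pi.single_apply, mul_comm]
  have hrank : F.rank 0 = 1 := by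
    rw [← Fintype.card_fin (F.rank 0)]
    exact Fintype.card_eq_one_iff.2 ⟨i, huniq⟩
  have hdeg : F.deg 0 i = 0 := by
    have := isHomogeneousOfDegree_iff.1 (hpdeg i) 0 (by rwa [← constantCoeff_eq])
    simpa using this.symm
  have hpi : p i = C (constantCoeff (p i)) := by
    have h1 := hpdeg i
    rw [hdeg, ← Nat.cast_zero, isHomogeneousOfDegree_natCast,
      ← totalDegree_zero_iff_isHomogeneous] at h1
    rw [constantCoeff_eq]
    exact totalDegree_eq_zero_iff_eq_C.1 h1
  refine ⟨hrank, fun j => by rw [huniq j, hdeg], hF.graded, hF.exact, hF.minimal, fun z => ?_⟩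
  have hsum : ∑ j, z j * p j = z i * p i :=
    Finset.sum_eq_single i (fun j _ hj => absurd (huniq j) hj) (by simp)
  rw [hker, hsum]
  constructor
  · intro h s
    rw [huniq s]
    have h1 := Ideal.mul_mem_right (C (constantCoeff (p i))⁻¹) I h
    have h2 : p i * C (constantCoeff (p i))⁻¹ = 1 := by
      nth_rewrite 1 [hpi]
      rw [← C_mul, mul_inv_cancel₀ hi, C_1]
    rwa [mul_assoc, h2, mul_one] at h1
  · exact fun h => Ideal.mul_mem_right _ _ (h i)

end


theorem IsPointsInGeneralPosition.isMinimalCyclicResolution {K : Type*} [Field K] {m : ℕ}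
    {X : Finset (ℙ (AlgebraicClosure K) (Fin (m + 1) → AlgebraicClosure K))}
    (hX : IsPointsInGeneralPosition K X) {F : FreeSequence (Fin (m + 1)) K}
    (hF : F.IsMinimalFreeResolution (homogeneousIdeal K X)) :
    F.IsMinimalCyclicResolution (homogeneousIdeal K X) := by
  have : Infinite (AlgebraicClosure K) := IsAlgClosed.instInfinite
  refine hF.isMinimalCyclicResolution fun p hp =>
    constantCoeff_eq_zero_of_mem_vanishingIdeal (Finset.card_pos.1 ?_) hp
  rw [hX.card_eq]
  omega

/-- The ranks and degrees are computed after extension of the base field to the algebraic closure,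
where a linear form exists that vanishes at none of the points. -/
theorem IsPointsInGeneralPosition.isGorensteinLinear {K : Type*} [Field K] {m : ℕ} (hm : 1 ≤ m)
    {X : Finset (ℙ (AlgebraicClosure K) (Fin (m + 1) → AlgebraicClosure K))}
    (hX : IsPointsInGeneralPosition K X) {F : FreeSequence (Fin (m + 1)) K}
    (hF : F.IsMinimalFreeResolution (homogeneousIdeal K X)) : F.IsGorensteinLinear m := by
  obtain ⟨y, hy⟩ := hX.exists_isGorensteinSystem hm
  have h := (hX.isMinimalCyclicResolution hF).baseChange (AlgebraicClosure K)
  rw [← hX.defined_over] at h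
  obtain ⟨h1, h2⟩ :=
    FreeSequence.rank_and_deg_top (F := F.baseChange (AlgebraicClosure K)) h hy hm
  exact ⟨h1, FreeSequence.rank_eq_zero (F := F.baseChange _) h hy, fun k hk s =>
    FreeSequence.deg_eq (F := F.baseChange _) h hy hk s, h2⟩

end PointsResolution

theorem mainTheorem4 {K : Type*} [Field K] (hK : (2 : K) ≠ 0) (m : ℕ) (hm : 1 ≤ m)
    (X : Finset (ℙ (AlgebraicClosure K) (Fin (m + 1) → AlgebraicClosure K)))
    (hX : PointsResolution.IsPointsInGeneralPosition K X)
    (F : PointsResolution.FreeSequence (Fin (m + 1)) K)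
    (hF : F.IsMinimalFreeResolution (PointsResolution.homogeneousIdeal K X))
    (g : GL (Fin (m + 1)) K) :
    F.rank 0 = 1 ∧ F.rank m = 1 ∧
    ∀ (s : Fin (F.rank 0)) (t : Fin (F.rank m)),
      ∃ (h : ∀ j, F.omega j s t ∈ PointsResolution.Forms K m 2)
        (h' : ∀ j, (F.changeCoordinates g).omega j s t ∈ PointsResolution.Forms K m 2),
        PointsResolution.tensorOf (fun j => ⟨(F.changeCoordinates g).omega j s t, h' j⟩) =
          Matrix.det (g : Matrix (Fin (m + 1)) (Fin (m + 1)) K) •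
            PointsResolution.actTensor g
              (PointsResolution.tensorOf (fun j => ⟨F.omega j s t, h j⟩)) := by
  have hF' := hX.isMinimalCyclicResolution hF
  have hD := hX.isGorensteinLinear hm hF
  obtain ⟨n, rfl⟩ : ∃ n, m = n + 1 := ⟨m - 1, by omega⟩
  exact ⟨hF'.rank_zero, hD.rank_top, fun s t =>
    PointsResolution.tensorOf_omega_changeCoordinates hK hF' hD s t g⟩
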